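/- **Conventions.** Let $X\neq\{0\}$ be a complex Banach space, let $E=\ell^2(\mathbb Z,X)$ be the Banach space of sequences $x=(x_j)_{j\in\mathbb Z}$ in $X$ with $\|x\|=(\sum_j\|x_j\|^2)^{1/2}<\infty$, and let $A\in L(E)$ be a bounded operator with matrix representation $[a_{i,j}]_{i,j\in\mathbb Z}$, $a_{i,j}\in L(X)$. For a bounded operator $B$ on a Banach space put $\|B^{-1}\|:=\infty$ if $B$ is not invertible, $1/\infty:=0$, and let $$\mathrm{Spec}_\varepsilon B=\{\lambda\in\mathbb C:1/\|(B-\lambda I)^{-1}\|\le\varepsilon\}\ (\varepsilon\ge 0),\qquad \mathrm{spec}_\varepsilon B=\{\lambda\in\mathbb C:1/\|(B-\lambda I)^{-1}\|<\varepsilon\}\ (\varepsilon>0),$$ so that $\mathrm{Spec}_0B=\mathrm{Spec}\,B$ is the spectrum. For $n\in\mathbb N=\{1,2,\dots\}$ and $k\in\mathbb Z$ let $A_{n,k}=[a_{i,j}]_{i,j=k+1}^{k+n}$, acting on $X^n$ with norm $(\sum_{j=1}^n\|x_j\|^2)^{1/2}$, and let $$\sigma^n_\varepsilon(A)=\bigcup_{k\in\mathbb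 Z}\mathrm{spec}_\varepsilon A_{n,k}\ (\varepsilon>0),\qquad \Sigma^n_\varepsilon(A)=\overline{\bigcup_{k\in\mathbb Z}\mathrm{Spec}_\varepsilon A_{n,k}}\ (\varepsilon\ge0).$$ With $\|\alpha\|_\infty=\sup_j\|a_{j+1,j}\|$ and $\|\gamma\|_\infty=\sup_j\|a_{j-1,j}\|$, let $$\varepsilon_n=2\inf_{0<\phi<1}\left(\sqrt{\frac{\|\alpha\|_\infty^2}{\phi}+\frac{\|\gamma\|_\infty^2}{1-\phi}}\;\sin\frac{\theta_n(\phi)}2\right),$$ where $\theta_n(\phi)$ is the unique solution $t\in\left[\frac{\pi}{2n+1},\frac{\pi}{n+2}\right]$ of $2\sin\frac t2\cos\left((n+\tfrac12)t\right)+\phi(1-\phi)\sin((n-1)t)=0$. A complex Banach space $Y$ is complex uniformly convex if for every $\varepsilon>0$ there is $\delta>0$ such that $\|x\|\le1-\delta$ whenever $x,y\in Y$, $\|y\|\ge\varepsilon$, and $\|x+\zeta y\|\le1$ for all $\zeta\in\mathbb C$ with $|\zeta|\le1$. $X$ has Globevnik's property if $X$ is finite-dimensional, or $X$ or its dual $X^*$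 is complex uniformly convex. The $\tau$ method does not suffer from spectral pollution for $A$ if there is a sequence $\eta_n>0$ with $\eta_n\to0$ such that, for every $\varepsilon>0$, $\mathrm{spec}_\varepsilon A_{n,k}\subset\mathrm{spec}_{\varepsilon+\eta_n}A$ for all $n\in\mathbb N$ and $k\in\mathbb Z$. For non-empty bounded $S_n,S\subset\mathbb C$, write $S_n\to S$ if the Hausdorff distance between $S_n$ and $S$ tends to $0$. **Theorem 1.3 (convergence of the $\tau$ method).** Suppose that $A$ is tridiagonal ($a_{i,j}=0$ for $|i-j|>1$), that the $\tau$ method does not suffer from spectral pollution for $A$, and that $X$ has Globevnik's property. Then, as $n\to\infty$ (all the sets involved being non-empty and bounded), 1. $\Sigma^n_{\varepsilon+\varepsilon_n}(A)\to\mathrm{Spec}_\varepsilon A$ for every $\varepsilon\ge0$, where in the case $\varepsilon=0$ it is assumed that $A$ is not diagonal or that $X$ is finite-dimensional; in particular, $\Sigma^n_{\varepsilon_n}(A)\to\mathrm{Spec}\,A$ under the same proviso; 2. $\sigma^n_{\varepsilon+\varepsilon_n}(A)\to\mathrm{spec}_\varepsilon A$ for every $\varepsilon>0$. -/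

import Mathlib

open Filter Topology
open scoped ENNReal

noncomputable section

/-- The (extended) norm `‖B⁻¹‖` of the inverse of a bounded operator `B`, with the convention
that `‖B⁻¹‖ = ∞` if `B` is not invertible. -/
def inverseENorm {Y : Type*} [NormedAddCommGroup Y] [NormedSpace ℂ Y] (B : Y →L[ℂ] Y) : ℝ≥0∞ :=
  open Classical in if IsUnit B then ‖Ring.inverse B‖ₑ else ⊤

/-- The closed `ε`-pseudospectrum `Spec_ε B = {z : 1 / ‖(B - z I)⁻¹‖ ≤ ε}`, `ε ≥ 0`,
where `1 / ∞ = 0`.  For `ε = 0` it is the spectrum of `B`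
(see `closedPseudospectrum_zero`). -/
def closedPseudospectrum {Y : Type*} [NormedAddCommGroup Y] [NormedSpace ℂ Y]
    (B : Y →L[ℂ] Y) (ε : ℝ) : Set ℂ :=
  {z | (inverseENorm (B - z • ContinuousLinearMap.id ℂ Y))⁻¹ ≤ ENNReal.ofReal ε}

/-- The open `ε`-pseudospectrum `spec_ε B = {z : 1 / ‖(B - z I)⁻¹‖ < ε}`, `ε > 0`. -/
def openPseudospectrum {Y : Type*} [NormedAddCommGroup Y] [NormedSpace ℂ Y]
    (B : Y →L[ℂ] Y) (ε : ℝ) : Set ℂ :=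
  {z | (inverseENorm (B - z • ContinuousLinearMap.id ℂ Y))⁻¹ < ENNReal.ofReal ε}

theorem closedPseudospectrum_zero {Y : Type*} [NormedAddCommGroup Y] [NormedSpace ℂ Y]
    (B : Y →L[ℂ] Y) : closedPseudospectrum B 0 = spectrum ℂ B := by
  ext z
  have h : IsUnit (B - z • ContinuousLinearMap.id ℂ Y) ↔
      IsUnit (algebraMap ℂ (Y →L[ℂ] Y) z - B) := by
    rw [← IsUnit.neg_iff, neg_sub, Algebra.algebraMap_eq_smul_one]
    rfl
  by_cases hu : IsUnit (B - z • ContinuousLinearMap.id ℂ Y)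
  · simp [closedPseudospectrum, inverseENorm, hu, spectrum.mem_iff, ← h]
  · simp [closedPseudospectrum, inverseENorm, hu, spectrum.mem_iff, ← h]

/-- Complex uniform convexity: for every `ε > 0` there is `δ > 0` such that `‖y‖ ≥ ε` and
`‖x + ζ y‖ ≤ 1` for all complex `|ζ| ≤ 1` imply `‖x‖ ≤ 1 - δ`. -/
def ComplexUniformlyConvex (Y : Type*) [NormedAddCommGroup Y] [NormedSpace ℂ Y] : Prop :=
  ∀ ε : ℝ, 0 < ε → ∃ δ : ℝ, 0 < δ ∧ ∀ x y : Y, ε ≤ ‖y‖ →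
    (∀ ζ : ℂ, ‖ζ‖ ≤ 1 → ‖x + ζ • y‖ ≤ 1) → ‖x‖ ≤ 1 - δ

/-- Globevnik's property: `Y` is finite-dimensional, or `Y` or its dual is complex uniformly
convex. -/
def GlobevnikProperty (Y : Type*) [NormedAddCommGroup Y] [NormedSpace ℂ Y] : Prop :=
  FiniteDimensional ℂ Y ∨ ComplexUniformlyConvex Y ∨ ComplexUniformlyConvex (Y →L[ℂ] ℂ)

/-- Convergence `S n → T` as `n → ∞` of non-empty bounded subsets of `ℂ` (indexed by the
positive integers) with respect to the Hausdorff distance. -/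
def HausdorffTendsto (S : ℕ → Set ℂ) (T : Set ℂ) : Prop :=
  (∀ n : ℕ, 1 ≤ n → (S n).Nonempty ∧ Bornology.IsBounded (S n)) ∧
  T.Nonempty ∧ Bornology.IsBounded T ∧
  Tendsto (fun n => Metric.hausdorffDist (S n) T) atTop (𝓝 0)

/-- The space `ℓ²(ℤ, X)` of square-summable bi-infinite `X`-valued sequences. -/
abbrev BiSeq (X : Type*) [NormedAddCommGroup X] : Type _ := lp (fun _ : ℤ => X) 2

section Operators

variable {X : Type*} [NormedAddCommGroup X] [NormedSpace ℂ X]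

/-- The entry `a_{i,j}`, an operator on `X`, of the matrix representation of an operator `A` on
`ℓ²(ℤ, X)`. -/
def matrixEntry (A : BiSeq X →L[ℂ] BiSeq X) (i j : ℤ) : X →L[ℂ] X :=
  (lp.evalCLM ℂ (fun _ : ℤ => X) 2 i).comp
    (A.comp (lp.singleContinuousLinearMap ℂ (fun _ : ℤ => X) 2 j))

/-- The matrix representation of `A` is tridiagonal. -/
def IsTridiagonal (A : BiSeq X →L[ℂ] BiSeq X) : Prop :=
  ∀ i j : ℤ, 1 < |i - j| → matrixEntry A i j = 0

/-- The matrix representation of `A` is diagonal. -/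
def IsDiagonalOperator (A : BiSeq X →L[ℂ] BiSeq X) : Prop :=
  ∀ i j : ℤ, i ≠ j → matrixEntry A i j = 0

/-- The finite section `A_{n,k}`: the `n × n` principal submatrix
`[a_{i,j}]`, `i, j ∈ {k+1, …, k+n}`, acting on `Xⁿ` with the norm
`‖(x₁, …, xₙ)‖ = (∑ ‖x_j‖²)^{1/2}`. -/
def finiteSection (A : BiSeq X →L[ℂ] BiSeq X) (n : ℕ) (k : ℤ) :
    PiLp 2 (fun _ : Fin n => X) →L[ℂ] PiLp 2 (fun _ : Fin n => X) :=
  ((PiLp.continuousLinearEquiv 2 ℂ (fun _ : Fin n => X)).symm :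
      (Fin n → X) →L[ℂ] PiLp 2 (fun _ : Fin n => X)).comp
    (ContinuousLinearMap.pi fun i : Fin n => ∑ j : Fin n,
      (matrixEntry A (k + 1 + (i : ℤ)) (k + 1 + (j : ℤ))).comp
        (PiLp.proj 2 (fun _ : Fin n => X) j))

/-- `σⁿ_ε(A)`, the union over `k ∈ ℤ` of the open `ε`-pseudospectra of `A_{n,k}`. -/
def tauOpenSet (A : BiSeq X →L[ℂ] BiSeq X) (n : ℕ) (ε : ℝ) : Set ℂ :=
  ⋃ k : ℤ, openPseudospectrum (finiteSection A n k) ε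

/-- `Σⁿ_ε(A)`, the closure of the union over `k ∈ ℤ` of the closed `ε`-pseudospectra of
`A_{n,k}`. -/
def tauClosedSet (A : BiSeq X →L[ℂ] BiSeq X) (n : ℕ) (ε : ℝ) : Set ℂ :=
  closure (⋃ k : ℤ, closedPseudospectrum (finiteSection A n k) ε)

/-- `‖α‖_∞`, where `α_j = a_{j+1,j}` is the first subdiagonal. -/
def subdiagNorm (A : BiSeq X →L[ℂ] BiSeq X) : ℝ := ⨆ j : ℤ, ‖matrixEntry A (j + 1) j‖

/-- `‖γ‖_∞`, where `γ_j = a_{j-1,j}` is the first superdiagonal. -/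
def superdiagNorm (A : BiSeq X →L[ℂ] BiSeq X) : ℝ := ⨆ j : ℤ, ‖matrixEntry A (j - 1) j‖

/-- `θ_n(φ)`: the solution `t` (it is unique, for `n ≥ 1` and `0 ≤ φ ≤ 1`) in
`[π/(2n+1), π/(n+2)]` of
`2 sin(t/2) cos((n + 1/2) t) + φ (1 - φ) sin((n - 1) t) = 0`. -/
def tauTheta (n : ℕ) (φ : ℝ) : ℝ :=
  sInf {t : ℝ | t ∈ Set.Icc (Real.pi / (2 * (n : ℝ) + 1)) (Real.pi / ((n : ℝ) + 2)) ∧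
    2 * Real.sin (t / 2) * Real.cos (((n : ℝ) + 1 / 2) * t)
      + φ * (1 - φ) * Real.sin (((n : ℝ) - 1) * t) = 0}

/-- The truncation penalty
`ε_n = 2 inf_{0<φ<1} (‖α‖_∞² / φ + ‖γ‖_∞² / (1 - φ))^{1/2} sin(θ_n(φ) / 2)`. -/
def tauPenalty (A : BiSeq X →L[ℂ] BiSeq X) (n : ℕ) : ℝ :=
  2 * ⨅ φ : Set.Ioo (0 : ℝ) 1,
    Real.sqrt (subdiagNorm A ^ 2 / (φ : ℝ) + superdiagNorm A ^ 2 / (1 - (φ : ℝ)))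
      * Real.sin (tauTheta n φ / 2)

/-- The `τ` method does not suffer from spectral pollution for `A`: there is a positive null
sequence `η` such that `spec_ε A_{n,k} ⊆ spec_{ε + η_n} A` for all `ε > 0`, `n ≥ 1`, `k ∈ ℤ`. -/
def TauNoSpectralPollution (A : BiSeq X →L[ℂ] BiSeq X) : Prop :=
  ∃ η : ℕ → ℝ, (∀ n, 0 < η n) ∧ Tendsto η atTop (𝓝 0) ∧
    ∀ ε : ℝ, 0 < ε → ∀ n : ℕ, 1 ≤ n → ∀ k : ℤ,
      openPseudospectrum (finiteSection A n k) ε ⊆ openPseudospectrum A (ε + η n)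

end Operators

end

/-!
If `x` is a vector with `‖(A - z) x‖ < ε ‖x‖`, or a functional with the same property for the
adjoint, multiply `x` by a weight supported in a window of length `n`. The commutator of a
tridiagonal operator with the weight involves only differences of neighbouring weights, and
averaging over all positions of the window costs exactly `ε_n` when the weight is extremal. Hence
`spec_ε A ⊆ σⁿ_{ε+ε_n}(A)`.

Passing from `spec_ε` to `Spec_ε` needs that `1 / ‖(B - z)⁻¹‖` has no local minimum other than `0`,
uniformly over all finite sections. If `X` or its dual is complex uniformly convex, so is the `ℓ²`
sum or its dual, so the centre of a disc of definite radius in a ball is well inside; such discs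
come from the Taylor coefficients of the resolvent. If `X` is finite-dimensional, a failure of
uniformity would produce in the limit a tridiagonal operator with a backward orbit `e₀, e₁, …` such
that at each site a functional norming `e₀` annihilates all later members; counting dimensions in
windows shows that there is none. A finite section becomes a tridiagonal operator on `ℓ²(ℤ, X)` when
it is extended by a scalar.
-/

noncomputable section

/-! ### The reciprocal of the norm of the inverse -/

section InverseGap

variable {Y : Type*} [NormedAddCommGroup Y] [NormedSpace ℂ Y]

/-- The number `1 / ‖B⁻¹‖` as a real number, equal to `0` if `B` is not invertible. -/
def inverseGap (B : Y →L[ℂ] Y) : ℝ := ((inverseENorm B)⁻¹).toReal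

theorem inverseGap_of_isUnit {B : Y →L[ℂ] Y} (h : IsUnit B) :
    inverseGap B = ‖Ring.inverse B‖⁻¹ := by
  simp [inverseGap, inverseENorm, h]

theorem inverseGap_of_not_isUnit {B : Y →L[ℂ] Y} (h : ¬ IsUnit B) : inverseGap B = 0 := by
  simp [inverseGap, inverseENorm, h]

theorem inverseGap_nonneg (B : Y →L[ℂ] Y) : 0 ≤ inverseGap B := ENNReal.toReal_nonneg

theorem isUnit_of_inverseGap_pos {B : Y →L[ℂ] Y} (h : 0 < inverseGap B) : IsUnit B :=
  of_not_not fun hu => h.ne' (inverseGap_of_not_isUnit hu)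

theorem inverse_apply_apply {B : Y →L[ℂ] Y} (h : IsUnit B) (x : Y) : Ring.inverse B (B x) = x :=
  DFunLike.congr_fun (Ring.inverse_mul_cancel B h) x

theorem apply_inverse_apply {B : Y →L[ℂ] Y} (h : IsUnit B) (x : Y) : B (Ring.inverse B x) = x :=
  DFunLike.congr_fun (Ring.mul_inverse_cancel B h) x

theorem inverseGap_mul_norm_inverse_le_one (B : Y →L[ℂ] Y) :
    inverseGap B * ‖Ring.inverse B‖ ≤ 1 := by
  by_cases h : IsUnit B
  · rw [inverseGap_of_isUnit h]
    exact inv_mul_le_one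
  · rw [inverseGap_of_not_isUnit h, zero_mul]
    exact zero_le_one

theorem inverseGap_mul_norm_le (B : Y →L[ℂ] Y) (x : Y) : inverseGap B * ‖x‖ ≤ ‖B x‖ := by
  by_cases h : IsUnit B
  · calc inverseGap B * ‖x‖ = inverseGap B * ‖Ring.inverse B (B x)‖ := by
          rw [inverse_apply_apply h]
      _ ≤ inverseGap B * (‖Ring.inverse B‖ * ‖B x‖) :=
          mul_le_mul_of_nonneg_left ((Ring.inverse B).le_opNorm _) (inverseGap_nonneg B)
      _ = inverseGap B * ‖Ring.inverse B‖ * ‖B x‖ := (mul_assoc _ _ _).symm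
      _ ≤ ‖B x‖ := mul_le_of_le_one_left (norm_nonneg _) (inverseGap_mul_norm_inverse_le_one B)
  · rw [inverseGap_of_not_isUnit h, zero_mul]
    exact norm_nonneg _

theorem inverseGap_mul_norm_le_norm_comp {F : Type*} [NormedAddCommGroup F] [NormedSpace ℂ F]
    (B : Y →L[ℂ] Y) (f : Y →L[ℂ] F) : inverseGap B * ‖f‖ ≤ ‖f.comp B‖ := by
  by_cases h : IsUnit B
  · have hf : f = (f.comp B).comp (Ring.inverse B) := by
      ext x
      exact congrArg f (apply_inverse_apply h x).symm
    calc inverseGap B * ‖f‖ ≤ inverseGap B * (‖f.comp B‖ * ‖Ring.inverse B‖) := by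
          refine mul_le_mul_of_nonneg_left ?_ (inverseGap_nonneg B)
          conv_lhs => rw [hf]
          exact ContinuousLinearMap.opNorm_comp_le _ _
      _ = ‖f.comp B‖ * (inverseGap B * ‖Ring.inverse B‖) := by ring
      _ ≤ ‖f.comp B‖ :=
          mul_le_of_le_one_right (norm_nonneg _) (inverseGap_mul_norm_inverse_le_one B)
  · rw [inverseGap_of_not_isUnit h, zero_mul]
    exact norm_nonneg _

theorem exists_dual_ne_zero_comp_eq_zero {B : Y →L[ℂ] Y} (h : B.range.topologicalClosure ≠ ⊤) :
    ∃ f : Y →L[ℂ] ℂ, f ≠ 0 ∧ f.comp B = 0 := by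
  set p := B.range.topologicalClosure
  have : IsClosed (p : Set Y) := B.range.isClosed_topologicalClosure
  obtain ⟨y, hy⟩ : ∃ y, y ∉ p := by simpa [SetLike.ext_iff] using h
  obtain ⟨g, hg⟩ := SeparatingDual.exists_ne_zero (R := ℂ) (x := p.mkQ y)
    (by simpa only [Submodule.mkQ_apply, ne_eq, Submodule.Quotient.mk_eq_zero] using hy)
  refine ⟨g.comp p.mkQL, fun h0 => hg (DFunLike.congr_fun h0 y), ?_⟩
  ext x
  have hx : p.mkQ (B x) = 0 := by
    rw [Submodule.mkQ_apply, Submodule.Quotient.mk_eq_zero]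
    exact B.range.le_topologicalClosure ⟨x, rfl⟩
  change g (p.mkQ (B x)) = 0
  rw [hx, map_zero]

variable [Nontrivial Y]

theorem norm_inverse_pos {B : Y →L[ℂ] Y} (h : IsUnit B) : 0 < ‖Ring.inverse B‖ :=
  norm_pos_iff.2 fun h0 => zero_ne_one (α := Y →L[ℂ] Y) <| by
    rw [← Ring.inverse_mul_cancel B h, h0, zero_mul]

theorem inv_inverseENorm_eq (B : Y →L[ℂ] Y) :
    (inverseENorm B)⁻¹ = ENNReal.ofReal (inverseGap B) := by
  rw [inverseGap, ENNReal.ofReal_toReal]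
  by_cases h : IsUnit B
  · have hne : ‖Ring.inverse B‖ₑ ≠ 0 := by
      rw [← ofReal_norm]
      exact (ENNReal.ofReal_pos.2 (norm_inverse_pos h)).ne'
    simpa only [inverseENorm, h, if_true, ne_eq, ENNReal.inv_eq_top] using hne
  · simp [inverseENorm, h]

theorem mem_openPseudospectrum_iff {B : Y →L[ℂ] Y} {ε : ℝ} (hε : 0 < ε) {z : ℂ} :
    z ∈ openPseudospectrum B ε ↔ inverseGap (B - z • ContinuousLinearMap.id ℂ Y) < ε := by
  rw [openPseudospectrum, Set.mem_ofPred_eq, inv_inverseENorm_eq,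
    ENNReal.ofReal_lt_ofReal_iff hε]

theorem mem_closedPseudospectrum_iff {B : Y →L[ℂ] Y} {ε : ℝ} (hε : 0 ≤ ε) {z : ℂ} :
    z ∈ closedPseudospectrum B ε ↔ inverseGap (B - z • ContinuousLinearMap.id ℂ Y) ≤ ε := by
  rw [closedPseudospectrum, Set.mem_ofPred_eq, inv_inverseENorm_eq,
    ENNReal.ofReal_le_ofReal_iff hε]

theorem le_inverseGap_of_forall {B : Y →L[ℂ] Y} (h : IsUnit B) {s : ℝ}
    (hB : ∀ x, s * ‖x‖ ≤ ‖B x‖) : s ≤ inverseGap B := by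
  rw [inverseGap_of_isUnit h]
  rcases le_or_gt s 0 with hs | hs
  · exact hs.trans (inv_nonneg.2 (norm_nonneg _))
  rw [le_inv_comm₀ hs (norm_inverse_pos h)]
  refine ContinuousLinearMap.opNorm_le_bound _ (by positivity) fun y => ?_
  rw [inv_mul_eq_div, le_div_iff₀' hs]
  simpa only [apply_inverse_apply h] using hB (Ring.inverse B y)

theorem norm_inverse_le_of_le_inverseGap {B : Y →L[ℂ] Y} {s : ℝ} (hs : 0 < s)
    (h : s ≤ inverseGap B) : IsUnit B ∧ ‖Ring.inverse B‖ ≤ s⁻¹ := by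
  have hu := isUnit_of_inverseGap_pos (hs.trans_le h)
  rw [inverseGap_of_isUnit hu] at h
  exact ⟨hu, (le_inv_comm₀ hs (norm_inverse_pos hu)).1 h⟩

variable [CompleteSpace Y]

theorem exists_small_of_inverseGap_lt {B : Y →L[ℂ] Y} {ε : ℝ} (hε : 0 < ε)
    (h : inverseGap B < ε) :
    (∃ x, ‖B x‖ < ε * ‖x‖) ∨ ∃ f : Y →L[ℂ] ℂ, ‖f.comp B‖ < ε * ‖f‖ := by
  by_contra! hB
  obtain ⟨hvec, hdual⟩ := hB
  have hanti : AntilipschitzWith ⟨ε⁻¹, by positivity⟩ B :=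
    B.antilipschitz_of_bound fun x => by
      change ‖x‖ ≤ ε⁻¹ * ‖B x‖
      rw [inv_mul_eq_div, le_div_iff₀' hε]
      exact hvec x
  have hdense : B.range.topologicalClosure = ⊤ := by
    by_contra hne
    obtain ⟨f, hf, hfB⟩ := exists_dual_ne_zero_comp_eq_zero hne
    have := hdual f
    rw [hfB, norm_zero] at this
    exact this.not_gt (mul_pos hε (norm_pos_iff.2 hf))
  have hunit : IsUnit B := ContinuousLinearMap.isUnit_iff_bijective.2
    (B.bijective_iff_dense_range_and_antilipschitz.2 ⟨hdense, _, hanti⟩)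
  exact (le_inverseGap_of_forall hunit hvec).not_gt h

theorem inverseGap_sub_norm_sub_le (B C : Y →L[ℂ] Y) :
    inverseGap B - ‖C - B‖ ≤ inverseGap C := by
  rcases le_or_gt (inverseGap B) ‖C - B‖ with h | h
  · exact (sub_nonpos.2 h).trans (inverseGap_nonneg C)
  obtain ⟨u, rfl⟩ := isUnit_of_inverseGap_pos ((norm_nonneg _).trans_lt h)
  have hC : IsUnit C := by
    rw [inverseGap_of_isUnit u.isUnit, Ring.inverse_unit] at h
    exact (u.ofNearby C h).isUnit
  refine le_inverseGap_of_forall hC fun x => ?_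
  calc (inverseGap (u : Y →L[ℂ] Y) - ‖C - u‖) * ‖x‖
      = inverseGap (u : Y →L[ℂ] Y) * ‖x‖ - ‖C - u‖ * ‖x‖ := sub_mul _ _ _
    _ ≤ ‖(u : Y →L[ℂ] Y) x‖ - ‖(C - u) x‖ :=
        sub_le_sub (inverseGap_mul_norm_le _ x) ((C - u).le_opNorm x)
    _ ≤ ‖(u : Y →L[ℂ] Y) x + (C - u) x‖ := norm_sub_le_norm_add _ _
    _ = ‖C x‖ := by rw [sub_apply, add_sub_cancel]

theorem lipschitzWith_inverseGap :
    LipschitzWith 1 (inverseGap : (Y →L[ℂ] Y) → ℝ) :=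
  LipschitzWith.of_le_add fun B C => by
    rw [dist_comm, dist_eq_norm]
    linarith [inverseGap_sub_norm_sub_le B C]

theorem continuous_inverseGap_sub_smul (B : Y →L[ℂ] Y) :
    Continuous fun z : ℂ => inverseGap (B - z • ContinuousLinearMap.id ℂ Y) :=
  lipschitzWith_inverseGap.continuous.comp (by fun_prop)

theorem sub_norm_le_inverseGap (B : Y →L[ℂ] Y) (z : ℂ) :
    ‖z‖ - ‖B‖ ≤ inverseGap (B - z • ContinuousLinearMap.id ℂ Y) := by
  rcases eq_or_ne z 0 with rfl | hz
  · rw [norm_zero, zero_sub]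
    exact (neg_nonpos.2 (norm_nonneg B)).trans (inverseGap_nonneg _)
  have hgap : ‖z‖ ≤ inverseGap (-z • ContinuousLinearMap.id ℂ Y) := by
    have hunit : IsUnit (-z • (1 : Y →L[ℂ] Y)) := by
      rw [← Algebra.algebraMap_eq_smul_one]
      exact (IsUnit.mk0 (-z) (neg_ne_zero.2 hz)).map (algebraMap ℂ (Y →L[ℂ] Y))
    exact le_inverseGap_of_forall hunit fun x => by simp [norm_smul]
  have h := inverseGap_sub_norm_sub_le (-z • ContinuousLinearMap.id ℂ Y)
    (B - z • ContinuousLinearMap.id ℂ Y)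
  rw [neg_smul, sub_neg_eq_add, sub_add_cancel] at h
  rw [neg_smul] at hgap
  linarith

theorem norm_le_of_mem_closedPseudospectrum {B : Y →L[ℂ] Y} {ε : ℝ}
    (hε : 0 ≤ ε) {z : ℂ} (hz : z ∈ closedPseudospectrum B ε) : ‖z‖ ≤ ‖B‖ + ε := by
  rw [mem_closedPseudospectrum_iff hε] at hz
  linarith [sub_norm_le_inverseGap B z]

theorem exists_openPseudospectrum_subset_thickening
    (B : Y →L[ℂ] Y) {ε ρ : ℝ} (hε : 0 ≤ ε) (hρ : 0 < ρ) :
    ∃ τ > 0, openPseudospectrum B (ε + τ) ⊆ Metric.thickening ρ (closedPseudospectrum B ε) := by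
  set U := Metric.thickening ρ (closedPseudospectrum B ε)
  have hcompact : IsCompact (Metric.closedBall (0 : ℂ) (‖B‖ + (ε + 1)) \ U) :=
    (isCompact_closedBall _ _).diff Metric.isOpen_thickening
  obtain ⟨s, hεs, hs⟩ := hcompact.exists_forall_le'
    (continuous_inverseGap_sub_smul B).continuousOn (a := ε) fun z hz => by
      by_contra! h
      exact hz.2 (Metric.self_subset_thickening hρ _ ((mem_closedPseudospectrum_iff hε).2 h))
  refine ⟨min (s - ε) 1, lt_min (sub_pos.2 hεs) one_pos, fun z hz => ?_⟩
  have hpos : 0 < ε + min (s - ε) 1 := add_pos_of_nonneg_of_pos hε (lt_min (sub_pos.2 hεs) one_pos)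
  by_contra hzU
  have hball : z ∈ Metric.closedBall (0 : ℂ) (‖B‖ + (ε + 1)) := by
    rw [mem_closedBall_zero_iff]
    linarith [sub_norm_le_inverseGap B z, (mem_openPseudospectrum_iff hpos).1 hz,
      min_le_right (s - ε) 1]
  linarith [hs z ⟨hball, hzU⟩, (mem_openPseudospectrum_iff hpos).1 hz, min_le_left (s - ε) 1]

end InverseGap

section Monotonicity

variable {Y : Type*} [NormedAddCommGroup Y] [NormedSpace ℂ Y] {B : Y →L[ℂ] Y} {ε δ : ℝ}

theorem openPseudospectrum_mono (h : ε ≤ δ) : openPseudospectrum B ε ⊆ openPseudospectrum B δ :=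
  fun _ hz => lt_of_lt_of_le hz (ENNReal.ofReal_le_ofReal h)

theorem closedPseudospectrum_mono (h : ε ≤ δ) :
    closedPseudospectrum B ε ⊆ closedPseudospectrum B δ :=
  fun _ hz => le_trans hz (ENNReal.ofReal_le_ofReal h)

theorem openPseudospectrum_subset_closedPseudospectrum :
    openPseudospectrum B ε ⊆ closedPseudospectrum B ε :=
  fun z hz => by
    rw [openPseudospectrum, Set.mem_ofPred_eq] at hz
    exact hz.le

theorem closedPseudospectrum_subset_openPseudospectrum (hε : 0 ≤ ε) (h : ε < δ) :
    closedPseudospectrum B ε ⊆ openPseudospectrum B δ :=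
  fun _ hz => lt_of_le_of_lt hz ((ENNReal.ofReal_lt_ofReal_iff (hε.trans_lt h)).2 h)

end Monotonicity

/-! ### The truncation penalty -/

section Angle

open Real

/-- The function of `t` whose zero in `[π / (2n + 1), π / (n + 2)]` is the angle `θ_n(φ)`. -/
def tauEquation (n : ℕ) (φ t : ℝ) : ℝ :=
  2 * sin (t / 2) * cos (((n : ℝ) + 1 / 2) * t) + φ * (1 - φ) * sin (((n : ℝ) - 1) * t)

theorem continuous_tauEquation (n : ℕ) (φ : ℝ) : Continuous (tauEquation n φ) := by
  unfold tauEquation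
  fun_prop

variable {n : ℕ} {φ : ℝ}

theorem pi_div_add_two_le (hn : 1 ≤ n) : π / ((n : ℝ) + 2) ≤ π / 3 := by
  have hn' : (1 : ℝ) ≤ n := by exact_mod_cast hn
  exact div_le_div_of_nonneg_left pi_pos.le (by norm_num) (by linarith)

theorem pi_div_two_mul_add_one_le (hn : 1 ≤ n) :
    π / (2 * (n : ℝ) + 1) ≤ π / ((n : ℝ) + 2) := by
  have hn' : (1 : ℝ) ≤ n := by exact_mod_cast hn
  exact div_le_div_of_nonneg_left pi_pos.le (by linarith) (by linarith)

theorem tauEquation_left_nonneg (hn : 1 ≤ n) (h0 : 0 < φ) (h1 : φ < 1) :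
    0 ≤ tauEquation n φ (π / (2 * (n : ℝ) + 1)) := by
  have hn' : (1 : ℝ) ≤ n := by exact_mod_cast hn
  have harg : ((n : ℝ) + 1 / 2) * (π / (2 * (n : ℝ) + 1)) = π / 2 := by field_simp
  rw [tauEquation, harg, cos_pi_div_two, mul_zero, zero_add]
  refine mul_nonneg (mul_nonneg h0.le (sub_pos.2 h1).le) (sin_nonneg_of_nonneg_of_le_pi ?_ ?_)
  · exact mul_nonneg (by linarith) (by positivity)
  · rw [← mul_div_assoc, div_le_iff₀ (by linarith)]
    nlinarith [pi_pos]

theorem tauEquation_pi_div_add_two (n : ℕ) (φ : ℝ) :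
    tauEquation n φ (π / ((n : ℝ) + 2)) =
      sin (π / ((n : ℝ) + 2)) - sin (2 * (π / ((n : ℝ) + 2)))
        + φ * (1 - φ) * sin (3 * (π / ((n : ℝ) + 2))) := by
  set t := π / ((n : ℝ) + 2) with ht
  have hnt : (n : ℝ) * t = π - 2 * t := by
    rw [ht]
    field_simp
    ring
  have hcos : 2 * sin (t / 2) * cos (((n : ℝ) + 1 / 2) * t) = sin t - sin (2 * t) := by
    rw [sin_sub_sin, show (t - 2 * t) / 2 = -(t / 2) by ring, sin_neg,
      show ((n : ℝ) + 1 / 2) * t = π - (t + 2 * t) / 2 by linarith, cos_pi_sub]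
    ring
  rw [tauEquation, hcos, show ((n : ℝ) - 1) * t = π - 3 * t by linarith, sin_pi_sub]

theorem tauEquation_right_nonpos (hn : 1 ≤ n) (h0 : 0 < φ) (h1 : φ < 1) :
    tauEquation n φ (π / ((n : ℝ) + 2)) ≤ 0 := by
  rw [tauEquation_pi_div_add_two]
  have ht3 := pi_div_add_two_le hn
  have ht0 : 0 < π / ((n : ℝ) + 2) := div_pos pi_pos (by positivity)
  generalize π / ((n : ℝ) + 2) = t at ht3 ht0
  have hsin : 0 ≤ sin t := sin_nonneg_of_nonneg_of_le_pi ht0.le (by linarith)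
  have hsin3 : 0 ≤ sin (3 * t) := sin_nonneg_of_nonneg_of_le_pi (by linarith) (by linarith)
  have hcos : 1 / 2 ≤ cos t := by
    rw [← cos_pi_div_three]
    exact cos_le_cos_of_nonneg_of_le_pi ht0.le (by linarith) ht3
  have hφ : φ * (1 - φ) ≤ 1 / 4 := by nlinarith [sq_nonneg (φ - 1 / 2)]
  calc sin t - sin (2 * t) + φ * (1 - φ) * sin (3 * t)
      ≤ sin t - sin (2 * t) + 1 / 4 * sin (3 * t) := by gcongr
    _ = sin t * ((cos t - 1 / 2) * (cos t - 3 / 2)) := by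
        rw [sin_two_mul, sin_three_mul]
        linear_combination -sin t * sin_sq_add_cos_sq t
    _ ≤ 0 := mul_nonpos_of_nonneg_of_nonpos hsin
        (mul_nonpos_of_nonneg_of_nonpos (by linarith) (by linarith [cos_le_one t]))

theorem tauTheta_spec (hn : 1 ≤ n) (h0 : 0 < φ) (h1 : φ < 1) :
    tauTheta n φ ∈ Set.Icc (π / (2 * (n : ℝ) + 1)) (π / ((n : ℝ) + 2)) ∧
      tauEquation n φ (tauTheta n φ) = 0 := by
  have hcont := continuous_tauEquation n φ
  have hclosed : IsClosed {t | t ∈ Set.Icc (π / (2 * (n : ℝ) + 1)) (π / ((n : ℝ) + 2)) ∧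
      tauEquation n φ t = 0} := isClosed_Icc.inter (isClosed_eq hcont continuous_const)
  obtain ⟨t, ht⟩ := intermediate_value_Icc' (pi_div_two_mul_add_one_le hn) hcont.continuousOn
    ⟨tauEquation_right_nonpos hn h0 h1, tauEquation_left_nonneg hn h0 h1⟩
  exact hclosed.csInf_mem ⟨t, ht⟩ ⟨_, fun s hs => hs.1.1⟩

theorem tauTheta_pos (hn : 1 ≤ n) (h0 : 0 < φ) (h1 : φ < 1) : 0 < tauTheta n φ :=
  (div_pos pi_pos (by positivity)).trans_le (tauTheta_spec hn h0 h1).1.1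

theorem tauTheta_le_pi_div_three (hn : 1 ≤ n) (h0 : 0 < φ) (h1 : φ < 1) :
    tauTheta n φ ≤ π / 3 :=
  (tauTheta_spec hn h0 h1).1.2.trans (pi_div_add_two_le hn)

theorem sin_tauTheta_half_pos (hn : 1 ≤ n) (h0 : 0 < φ) (h1 : φ < 1) :
    0 < sin (tauTheta n φ / 2) :=
  sin_pos_of_pos_of_lt_pi (by linarith [tauTheta_pos hn h0 h1])
    (by linarith [tauTheta_le_pi_div_three hn h0 h1, pi_pos])

theorem tauTheta_one_sub (n : ℕ) (φ : ℝ) : tauTheta n (1 - φ) = tauTheta n φ := by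
  simp only [tauTheta, sub_sub_cancel, mul_comm (1 - φ) φ]

end Angle

section Weight

theorem sum_range_succ_sq_sub (u : ℕ → ℝ) (n : ℕ) :
    ∑ i ∈ Finset.range (n + 1), (u (i + 1) - u i) ^ 2 =
      ∑ i ∈ Finset.range n, u (i + 1) * (2 * u (i + 1) - u i - u (i + 2))
        + (u (n + 1) * (u (n + 1) - u n) - u 0 * (u 1 - u 0)) := by
  induction n with
  | zero =>
    rw [Finset.sum_range_one, Finset.sum_range_zero]
    ring
  | succ n ih =>
    rw [Finset.sum_range_succ, ih, Finset.sum_range_succ _ n]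
    ring

theorem sum_sq_sub_of_eigenvector {u : ℕ → ℝ} {n : ℕ} {φ c : ℝ} (hn : 1 ≤ n) (hu0 : u 0 = 0)
    (hun : u (n + 1) = 0)
    (hu : ∀ i < n, 2 * u (i + 1) - u i - u (i + 2) = c * u (i + 1)
      + (if i = 0 then (1 - φ) * u 1 else 0) + (if i = n - 1 then φ * u n else 0)) :
    ∑ i ∈ Finset.range n, ((1 - φ) * (u (i + 2) - u (i + 1)) ^ 2 + φ * (u (i + 1) - u i) ^ 2) =
      c * ∑ i ∈ Finset.range n, u (i + 1) ^ 2 := by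
  have hparts := sum_range_succ_sq_sub u n
  rw [hu0, hun, zero_mul, zero_mul, sub_zero, add_zero] at hparts
  have heigen : ∑ i ∈ Finset.range n, u (i + 1) * (2 * u (i + 1) - u i - u (i + 2)) =
      c * ∑ i ∈ Finset.range n, u (i + 1) ^ 2 + (1 - φ) * u 1 ^ 2 + φ * u n ^ 2 := by
    rw [Finset.sum_congr rfl fun i hi => by rw [hu i (Finset.mem_range.1 hi)]]
    simp only [mul_add, mul_ite, mul_zero, Finset.sum_add_distrib, Finset.sum_ite_eq',
      Finset.mem_range, Finset.mul_sum, show 0 < n by omega, show n - 1 < n by omega, if_true,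
      Nat.sub_add_cancel hn, zero_add]
    refine congr_arg₂ _ (congr_arg₂ _ (Finset.sum_congr rfl fun i _ => ?_) ?_) ?_ <;> ring
  have hfirst := hparts
  rw [Finset.sum_range_succ', zero_add, hu0, sub_zero] at hfirst
  rw [Finset.sum_range_succ, hun, zero_sub, neg_sq] at hparts
  rw [Finset.sum_add_distrib, ← Finset.mul_sum, ← Finset.mul_sum]
  linear_combination (1 - φ) * hfirst + φ * hparts + heigen

open Real

/-- The weights `w₁, …, w_n` attached to the `n` rows of a finite section, extended by zero. They
minimise `∑ ((1 - φ) (w_{i+1} - w_i)² + φ (w_i - w_{i-1})²)` relative to `∑ w_i²`. -/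
def tauWeight (n : ℕ) (φ : ℝ) (i : ℤ) : ℝ :=
  if 1 ≤ i ∧ i ≤ n then sin (i * tauTheta n φ) - (1 - φ) * sin ((i - 1) * tauTheta n φ) else 0

variable {n : ℕ} {φ : ℝ}

theorem tauWeight_of_notMem {i : ℤ} (h : ¬ (1 ≤ i ∧ i ≤ n)) : tauWeight n φ i = 0 := if_neg h

theorem tauWeight_one_pos (hn : 1 ≤ n) (h0 : 0 < φ) (h1 : φ < 1) : 0 < tauWeight n φ 1 := by
  rw [tauWeight, if_pos ⟨le_rfl, by exact_mod_cast hn⟩]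
  have : 0 < sin (tauTheta n φ) := sin_pos_of_pos_of_lt_pi (tauTheta_pos hn h0 h1)
    (by linarith [tauTheta_le_pi_div_three hn h0 h1, pi_pos])
  simpa using this

theorem sum_sq_tauWeight_pos (hn : 1 ≤ n) (h0 : 0 < φ) (h1 : φ < 1) :
    0 < ∑ i ∈ Finset.range n, tauWeight n φ (i + 1) ^ 2 :=
  Finset.sum_pos' (fun _ _ => sq_nonneg _) ⟨0, Finset.mem_range.2 hn, by
    simpa using pow_pos (tauWeight_one_pos hn h0 h1) 2⟩

theorem two_mul_sin_sub_sin_sub_sin (y t : ℝ) :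
    2 * sin (y * t) - sin ((y - 1) * t) - sin ((y + 1) * t) =
      (2 * sin (t / 2)) ^ 2 * sin (y * t) := by
  have hcos : cos t = 1 - 2 * sin (t / 2) ^ 2 := by
    rw [sin_sq_eq_half_sub, mul_div_cancel₀ t two_ne_zero]
    ring
  rw [add_mul, sub_mul, one_mul, sin_add, sin_sub]
  linear_combination -2 * sin (y * t) * hcos

theorem tauWeight_eigenvector (hn : 1 ≤ n) (h0 : 0 < φ) (h1 : φ < 1) {i : ℕ} (hi : i < n) :
    2 * tauWeight n φ ((i + 1 : ℕ) : ℤ) - tauWeight n φ (i : ℤ) - tauWeight n φ ((i + 2 : ℕ) : ℤ) =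
      (2 * sin (tauTheta n φ / 2)) ^ 2 * tauWeight n φ ((i + 1 : ℕ) : ℤ)
      + (if i = 0 then (1 - φ) * tauWeight n φ ((1 : ℕ) : ℤ) else 0)
      + (if i = n - 1 then φ * tauWeight n φ (n : ℤ) else 0) := by
  set t := tauTheta n φ with ht
  set v : ℤ → ℝ := fun j => sin (j * t) - (1 - φ) * sin ((j - 1) * t) with hv
  have hw : ∀ j : ℤ, 1 ≤ j → j ≤ n → tauWeight n φ j = v j := fun j h h' => if_pos ⟨h, h'⟩
  have hrec : ∀ j : ℤ, 2 * v j - v (j - 1) - v (j + 1) = (2 * sin (t / 2)) ^ 2 * v j := fun j => by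
    have hj' := two_mul_sin_sub_sin_sub_sin (j - 1) t
    rw [sub_add_cancel] at hj'
    simp only [hv, Int.cast_add, Int.cast_sub, Int.cast_one, add_sub_cancel_right]
    linear_combination two_mul_sin_sub_sin_sub_sin j t - (1 - φ) * hj'
  have hv0 : v 0 = (1 - φ) * v 1 := by simp [hv]
  have hvn : v (n + 1) = φ * v n := by
    have heq := (tauTheta_spec hn h0 h1).2
    have hdiff : sin (((n : ℝ) + 1) * t) - sin (n * t) =
        2 * sin (t / 2) * cos (((n : ℝ) + 1 / 2) * t) := by
      rw [sin_sub_sin]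
      ring_nf
    rw [tauEquation, ← ht, ← hdiff] at heq
    simp only [hv, Int.cast_add, Int.cast_one, Int.cast_natCast, add_sub_cancel_right]
    linear_combination heq
  have hprev : tauWeight n φ i =
      v i - if i = 0 then (1 - φ) * tauWeight n φ ((1 : ℕ) : ℤ) else 0 := by
    split_ifs with h
    · rw [tauWeight_of_notMem (by omega), hw _ (by omega) (by omega), h]
      exact (sub_eq_zero.2 hv0).symm
    · rw [hw _ (by omega) (by omega), sub_zero]
  have hnext : tauWeight n φ ((i + 2 : ℕ) : ℤ) =
      v (i + 2) - if i = n - 1 then φ * tauWeight n φ n else 0 := by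
    split_ifs with h
    · rw [tauWeight_of_notMem (by omega), hw _ (by omega) (by omega), ← hvn,
        show (i : ℤ) + 2 = n + 1 by omega, sub_self]
    · rw [hw _ (by omega) (by omega), sub_zero]
      push_cast
      rfl
  have h := hrec (i + 1)
  rw [add_sub_cancel_right, add_assoc, one_add_one_eq_two] at h
  rw [hprev, hnext, hw _ (by omega) (by omega)]
  push_cast
  linear_combination h

theorem sum_sq_sub_tauWeight (hn : 1 ≤ n) (h0 : 0 < φ) (h1 : φ < 1) :
    ∑ i ∈ Finset.range n, ((1 - φ) * (tauWeight n φ (i + 1 + 1) - tauWeight n φ (i + 1)) ^ 2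
        + φ * (tauWeight n φ (i + 1) - tauWeight n φ i) ^ 2)
      = (2 * sin (tauTheta n φ / 2)) ^ 2 * ∑ i ∈ Finset.range n, tauWeight n φ (i + 1) ^ 2 := by
  have h := sum_sq_sub_of_eigenvector (u := fun i : ℕ => tauWeight n φ i) hn
    (tauWeight_of_notMem (by omega)) (tauWeight_of_notMem (by omega))
    fun i hi => tauWeight_eigenvector hn h0 h1 hi
  simpa only [Nat.cast_add, Nat.cast_one, Nat.cast_ofNat, add_assoc, one_add_one_eq_two] using h

end Weight

section Averaging

theorem hasSum_sum_window {g : ℤ → ℝ} {S : ℝ} (h : HasSum g S) (n : ℕ) (c : ℕ → ℝ) (d : ℤ) :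
    HasSum (fun k : ℤ => ∑ i ∈ Finset.range n, c i * g (k + 1 + i + d))
      ((∑ i ∈ Finset.range n, c i) * S) := by
  rw [Finset.sum_mul]
  refine hasSum_sum fun i _ => ?_
  have hshift := ((Equiv.addRight (1 + i + d : ℤ)).hasSum_iff (f := g)).2 h
  simpa only [Function.comp_def, Equiv.coe_addRight, add_assoc] using hshift.mul_left (c i)

theorem sq_add_mul_add_mul_le {a b φ ε κ : ℝ} (hφ0 : 0 < φ) (hφ1 : φ < 1) (hε : 0 < ε)
    (hκ : 0 < κ) (p u v : ℝ) : (p + (a * u + b * v)) ^ 2 ≤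
      (ε + κ) * (p ^ 2 / ε + (a ^ 2 / φ + b ^ 2 / (1 - φ)) / κ *
        (φ * u ^ 2 + (1 - φ) * v ^ 2)) := by
  have hφ1' : 0 < 1 - φ := by linarith
  have hcauchy : (a * u + b * v) ^ 2 ≤
      (a ^ 2 / φ + b ^ 2 / (1 - φ)) * (φ * u ^ 2 + (1 - φ) * v ^ 2) := by
    rw [div_add_div _ _ hφ0.ne' hφ1'.ne', div_mul_eq_mul_div,
      le_div_iff₀ (mul_pos hφ0 hφ1')]
    nlinarith [sq_nonneg (a * (1 - φ) * v - b * φ * u)]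
  have hyoung : ∀ r : ℝ, (p + r) ^ 2 ≤ (ε + κ) * (p ^ 2 / ε + r ^ 2 / κ) := fun r => by
    rw [div_add_div _ _ hε.ne' hκ.ne', ← mul_div_assoc, le_div_iff₀ (mul_pos hε hκ)]
    nlinarith [sq_nonneg (κ * p - ε * r)]
  refine (hyoung _).trans (mul_le_mul_of_nonneg_left ?_ (by linarith))
  rw [div_mul_eq_mul_div]
  gcongr

theorem exists_window_sum_lt {n : ℕ} {w x y : ℤ → ℝ} {a b φ μ Sx Sy ε κ : ℝ}
    (hx : HasSum (fun j => x j ^ 2) Sx) (hy : HasSum (fun j => y j ^ 2) Sy)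
    (hφ0 : 0 < φ) (hφ1 : φ < 1)
    (hw : ∑ i ∈ Finset.range n, ((1 - φ) * (w (i + 1 + 1) - w (i + 1)) ^ 2
        + φ * (w (i + 1) - w i) ^ 2) = μ ^ 2 * ∑ i ∈ Finset.range n, w (i + 1) ^ 2)
    (hwpos : 0 < ∑ i ∈ Finset.range n, w (i + 1) ^ 2)
    (hε : 0 < ε) (hκ : 0 < κ) (hμ : (a ^ 2 / φ + b ^ 2 / (1 - φ)) * μ ^ 2 ≤ κ ^ 2)
    (hxy : Sy < ε ^ 2 * Sx) :
    ∃ k : ℤ, ∑ i ∈ Finset.range n, (|w (i + 1)| * y (k + 1 + i)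
        + (a * |w (i + 1) - w i| * x (k + 1 + i - 1)
          + b * |w (i + 1 + 1) - w (i + 1)| * x (k + 1 + i + 1))) ^ 2
      < (ε + κ) ^ 2 * ∑ i ∈ Finset.range n, w (i + 1) ^ 2 * x (k + 1 + i) ^ 2 := by
  by_contra! hcon
  set W := ∑ i ∈ Finset.range n, w (i + 1) ^ 2
  set Dl := ∑ i ∈ Finset.range n, (w (i + 1) - w i) ^ 2
  set Dr := ∑ i ∈ Finset.range n, (w (i + 1 + 1) - w (i + 1)) ^ 2
  set α := a ^ 2 / φ + b ^ 2 / (1 - φ)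
  have hform : φ * Dl + (1 - φ) * Dr = μ ^ 2 * W := by
    rw [← hw, Finset.sum_add_distrib, ← Finset.mul_sum, ← Finset.mul_sum, add_comm]
  have hlower := (hasSum_sum_window hx n (fun i => w (i + 1) ^ 2) 0).mul_left ((ε + κ) ^ 2)
  have hupper := (((hasSum_sum_window hy n (fun i => w (i + 1) ^ 2) 0).div_const ε).add
    ((((hasSum_sum_window hx n (fun i => (w (i + 1) - w i) ^ 2) (-1)).mul_left φ).add
      ((hasSum_sum_window hx n (fun i => (w (i + 1 + 1) - w (i + 1)) ^ 2) 1).mul_left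
        (1 - φ))).mul_left (α / κ))).mul_left (ε + κ)
  have hle := hasSum_le (fun k => by
    simp only [add_zero, ← sub_eq_add_neg]
    refine (hcon k).trans ?_
    simp only [mul_assoc a, mul_assoc b]
    refine (Finset.sum_le_sum fun i _ => sq_add_mul_add_mul_le hφ0 hφ1 hε hκ _ _ _).trans_eq ?_
    simp only [mul_pow, sq_abs, ← Finset.mul_sum, Finset.sum_add_distrib, ← Finset.sum_div]
    rfl) hlower hupper
  have hresidual : W * Sy / ε < W * (ε * Sx) := by
    rw [div_lt_iff₀ hε]
    nlinarith
  have hcommutator : α / κ * (φ * (Dl * Sx) + (1 - φ) * (Dr * Sx)) ≤ κ * (W * Sx) := by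
    have hWSx : 0 ≤ W * Sx := mul_nonneg hwpos.le (hx.nonneg fun _ => sq_nonneg _)
    rw [div_mul_eq_mul_div, div_le_iff₀ hκ]
    calc α * (φ * (Dl * Sx) + (1 - φ) * (Dr * Sx)) = α * μ ^ 2 * (W * Sx) := by
          linear_combination α * Sx * hform
      _ ≤ κ ^ 2 * (W * Sx) := mul_le_mul_of_nonneg_right hμ hWSx
      _ = κ * (W * Sx) * κ := by ring
  nlinarith

end Averaging

section Penalty

open Real

variable {X : Type*} [NormedAddCommGroup X] [NormedSpace ℂ X]

theorem norm_matrixEntry_le (A : BiSeq X →L[ℂ] BiSeq X) (i j : ℤ) : ‖matrixEntry A i j‖ ≤ ‖A‖ :=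
  ContinuousLinearMap.opNorm_le_bound _ (norm_nonneg _) fun x =>
    calc ‖matrixEntry A i j x‖ ≤ ‖A (lp.single 2 j x)‖ :=
          lp.norm_apply_le_norm two_ne_zero (A (lp.single 2 j x)) i
      _ ≤ ‖A‖ * ‖lp.single (E := fun _ : ℤ => X) 2 j x‖ := A.le_opNorm _
      _ = ‖A‖ * ‖x‖ := by rw [lp.norm_single two_pos]

theorem norm_matrixEntry_le_subdiagNorm (A : BiSeq X →L[ℂ] BiSeq X) (j : ℤ) :
    ‖matrixEntry A (j + 1) j‖ ≤ subdiagNorm A :=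
  le_ciSup (f := fun j : ℤ => ‖matrixEntry A (j + 1) j‖)
    ⟨‖A‖, Set.forall_mem_range.2 fun _ => norm_matrixEntry_le A _ _⟩ j

theorem norm_matrixEntry_le_superdiagNorm (A : BiSeq X →L[ℂ] BiSeq X) (j : ℤ) :
    ‖matrixEntry A (j - 1) j‖ ≤ superdiagNorm A :=
  le_ciSup (f := fun j : ℤ => ‖matrixEntry A (j - 1) j‖)
    ⟨‖A‖, Set.forall_mem_range.2 fun _ => norm_matrixEntry_le A _ _⟩ j

/-- The value at `φ` of the function of which half the truncation penalty is the infimum. -/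
def penaltyTerm (A : BiSeq X →L[ℂ] BiSeq X) (n : ℕ) (φ : ℝ) : ℝ :=
  √(subdiagNorm A ^ 2 / φ + superdiagNorm A ^ 2 / (1 - φ)) * sin (tauTheta n φ / 2)

theorem tauPenalty_eq (A : BiSeq X →L[ℂ] BiSeq X) (n : ℕ) :
    tauPenalty A n = 2 * ⨅ φ : Set.Ioo (0 : ℝ) 1, penaltyTerm A n φ := rfl

theorem penaltyTerm_nonneg (A : BiSeq X →L[ℂ] BiSeq X) {n : ℕ} (hn : 1 ≤ n)
    (φ : Set.Ioo (0 : ℝ) 1) : 0 ≤ penaltyTerm A n φ :=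
  mul_nonneg (sqrt_nonneg _) (sin_tauTheta_half_pos hn φ.2.1 φ.2.2).le

theorem tauPenalty_nonneg (A : BiSeq X →L[ℂ] BiSeq X) {n : ℕ} (hn : 1 ≤ n) :
    0 ≤ tauPenalty A n :=
  mul_nonneg zero_le_two (Real.iInf_nonneg (penaltyTerm_nonneg A hn))

theorem tauPenalty_le_two_mul_penaltyTerm (A : BiSeq X →L[ℂ] BiSeq X) {n : ℕ} (hn : 1 ≤ n)
    (φ : Set.Ioo (0 : ℝ) 1) : tauPenalty A n ≤ 2 * penaltyTerm A n φ :=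
  mul_le_mul_of_nonneg_left
    (ciInf_le ⟨0, Set.forall_mem_range.2 (penaltyTerm_nonneg A hn)⟩ φ) zero_le_two

theorem exists_penaltyTerm_lt (A : BiSeq X →L[ℂ] BiSeq X) (n : ℕ) {s : ℝ}
    (h : tauPenalty A n < s) : ∃ φ : ℝ, 0 < φ ∧ φ < 1 ∧ 2 * penaltyTerm A n φ < s := by
  have := Set.nonempty_Ioo_subtype (zero_lt_one' ℝ)
  rw [tauPenalty_eq, ← lt_div_iff₀' two_pos] at h
  obtain ⟨φ, hφ⟩ := exists_lt_of_ciInf_lt h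
  exact ⟨φ, φ.2.1, φ.2.2, (lt_div_iff₀' two_pos).1 hφ⟩

theorem tendsto_tauPenalty (A : BiSeq X →L[ℂ] BiSeq X) :
    Tendsto (tauPenalty A) atTop (𝓝 0) := by
  set c := √(subdiagNorm A ^ 2 / (1 / 2) + superdiagNorm A ^ 2 / (1 - 1 / 2))
  have hlim : Tendsto (fun n : ℕ => c * π * (1 / ((n : ℝ) + 1))) atTop (𝓝 0) := by
    simpa only [mul_zero] using tendsto_one_div_add_atTop_nhds_zero_nat.const_mul (c * π)
  refine tendsto_of_tendsto_of_tendsto_of_le_of_le' tendsto_const_nhds hlim ?_ ?_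
  · filter_upwards [eventually_ge_atTop 1] with n hn using tauPenalty_nonneg A hn
  filter_upwards [eventually_ge_atTop 1] with n hn
  have h0 : (0 : ℝ) < 1 / 2 := by norm_num
  have h1 : (1 / 2 : ℝ) < 1 := by norm_num
  calc tauPenalty A n ≤ 2 * penaltyTerm A n (1 / 2) :=
        tauPenalty_le_two_mul_penaltyTerm A hn ⟨1 / 2, h0, h1⟩
    _ ≤ 2 * (c * (tauTheta n (1 / 2) / 2)) := by
        unfold penaltyTerm
        gcongr
        exact sin_le (by linarith [tauTheta_pos hn h0 h1])
    _ = c * tauTheta n (1 / 2) := by ring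
    _ ≤ c * (π / ((n : ℝ) + 1)) := by
        gcongr
        exact (tauTheta_spec hn h0 h1).1.2.trans
          (div_le_div_of_nonneg_left pi_pos.le (by positivity) (by linarith))
    _ = c * π * (1 / ((n : ℝ) + 1)) := by ring

theorem IsTridiagonal.max_subdiagNorm_superdiagNorm_pos {A : BiSeq X →L[ℂ] BiSeq X}
    (hA : IsTridiagonal A) (hd : ¬ IsDiagonalOperator A) :
    0 < max (subdiagNorm A) (superdiagNorm A) := by
  simp only [IsDiagonalOperator, not_forall] at hd
  obtain ⟨i, j, hij, hne⟩ := hd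
  have hle : |i - j| ≤ 1 := not_lt.1 fun h => hne (hA i j h)
  have hpos : 0 < ‖matrixEntry A i j‖ := norm_pos_iff.2 hne
  rw [abs_le] at hle
  rcases (by omega : i = j + 1 ∨ i = j - 1) with rfl | rfl
  · exact lt_max_of_lt_left (hpos.trans_le (norm_matrixEntry_le_subdiagNorm A j))
  · exact lt_max_of_lt_right (hpos.trans_le (norm_matrixEntry_le_superdiagNorm A j))

theorem max_le_sqrt_sq_div_add_sq_div {φ : ℝ} (h0 : 0 < φ) (h1 : φ < 1) (a b : ℝ) :
    max a b ≤ √(a ^ 2 / φ + b ^ 2 / (1 - φ)) := by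
  have ha : a ^ 2 ≤ a ^ 2 / φ := le_div_self (sq_nonneg _) h0 h1.le
  have hb : b ^ 2 ≤ b ^ 2 / (1 - φ) := le_div_self (sq_nonneg _) (by linarith) (by linarith)
  exact max_le (le_sqrt_of_sq_le (by linarith [sq_nonneg b]))
    (le_sqrt_of_sq_le (by linarith [sq_nonneg a]))

theorem tauPenalty_pos {A : BiSeq X →L[ℂ] BiSeq X} (hA : IsTridiagonal A)
    (hd : ¬ IsDiagonalOperator A) {n : ℕ} (hn : 1 ≤ n) : 0 < tauPenalty A n := by
  have := Set.nonempty_Ioo_subtype (zero_lt_one' ℝ)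
  set t := π / (2 * (n : ℝ) + 1)
  have ht0 : 0 < t := div_pos pi_pos (by positivity)
  have ht1 : t ≤ π / 3 := (pi_div_two_mul_add_one_le hn).trans (pi_div_add_two_le hn)
  have hsin : 0 < sin (t / 2) := sin_pos_of_pos_of_lt_pi (by linarith) (by linarith)
  refine mul_pos two_pos ((mul_pos (hA.max_subdiagNorm_superdiagNorm_pos hd) hsin).trans_le
    (le_ciInf fun ⟨φ, h0, h1⟩ => ?_))
  refine mul_le_mul (max_le_sqrt_sq_div_add_sq_div h0 h1 _ _) ?_ hsin.le (sqrt_nonneg _)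
  have hθ := (tauTheta_spec hn h0 h1).1.1
  exact sin_le_sin_of_le_of_le_pi_div_two (by linarith)
    (by linarith [tauTheta_le_pi_div_three hn h0 h1]) (by linarith)

end Penalty

/-! ### Coordinates of sequences and of functionals -/

section Coordinates

namespace BiSeq

theorem hasSum_norm_sq {X : Type*} [NormedAddCommGroup X] (x : BiSeq X) :
    HasSum (fun j => ‖x j‖ ^ 2) (‖x‖ ^ 2) := by
  simpa using lp.hasSum_norm (p := 2) (by norm_num) x

variable {X : Type*} [NormedAddCommGroup X] [NormedSpace ℂ X]

theorem hasSum_single (x : BiSeq X) :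
    HasSum (fun j => lp.singleContinuousLinearMap ℂ (fun _ : ℤ => X) 2 j (x j)) x :=
  lp.hasSum_single (by norm_num) x

theorem norm_sum_single_sq (x : ℤ → X) (s : Finset ℤ) :
    ‖∑ j ∈ s, lp.singleContinuousLinearMap ℂ (fun _ : ℤ => X) 2 j (x j)‖ ^ 2
      = ∑ j ∈ s, ‖x j‖ ^ 2 := by
  simpa using lp.norm_sum_single (p := 2) (E := fun _ : ℤ => X) (by norm_num) x s

theorem single_apply (i j : ℤ) (x : X) :
    (lp.singleContinuousLinearMap ℂ (fun _ : ℤ => X) 2 j x : BiSeq X) i =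
      if i = j then x else 0 := by
  rw [lp.singleContinuousLinearMap_apply, lp.single_apply, Pi.single_apply]

end BiSeq

variable {X : Type*} [NormedAddCommGroup X] [NormedSpace ℂ X]

theorem matrixEntry_apply (A : BiSeq X →L[ℂ] BiSeq X) (i j : ℤ) (x : X) :
    matrixEntry A i j x = A (lp.singleContinuousLinearMap ℂ (fun _ : ℤ => X) 2 j x) i := rfl

theorem hasSum_matrixEntry (A : BiSeq X →L[ℂ] BiSeq X) (x : BiSeq X) (i : ℤ) :
    HasSum (fun j => matrixEntry A i j (x j)) (A x i) :=
  ((lp.evalCLM ℂ (fun _ : ℤ => X) 2 i).comp A).hasSum (BiSeq.hasSum_single x)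

theorem IsTridiagonal.apply_eq {A : BiSeq X →L[ℂ] BiSeq X} (hA : IsTridiagonal A) (x : BiSeq X)
    (i : ℤ) : A x i = matrixEntry A i (i - 1) (x (i - 1)) + matrixEntry A i i (x i)
      + matrixEntry A i (i + 1) (x (i + 1)) := by
  have hsum : HasSum (fun j => matrixEntry A i j (x j))
      (∑ j ∈ {i - 1, i, i + 1}, matrixEntry A i j (x j)) :=
    hasSum_sum_of_ne_finset_zero fun j hj => by
      simp only [Finset.mem_insert, Finset.mem_singleton, not_or] at hj
      rw [hA i j (lt_abs.2 (by omega)), zero_apply]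
  rw [(hasSum_matrixEntry A x i).unique hsum, Finset.sum_insert (by simp; omega),
    Finset.sum_insert (by simp), Finset.sum_singleton, add_assoc]

/-- The coordinates of a functional on `ℓ²(ℤ, X)`. -/
def dualCoord (f : BiSeq X →L[ℂ] ℂ) (j : ℤ) : X →L[ℂ] ℂ :=
  f.comp (lp.singleContinuousLinearMap ℂ (fun _ : ℤ => X) 2 j)

theorem dualCoord_apply (f : BiSeq X →L[ℂ] ℂ) (j : ℤ) (x : X) :
    dualCoord f j x = f (lp.singleContinuousLinearMap ℂ (fun _ : ℤ => X) 2 j x) := rfl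

theorem sum_norm_dualCoord_apply_sq_le (f : BiSeq X →L[ℂ] ℂ) {x : ℤ → X} (hx : ∀ j, ‖x j‖ ≤ 1)
    (s : Finset ℤ) : ∑ j ∈ s, ‖dualCoord f j (x j)‖ ^ 2 ≤ ‖f‖ ^ 2 := by
  set T := ∑ j ∈ s, ‖dualCoord f j (x j)‖ ^ 2
  set y : ℤ → X := fun j => star (dualCoord f j (x j)) • x j with hy
  set v := ∑ j ∈ s, lp.singleContinuousLinearMap ℂ (fun _ : ℤ => X) 2 j (y j)
  have hT : 0 ≤ T := Finset.sum_nonneg fun _ _ => sq_nonneg _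
  have hfv : f v = (T : ℂ) := by
    rw [map_sum, Complex.ofReal_sum]
    refine Finset.sum_congr rfl fun j _ => ?_
    rw [← dualCoord_apply, map_smul, smul_eq_mul, Complex.star_def, Complex.conj_mul',
      Complex.ofReal_pow]
  have hv : ‖v‖ ^ 2 ≤ T := by
    rw [BiSeq.norm_sum_single_sq]
    refine Finset.sum_le_sum fun j _ => ?_
    rw [hy, norm_smul, norm_star, mul_pow]
    exact mul_le_of_le_one_right (sq_nonneg _) (pow_le_one₀ (norm_nonneg _) (hx j))
  have hle : T ≤ ‖f‖ * ‖v‖ := by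
    simpa only [hfv, Complex.norm_real, Real.norm_of_nonneg hT] using f.le_opNorm v
  nlinarith [sq_nonneg (‖f‖ - ‖v‖)]

theorem exists_mul_opNorm_le_norm_apply {Y : Type*} [NormedAddCommGroup Y] [NormedSpace ℂ Y]
    (f : Y →L[ℂ] ℂ) {t : ℝ} (ht : t < 1) : ∃ x, ‖x‖ ≤ 1 ∧ t * ‖f‖ ≤ ‖f x‖ := by
  rcases (norm_nonneg f).eq_or_lt with hf | hf
  · exact ⟨0, by simp, by simp [← hf]⟩
  · obtain ⟨x, hx, hfx⟩ := f.exists_lt_apply_of_lt_opNorm (mul_lt_of_lt_one_left hf ht)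
    exact ⟨x, hx.le, hfx.le⟩

theorem sum_norm_dualCoord_sq_le (f : BiSeq X →L[ℂ] ℂ) (s : Finset ℤ) :
    ∑ j ∈ s, ‖dualCoord f j‖ ^ 2 ≤ ‖f‖ ^ 2 := by
  have hlim : Tendsto (fun t : ℝ => t ^ 2 * ∑ j ∈ s, ‖dualCoord f j‖ ^ 2) (𝓝[<] 1)
      (𝓝 (∑ j ∈ s, ‖dualCoord f j‖ ^ 2)) := by
    refine (Continuous.tendsto' ?_ 1 _ (by rw [one_pow, one_mul])).mono_left nhdsWithin_le_nhds
    fun_prop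
  refine le_of_tendsto hlim ?_
  filter_upwards [Ioo_mem_nhdsLT one_pos] with t ht
  choose x hx hfx using fun j => exists_mul_opNorm_le_norm_apply (dualCoord f j) ht.2
  refine le_trans ?_ (sum_norm_dualCoord_apply_sq_le f hx s)
  rw [Finset.mul_sum]
  refine Finset.sum_le_sum fun j _ => ?_
  rw [← mul_pow]
  exact pow_le_pow_left₀ (mul_nonneg ht.1.le (norm_nonneg _)) (hfx j) 2

theorem hasSum_norm_dualCoord_sq (f : BiSeq X →L[ℂ] ℂ) :
    HasSum (fun j => ‖dualCoord f j‖ ^ 2) (‖f‖ ^ 2) := by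
  have hsum : Summable fun j => ‖dualCoord f j‖ ^ 2 :=
    summable_of_sum_le (fun _ => sq_nonneg _) (sum_norm_dualCoord_sq_le f)
  convert hsum.hasSum using 1
  refine le_antisymm ?_ (hsum.tsum_le_of_sum_le (sum_norm_dualCoord_sq_le f))
  refine (Real.le_sqrt (norm_nonneg _) (tsum_nonneg fun _ => sq_nonneg _)).1 ?_
  refine f.opNorm_le_bound (Real.sqrt_nonneg _) fun x => ?_
  refine le_of_tendsto (f.hasSum (BiSeq.hasSum_single x)).norm (Eventually.of_forall fun s => ?_)
  calc ‖∑ j ∈ s, f (lp.singleContinuousLinearMap ℂ (fun _ : ℤ => X) 2 j (x j))‖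
      ≤ ∑ j ∈ s, ‖dualCoord f j‖ * ‖x j‖ :=
        norm_sum_le_of_le _ fun j _ => (dualCoord f j).le_opNorm (x j)
    _ ≤ √(∑ j ∈ s, ‖dualCoord f j‖ ^ 2) * √(∑ j ∈ s, ‖x j‖ ^ 2) :=
        Real.sum_mul_le_sqrt_mul_sqrt _ _ _
    _ ≤ √(∑' j, ‖dualCoord f j‖ ^ 2) * ‖x‖ := by
        gcongr
        · exact hsum.sum_le_tsum s fun _ _ => sq_nonneg _
        · rw [Real.sqrt_le_left (norm_nonneg _)]
          exact sum_le_hasSum s (fun _ _ => sq_nonneg _) (BiSeq.hasSum_norm_sq x)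

end Coordinates

/-! ### Complex uniform convexity of `ℓ²` sums -/

section UniformConvexity

open Complex (I)

variable {Y : Type*} [NormedAddCommGroup Y] [NormedSpace ℂ Y]

/-- The mean of `‖x + ζ y‖²` over the fourth roots of unity `ζ`. Complex uniform convexity is
quantified through it because, unlike a maximum over `ζ`, it is additive along `ℓ²` sums. -/
def fourMean (x y : Y) : ℝ :=
  (‖x + y‖ ^ 2 + ‖x - y‖ ^ 2 + ‖x + I • y‖ ^ 2 + ‖x - I • y‖ ^ 2) / 4

theorem two_mul_norm_le_norm_add_add_norm_sub (x y : Y) : 2 * ‖x‖ ≤ ‖x + y‖ + ‖x - y‖ :=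
  calc 2 * ‖x‖ = ‖(x + y) + (x - y)‖ := by
        rw [add_add_sub_cancel, ← two_smul ℂ, norm_smul, Complex.norm_ofNat]
    _ ≤ ‖x + y‖ + ‖x - y‖ := norm_add_le _ _

theorem two_mul_norm_sq_le (x y : Y) : 2 * ‖x‖ ^ 2 ≤ ‖x + y‖ ^ 2 + ‖x - y‖ ^ 2 := by
  nlinarith [norm_nonneg x, two_mul_norm_le_norm_add_add_norm_sub x y,
    sq_nonneg (‖x + y‖ - ‖x - y‖)]

theorem norm_sq_le_fourMean (x y : Y) : ‖y‖ ^ 2 ≤ fourMean x y := by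
  have h := two_mul_norm_sq_le y x
  have hI := two_mul_norm_sq_le (I • y) x
  rw [add_comm y, norm_sub_rev] at h
  rw [norm_smul, Complex.norm_I, one_mul, add_comm _ x, norm_sub_rev] at hI
  unfold fourMean
  linarith

theorem two_mul_norm_sq_add_le {x y : Y} {τ : ℝ} (hτ : 0 ≤ τ)
    (h : (1 + τ) * ‖x‖ ≤ max ‖x + y‖ ‖x - y‖) :
    2 * ‖x‖ ^ 2 + τ ^ 2 / 2 * ‖x‖ ^ 2 ≤ ‖x + y‖ ^ 2 + ‖x - y‖ ^ 2 := by
  have hsum := two_mul_norm_le_norm_add_add_norm_sub x y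
  have hp := norm_nonneg (x + y)
  have hq := norm_nonneg (x - y)
  have hx := norm_nonneg x
  have hτx : 0 ≤ τ * ‖x‖ := mul_nonneg hτ hx
  generalize ‖x + y‖ = p at *
  generalize ‖x - y‖ = q at *
  wlog hpq : q ≤ p generalizing p q
  · rw [add_comm (p ^ 2)]
    exact this q hq p hp (by rwa [max_comm]) (by rwa [add_comm]) (le_of_not_ge hpq)
  rw [max_eq_left hpq] at h
  rcases le_total ‖x‖ q with hxq | hxq
  · nlinarith
  · nlinarith [pow_le_pow_left₀ hτx (by linarith : τ * ‖x‖ ≤ p - q) 2]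

theorem norm_add_real_smul_le {x u : Y} {ρ : ℝ} (hadd : ‖x + u‖ ≤ ρ) (hsub : ‖x - u‖ ≤ ρ) {a : ℝ}
    (ha : |a| ≤ 1) : ‖x + (a : ℂ) • u‖ ≤ ρ := by
  obtain ⟨ha₁, ha₂⟩ := abs_le.1 ha
  have hcomb : x + (a : ℂ) • u =
      (((1 + a) / 2 : ℝ) : ℂ) • (x + u) + (((1 - a) / 2 : ℝ) : ℂ) • (x - u) := by
    push_cast
    module
  calc ‖x + (a : ℂ) • u‖ ≤ (1 + a) / 2 * ‖x + u‖ + (1 - a) / 2 * ‖x - u‖ := by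
        rw [hcomb]
        refine (norm_add_le _ _).trans_eq ?_
        rw [norm_smul, norm_smul, Complex.norm_of_nonneg (by linarith),
          Complex.norm_of_nonneg (by linarith)]
    _ ≤ (1 + a) / 2 * ρ + (1 - a) / 2 * ρ := by
        gcongr
        linarith
    _ = ρ := by ring

theorem norm_add_smul_half_le {x y : Y} {ρ : ℝ} (hadd : ‖x + y‖ ≤ ρ) (hsub : ‖x - y‖ ≤ ρ)
    (haddI : ‖x + I • y‖ ≤ ρ) (hsubI : ‖x - I • y‖ ≤ ρ) {ζ : ℂ} (hζ : ‖ζ‖ ≤ 1) :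
    ‖x + ζ • (1 / 2 : ℂ) • y‖ ≤ ρ := by
  have hre := norm_add_real_smul_le hadd hsub ((Complex.abs_re_le_norm ζ).trans hζ)
  have him := norm_add_real_smul_le haddI hsubI ((Complex.abs_im_le_norm ζ).trans hζ)
  have hmean : x + ζ • (1 / 2 : ℂ) • y =
      (1 / 2 : ℂ) • ((x + (ζ.re : ℂ) • y) + (x + (ζ.im : ℂ) • I • y)) := by
    conv_lhs => rw [← Complex.re_add_im ζ]
    module
  rw [hmean, norm_smul, show ‖(1 / 2 : ℂ)‖ = 1 / 2 by norm_num]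
  linarith [norm_add_le (x + (ζ.re : ℂ) • y) (x + (ζ.im : ℂ) • I • y)]

namespace ComplexUniformlyConvex

theorem exists_norm_le_mul (hY : ComplexUniformlyConvex Y) {ε : ℝ} (hε : 0 < ε) :
    ∃ δ : ℝ, 0 < δ ∧ ∀ (x y : Y) (ρ : ℝ), 0 < ρ → ε * ρ ≤ ‖y‖ →
      (∀ ζ : ℂ, ‖ζ‖ ≤ 1 → ‖x + ζ • y‖ ≤ ρ) → ‖x‖ ≤ (1 - δ) * ρ := by
  obtain ⟨δ, hδ, hconv⟩ := hY ε hε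
  refine ⟨δ, hδ, fun x y ρ hρ hy hxy => ?_⟩
  have hscale : ∀ u : Y, ‖(ρ⁻¹ : ℂ) • u‖ = ‖u‖ / ρ := fun u => by
    rw [norm_smul, norm_inv, Complex.norm_of_nonneg hρ.le, inv_mul_eq_div]
  rw [← div_le_iff₀ hρ, ← hscale]
  refine hconv _ ((ρ⁻¹ : ℂ) • y) ?_ fun ζ hζ => ?_
  · rwa [hscale, le_div_iff₀ hρ]
  · rw [smul_comm ζ, ← smul_add, hscale, div_le_one hρ]
    exact hxy ζ hζ

theorem exists_one_add_mul_norm_le (hY : ComplexUniformlyConvex Y) {ε : ℝ} (hε : 0 < ε) :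
    ∃ τ : ℝ, 0 < τ ∧ ∀ x y : Y, ε * ‖x‖ ≤ ‖y‖ →
      (1 + τ) * ‖x‖ ≤ max ‖x + y‖ ‖x - y‖ ∨ (1 + τ) * ‖x‖ ≤ max ‖x + I • y‖ ‖x - I • y‖ := by
  obtain ⟨δ, hδ, hconv⟩ := hY.exists_norm_le_mul (show 0 < ε / 4 by positivity)
  set τ := min (δ / 2) 1
  have hτ : 0 < τ := lt_min (by linarith) one_pos
  have hτ1 : τ ≤ 1 := min_le_right _ _
  have hτδ : τ ≤ δ / 2 := min_le_left _ _
  refine ⟨τ, hτ, fun x y hxy => ?_⟩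
  by_contra! hcon
  simp only [max_lt_iff] at hcon
  obtain ⟨⟨hadd, hsub⟩, haddI, hsubI⟩ := hcon
  have hρ : 0 < (1 + τ) * ‖x‖ := (norm_nonneg _).trans_lt hadd
  have hx : 0 < ‖x‖ := pos_of_mul_pos_right hρ (by linarith)
  have hle := hconv x ((1 / 2 : ℂ) • y) _ hρ ?_ fun ζ hζ =>
    norm_add_smul_half_le hadd.le hsub.le haddI.le hsubI.le hζ
  · nlinarith [mul_pos hδ hτ]
  · rw [norm_smul, show ‖(1 / 2 : ℂ)‖ = 1 / 2 by norm_num]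
    nlinarith [mul_pos hε hx]

theorem exists_one_add_mul_norm_sq_le_fourMean (hY : ComplexUniformlyConvex Y) {ε : ℝ}
    (hε : 0 < ε) : ∃ c : ℝ, 0 < c ∧ ∀ x y : Y, ε * ‖x‖ ≤ ‖y‖ →
      (1 + c) * ‖x‖ ^ 2 ≤ fourMean x y := by
  obtain ⟨τ, hτ, hle⟩ := hY.exists_one_add_mul_norm_le hε
  refine ⟨τ ^ 2 / 8, by positivity, fun x y hxy => ?_⟩
  have h := two_mul_norm_sq_le x y
  have hI := two_mul_norm_sq_le x (I • y)
  unfold fourMean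
  rcases hle x y hxy with hmax | hmax
  all_goals linarith [two_mul_norm_sq_add_le hτ.le hmax]

theorem exists_norm_sq_le (hY : ComplexUniformlyConvex Y) {η : ℝ} (hη : 0 < η) :
    ∃ C : ℝ, 0 < C ∧ ∀ x y : Y, ‖y‖ ^ 2 ≤ η * ‖x‖ ^ 2 + C * (fourMean x y - ‖x‖ ^ 2) := by
  obtain ⟨c, hc, hgain⟩ := hY.exists_one_add_mul_norm_sq_le_fourMean (Real.sqrt_pos.2 hη)
  refine ⟨1 + 1 / c, by positivity, fun x y => ?_⟩
  have hη' : 0 ≤ η * ‖x‖ ^ 2 := by positivity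
  have hmean : 0 ≤ fourMean x y - ‖x‖ ^ 2 := by
    have h := two_mul_norm_sq_le x y
    have hI := two_mul_norm_sq_le x (I • y)
    unfold fourMean
    linarith
  rcases le_total ‖y‖ (√η * ‖x‖) with hsmall | hlarge
  · have hy := pow_le_pow_left₀ (norm_nonneg y) hsmall 2
    rw [mul_pow, Real.sq_sqrt hη.le] at hy
    exact hy.trans (le_add_of_nonneg_right (by positivity))
  · have hx : ‖x‖ ^ 2 ≤ 1 / c * (fourMean x y - ‖x‖ ^ 2) := by
      rw [one_div_mul_eq_div, le_div_iff₀ hc]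
      linarith [hgain x y hlarge]
    linarith [norm_sq_le_fourMean x y]

theorem of_hasSum {ι V : Type*} [NormedAddCommGroup V] [NormedSpace ℂ V]
    (hY : ComplexUniformlyConvex Y) (π : ι → V →ₗ[ℂ] Y)
    (hπ : ∀ v, HasSum (fun j => ‖π j v‖ ^ 2) (‖v‖ ^ 2)) : ComplexUniformlyConvex V := by
  intro ε hε
  obtain ⟨C, hC, hle⟩ := hY.exists_norm_sq_le (show 0 < ε ^ 2 / 2 by positivity)
  refine ⟨ε ^ 2 / (4 * C), by positivity, fun u v hv huv => ?_⟩
  have hmean : HasSum (fun j => fourMean (π j u) (π j v)) (fourMean u v) := by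
    have h := (((hπ (u + v)).add (hπ (u - v))).add (hπ (u + I • v))).add (hπ (u - I • v))
    simp only [map_add, map_sub, map_smul] at h
    exact h.div_const 4
  have hsum : ‖v‖ ^ 2 ≤ ε ^ 2 / 2 * ‖u‖ ^ 2 + C * (fourMean u v - ‖u‖ ^ 2) :=
    hasSum_le (fun j => hle (π j u) (π j v)) (hπ v)
      (((hπ u).mul_left _).add ((hmean.sub (hπ u)).mul_left C))
  have hu : ‖u‖ ≤ 1 := by simpa using huv 0 (by simp)
  have hmean_le : fourMean u v ≤ 1 := by
    have hsq : ∀ ζ : ℂ, ‖ζ‖ ≤ 1 → ‖u + ζ • v‖ ^ 2 ≤ 1 := fun ζ hζ =>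
      pow_le_one₀ (norm_nonneg _) (huv ζ hζ)
    have h := hsq 1 (by simp)
    have hneg := hsq (-1) (by simp)
    have hI := hsq I (by simp)
    have hnegI := hsq (-I) (by simp)
    simp only [neg_smul, one_smul, ← sub_eq_add_neg] at h hneg hnegI
    unfold fourMean
    linarith
  have hdefect : ε ^ 2 ≤ (1 - ‖u‖) * (4 * C) := by
    have hC_mul : C * (fourMean u v - ‖u‖ ^ 2) ≤ C * (2 * (1 - ‖u‖)) :=
      mul_le_mul_of_nonneg_left (by nlinarith [norm_nonneg u]) hC.le
    nlinarith [pow_le_pow_left₀ hε.le hv 2, pow_le_one₀ (n := 2) (norm_nonneg u) hu, sq_nonneg ε]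
  linarith [(div_le_iff₀ (by positivity)).2 hdefect]

variable {X : Type*} [NormedAddCommGroup X] [NormedSpace ℂ X]

protected theorem biSeq (hX : ComplexUniformlyConvex X) : ComplexUniformlyConvex (BiSeq X) :=
  hX.of_hasSum (fun j => (lp.evalCLM ℂ (fun _ : ℤ => X) 2 j).toLinearMap) BiSeq.hasSum_norm_sq

protected theorem dual_biSeq (hX : ComplexUniformlyConvex (X →L[ℂ] ℂ)) :
    ComplexUniformlyConvex (BiSeq X →L[ℂ] ℂ) :=
  hX.of_hasSum (fun j => (ContinuousLinearMap.precomp ℂ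
    (lp.singleContinuousLinearMap ℂ (fun _ : ℤ => X) 2 j)).toLinearMap) hasSum_norm_dualCoord_sq

end ComplexUniformlyConvex

end UniformConvexity

/-! ### Windows and finite sections -/

section Windows

variable {X : Type*} [NormedAddCommGroup X] [NormedSpace ℂ X]

/-- The embedding of `Xⁿ` into `ℓ²(ℤ, X)` at the positions `k+1, …, k+n`. -/
def windowEmbed (X : Type*) [NormedAddCommGroup X] [NormedSpace ℂ X] (n : ℕ) (k : ℤ) :
    PiLp 2 (fun _ : Fin n => X) →L[ℂ] BiSeq X :=
  ∑ i : Fin n, (lp.singleContinuousLinearMap ℂ (fun _ : ℤ => X) 2 (k + 1 + (i : ℤ))).comp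
    (PiLp.proj 2 (fun _ : Fin n => X) i)

/-- The restriction of a sequence to the positions `k+1, …, k+n`. -/
def windowRestrict (X : Type*) [NormedAddCommGroup X] [NormedSpace ℂ X] (n : ℕ) (k : ℤ) :
    BiSeq X →L[ℂ] PiLp 2 (fun _ : Fin n => X) :=
  ((PiLp.continuousLinearEquiv 2 ℂ (fun _ : Fin n => X)).symm :
      (Fin n → X) →L[ℂ] PiLp 2 (fun _ : Fin n => X)).comp
    (ContinuousLinearMap.pi fun i : Fin n => lp.evalCLM ℂ (fun _ : ℤ => X) 2 (k + 1 + (i : ℤ)))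

variable (n : ℕ) (k : ℤ)

instance nontrivial_piLp {n : ℕ} [NeZero n] [Nontrivial X] :
    Nontrivial (PiLp 2 fun _ : Fin n => X) :=
  inferInstanceAs (Nontrivial (WithLp 2 (Fin n → X)))

theorem windowRestrict_apply (x : BiSeq X) (i : Fin n) :
    windowRestrict X n k x i = x (k + 1 + (i : ℤ)) := rfl

theorem BiSeq.sum_apply {ι : Type*} (s : Finset ι) (f : ι → BiSeq X) (j : ℤ) :
    (∑ i ∈ s, f i : BiSeq X) j = ∑ i ∈ s, f i j :=
  map_sum (lp.evalCLM ℂ (fun _ : ℤ => X) 2 j) f s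

theorem windowEmbed_apply (y : PiLp 2 (fun _ : Fin n => X)) :
    windowEmbed X n k y = ∑ i : Fin n,
      lp.singleContinuousLinearMap ℂ (fun _ : ℤ => X) 2 (k + 1 + (i : ℤ)) (y i) := by
  simp [windowEmbed]

theorem windowEmbed_apply_notMem (y : PiLp 2 (fun _ : Fin n => X)) {j : ℤ}
    (h : ¬ (k + 1 ≤ j ∧ j ≤ k + n)) : windowEmbed X n k y j = 0 := by
  rw [windowEmbed_apply, BiSeq.sum_apply]
  refine Finset.sum_eq_zero fun i _ => ?_
  rw [BiSeq.single_apply, if_neg (by omega)]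

theorem windowRestrict_embed (y : PiLp 2 (fun _ : Fin n => X)) :
    windowRestrict X n k (windowEmbed X n k y) = y := by
  ext i
  rw [windowRestrict_apply, windowEmbed_apply, BiSeq.sum_apply, Finset.sum_eq_single i]
  · rw [BiSeq.single_apply, if_pos rfl]
  · intro j _ hj
    rw [BiSeq.single_apply, if_neg fun h => hj (Fin.ext (by omega))]
  · exact fun h => absurd (Finset.mem_univ _) h

theorem windowEmbed_restrict_apply (x : BiSeq X) (j : ℤ) :
    windowEmbed X n k (windowRestrict X n k x) j =
      if k + 1 ≤ j ∧ j ≤ k + n then x j else 0 := by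
  split_ifs with h
  · obtain ⟨i, rfl⟩ : ∃ i : Fin n, k + 1 + (i : ℤ) = j :=
      ⟨⟨(j - k - 1).toNat, by omega⟩, by simp only; omega⟩
    rw [← windowRestrict_apply, windowRestrict_embed, windowRestrict_apply]
  · exact windowEmbed_apply_notMem n k _ h

theorem windowEmbed_restrict_of_support {x : BiSeq X}
    (hx : ∀ j, ¬ (k + 1 ≤ j ∧ j ≤ k + n) → x j = 0) :
    windowEmbed X n k (windowRestrict X n k x) = x := by
  ext j
  rw [windowEmbed_restrict_apply]
  split_ifs with h
  · rfl
  · exact (hx j h).symm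

theorem windowEmbed_restrict_single {j : ℤ} (hj : k + 1 ≤ j ∧ j ≤ k + n) (x : X) :
    windowEmbed X n k (windowRestrict X n k
      (lp.singleContinuousLinearMap ℂ (fun _ : ℤ => X) 2 j x)) =
      lp.singleContinuousLinearMap ℂ (fun _ : ℤ => X) 2 j x :=
  windowEmbed_restrict_of_support n k fun i hi => by
    rw [BiSeq.single_apply, if_neg]
    rintro rfl
    exact hi hj

theorem windowRestrict_single_of_notMem {j : ℤ} (hj : ¬ (k + 1 ≤ j ∧ j ≤ k + n)) (x : X) :
    windowRestrict X n k (lp.singleContinuousLinearMap ℂ (fun _ : ℤ => X) 2 j x) = 0 := by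
  ext i
  rw [windowRestrict_apply, BiSeq.single_apply, if_neg (by omega), PiLp.zero_apply]

theorem injective_window : Function.Injective fun i : ℕ => k + 1 + (i : ℤ) :=
  (add_right_injective (k + 1)).comp Nat.cast_injective

theorem eq_sum_window_of_hasSum {g : ℤ → ℝ} {S : ℝ} (h : HasSum g S)
    (hg : ∀ j, ¬ (k + 1 ≤ j ∧ j ≤ k + n) → g j = 0) :
    S = ∑ i ∈ Finset.range n, g (k + 1 + i) := by
  have hwindow : HasSum g (∑ j ∈ (Finset.range n).map ⟨_, injective_window k⟩, g j) := by
    refine hasSum_sum_of_ne_finset_zero fun j hj => hg j fun hj' => hj ?_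
    exact Finset.mem_map.2 ⟨(j - k - 1).toNat, Finset.mem_range.2 (by omega), by
      simp only [Function.Embedding.coeFn_mk]; omega⟩
  rw [h.unique hwindow, Finset.sum_map]
  rfl

theorem norm_windowRestrict_apply_sq (x : BiSeq X) :
    ‖windowRestrict X n k x‖ ^ 2 = ∑ i ∈ Finset.range n, ‖x (k + 1 + i)‖ ^ 2 := by
  rw [PiLp.norm_sq_eq_of_L2, Finset.sum_range fun i : ℕ => ‖x (k + 1 + i)‖ ^ 2]
  rfl

theorem norm_windowRestrict_le_one : ‖windowRestrict X n k‖ ≤ 1 :=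
  ContinuousLinearMap.opNorm_le_bound _ zero_le_one fun x => by
    rw [one_mul]
    refine le_of_sq_le_sq ?_ (norm_nonneg _)
    rw [norm_windowRestrict_apply_sq]
    have hle := sum_le_hasSum ((Finset.range n).map ⟨_, injective_window k⟩)
      (fun _ _ => sq_nonneg _) (BiSeq.hasSum_norm_sq x)
    rwa [Finset.sum_map] at hle

theorem norm_windowEmbed_apply (y : PiLp 2 (fun _ : Fin n => X)) :
    ‖windowEmbed X n k y‖ = ‖y‖ := by
  have hsq := eq_sum_window_of_hasSum n k (BiSeq.hasSum_norm_sq (windowEmbed X n k y))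
    fun j hj => by rw [windowEmbed_apply_notMem n k y hj, norm_zero, zero_pow two_ne_zero]
  rw [← norm_windowRestrict_apply_sq, windowRestrict_embed] at hsq
  exact (pow_left_inj₀ (norm_nonneg _) (norm_nonneg _) two_ne_zero).1 hsq

theorem norm_windowEmbed_le_one : ‖windowEmbed X n k‖ ≤ 1 :=
  ContinuousLinearMap.opNorm_le_bound _ zero_le_one fun y => by
    rw [one_mul, norm_windowEmbed_apply]

theorem norm_comp_windowRestrict (g : PiLp 2 (fun _ : Fin n => X) →L[ℂ] ℂ) :
    ‖g.comp (windowRestrict X n k)‖ = ‖g‖ := by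
  refine le_antisymm ((g.opNorm_comp_le _).trans
    (mul_le_of_le_one_right (norm_nonneg _) (norm_windowRestrict_le_one n k))) ?_
  refine g.opNorm_le_bound (norm_nonneg _) fun y => ?_
  have hle := (g.comp (windowRestrict X n k)).le_opNorm (windowEmbed X n k y)
  rwa [ContinuousLinearMap.comp_apply, windowRestrict_embed, norm_windowEmbed_apply] at hle

theorem norm_sq_eq_sum_norm_dualCoord_sq (g : PiLp 2 (fun _ : Fin n => X) →L[ℂ] ℂ) :
    ‖g‖ ^ 2 = ∑ i ∈ Finset.range n,
      ‖dualCoord (g.comp (windowRestrict X n k)) (k + 1 + i)‖ ^ 2 := by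
  rw [← norm_comp_windowRestrict n k g]
  refine eq_sum_window_of_hasSum n k (hasSum_norm_dualCoord_sq _) fun j hj => ?_
  have hzero : dualCoord (g.comp (windowRestrict X n k)) j = 0 := by
    ext x
    rw [dualCoord_apply, ContinuousLinearMap.comp_apply, windowRestrict_single_of_notMem n k hj,
      map_zero, zero_apply]
  rw [hzero, norm_zero, zero_pow two_ne_zero]

variable (A : BiSeq X →L[ℂ] BiSeq X)

theorem finiteSection_eq_comp :
    finiteSection A n k = (windowRestrict X n k).comp (A.comp (windowEmbed X n k)) := by
  ext y i
  change (∑ j : Fin n, (matrixEntry A (k + 1 + (i : ℤ)) (k + 1 + (j : ℤ))).comp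
        (PiLp.proj 2 (fun _ : Fin n => X) j)) y = A (windowEmbed X n k y) (k + 1 + (i : ℤ))
  rw [windowEmbed_apply, map_sum, BiSeq.sum_apply]
  simp only [FunLike.coe_sum, Finset.sum_apply]
  rfl

theorem norm_finiteSection_le : ‖finiteSection A n k‖ ≤ ‖A‖ := by
  rw [finiteSection_eq_comp]
  calc ‖(windowRestrict X n k).comp (A.comp (windowEmbed X n k))‖
      ≤ ‖windowRestrict X n k‖ * (‖A‖ * ‖windowEmbed X n k‖) :=
        (ContinuousLinearMap.opNorm_comp_le _ _).trans
          (mul_le_mul_of_nonneg_left (ContinuousLinearMap.opNorm_comp_le _ _) (norm_nonneg _))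
    _ ≤ 1 * (‖A‖ * 1) := by
        gcongr
        · exact norm_windowRestrict_le_one n k
        · exact norm_windowEmbed_le_one n k
    _ = ‖A‖ := by ring

theorem finiteSection_sub_smul (z : ℂ) :
    finiteSection (A - z • ContinuousLinearMap.id ℂ _) n k =
      finiteSection A n k - z • ContinuousLinearMap.id ℂ _ := by
  rw [finiteSection_eq_comp, finiteSection_eq_comp]
  ext y : 1
  change windowRestrict X n k (A (windowEmbed X n k y) - z • windowEmbed X n k y) =
    windowRestrict X n k (A (windowEmbed X n k y)) - z • y
  rw [map_sub, map_smul, windowRestrict_embed]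

variable {A}

theorem matrixEntry_sub_smul (z : ℂ) {i j : ℤ} (h : i ≠ j) :
    matrixEntry (A - z • ContinuousLinearMap.id ℂ _) i j = matrixEntry A i j := by
  ext x
  rw [matrixEntry_apply, matrixEntry_apply]
  change A _ i - z • (lp.singleContinuousLinearMap ℂ (fun _ : ℤ => X) 2 j x : BiSeq X) i = _
  rw [BiSeq.single_apply, if_neg h, smul_zero, sub_zero]

theorem IsTridiagonal.sub_smul (hA : IsTridiagonal A) (z : ℂ) :
    IsTridiagonal (A - z • ContinuousLinearMap.id ℂ _) := by
  intro i j hij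
  rw [matrixEntry_sub_smul z (by rintro rfl; simp at hij), hA i j hij]

theorem tauPenalty_sub_smul (z : ℂ) :
    tauPenalty (A - z • ContinuousLinearMap.id ℂ _) n = tauPenalty A n := by
  have hsub : subdiagNorm (A - z • ContinuousLinearMap.id ℂ _) = subdiagNorm A := by
    simp only [subdiagNorm]
    exact iSup_congr fun j => by rw [matrixEntry_sub_smul z (by omega)]
  have hsuper : superdiagNorm (A - z • ContinuousLinearMap.id ℂ _) = superdiagNorm A := by
    simp only [superdiagNorm]
    exact iSup_congr fun j => by rw [matrixEntry_sub_smul z (by omega)]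
  simp only [tauPenalty, hsub, hsuper]

end Windows

/-! ### Pseudospectra are contained in those of the finite sections -/

section Truncation

variable {X : Type*} [NormedAddCommGroup X] [NormedSpace ℂ X]

theorem norm_smul_add_smul_add_smul_le {V : Type*} [NormedAddCommGroup V] [NormedSpace ℂ V]
    (r s t : ℝ) (u v w : V) :
    ‖(r : ℂ) • u + (s : ℂ) • v + (t : ℂ) • w‖ ≤
      |s| * ‖u + v + w‖ + (|s - r| * ‖u‖ + |t - s| * ‖w‖) := by
  have hdecomp : (r : ℂ) • u + (s : ℂ) • v + (t : ℂ) • w =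
      (s : ℂ) • (u + v + w) + (((r - s : ℝ) : ℂ) • u + ((t - s : ℝ) : ℂ) • w) := by
    push_cast
    module
  rw [hdecomp, abs_sub_comm s r]
  refine (norm_add_le _ _).trans (add_le_add ?_ ((norm_add_le _ _).trans (add_le_add ?_ ?_))) <;>
  · rw [norm_smul, Complex.norm_real, Real.norm_eq_abs]

/-- Multiplication by the weight `w`, placed at the positions `k+1, …, k+n`. -/
def windowMul (X : Type*) [NormedAddCommGroup X] [NormedSpace ℂ X] (w : ℤ → ℝ) (n : ℕ) (k : ℤ) :
    BiSeq X →L[ℂ] BiSeq X :=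
  ∑ i : Fin n, (w (i + 1) : ℂ) •
    (lp.singleContinuousLinearMap ℂ (fun _ : ℤ => X) 2 (k + 1 + (i : ℤ))).comp
      (lp.evalCLM ℂ (fun _ : ℤ => X) 2 (k + 1 + (i : ℤ)))

section WindowMul

variable {w : ℤ → ℝ} {n : ℕ} (hw : ∀ i, ¬ (1 ≤ i ∧ i ≤ (n : ℤ)) → w i = 0) (k : ℤ)
include hw

theorem windowMul_apply (x : BiSeq X) (j : ℤ) :
    windowMul X w n k x j = (w (j - k) : ℂ) • x j := by
  have hsum : windowMul X w n k x j =
      ∑ i : Fin n, (w (i + 1) : ℂ) • if j = k + 1 + i then x (k + 1 + i) else 0 := by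
    simp only [windowMul, FunLike.coe_sum, Finset.sum_apply, BiSeq.sum_apply]
    refine Finset.sum_congr rfl fun i _ => ?_
    rw [← BiSeq.single_apply]
    rfl
  rw [hsum]
  by_cases h : k + 1 ≤ j ∧ j ≤ k + n
  · obtain ⟨i, rfl⟩ : ∃ i : Fin n, k + 1 + (i : ℤ) = j :=
      ⟨⟨(j - k - 1).toNat, by omega⟩, by simp only; omega⟩
    rw [Finset.sum_eq_single i (fun l _ hl => by
        rw [if_neg fun h => hl (Fin.ext (by omega)), smul_zero])
      (fun h => absurd (Finset.mem_univ _) h), if_pos rfl,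
      show k + 1 + (i : ℤ) - k = i + 1 by ring]
  · rw [hw _ (by omega), Complex.ofReal_zero, zero_smul]
    exact Finset.sum_eq_zero fun i _ => by rw [if_neg (by omega), smul_zero]

theorem windowMul_single (j : ℤ) (x : X) :
    windowMul X w n k (lp.singleContinuousLinearMap ℂ (fun _ : ℤ => X) 2 j x) =
      (w (j - k) : ℂ) • lp.singleContinuousLinearMap ℂ (fun _ : ℤ => X) 2 j x := by
  ext i
  rw [windowMul_apply hw, lp.coeFn_smul, Pi.smul_apply, BiSeq.single_apply]
  split_ifs with h
  · rw [h]
  · rw [smul_zero, smul_zero]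

theorem windowEmbed_restrict_windowMul (x : BiSeq X) :
    windowEmbed X n k (windowRestrict X n k (windowMul X w n k x)) = windowMul X w n k x :=
  windowEmbed_restrict_of_support n k fun j hj => by
    rw [windowMul_apply hw, hw _ (by omega), Complex.ofReal_zero, zero_smul]

theorem windowMul_embed_restrict (x : BiSeq X) :
    windowMul X w n k (windowEmbed X n k (windowRestrict X n k x)) = windowMul X w n k x := by
  ext j
  rw [windowMul_apply hw, windowMul_apply hw, windowEmbed_restrict_apply]
  split_ifs with hj
  · rfl
  · rw [hw _ (by omega), Complex.ofReal_zero, zero_smul, zero_smul]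

theorem norm_windowRestrict_windowMul_sq (x : BiSeq X) :
    ‖windowRestrict X n k (windowMul X w n k x)‖ ^ 2 =
      ∑ i ∈ Finset.range n, w (i + 1) ^ 2 * ‖x (k + 1 + i)‖ ^ 2 := by
  rw [norm_windowRestrict_apply_sq]
  refine Finset.sum_congr rfl fun i _ => ?_
  rw [windowMul_apply hw, norm_smul, mul_pow, Complex.norm_real, Real.norm_eq_abs, sq_abs,
    show k + 1 + (i : ℤ) - k = i + 1 by ring]

theorem dualCoord_comp_windowMul (f : BiSeq X →L[ℂ] ℂ) (j : ℤ) :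
    dualCoord (f.comp (windowMul X w n k)) j = (w (j - k) : ℂ) • dualCoord f j := by
  ext x
  rw [dualCoord_apply, ContinuousLinearMap.comp_apply, windowMul_single hw, map_smul]
  rfl

end WindowMul

section Tridiagonal

variable {B : BiSeq X →L[ℂ] BiSeq X} (hB : IsTridiagonal B)
include hB

theorem IsTridiagonal.dualCoord_comp (f : BiSeq X →L[ℂ] ℂ) (j : ℤ) :
    dualCoord (f.comp B) j = (dualCoord f (j - 1)).comp (matrixEntry B (j - 1) j) +
      (dualCoord f j).comp (matrixEntry B j j) +
      (dualCoord f (j + 1)).comp (matrixEntry B (j + 1) j) := by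
  ext x
  set v := B (lp.singleContinuousLinearMap ℂ (fun _ : ℤ => X) 2 j x) with hv
  have hcolumn : HasSum
      (fun l => f (lp.singleContinuousLinearMap ℂ (fun _ : ℤ => X) 2 l (v l)))
      (∑ l ∈ {j - 1, j, j + 1}, f (lp.singleContinuousLinearMap ℂ (fun _ : ℤ => X) 2 l (v l))) :=
    hasSum_sum_of_ne_finset_zero fun l hl => by
      simp only [Finset.mem_insert, Finset.mem_singleton, not_or] at hl
      rw [hv, ← matrixEntry_apply, hB l j (lt_abs.2 (by omega)), zero_apply, map_zero, map_zero]
  change f v = _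
  rw [(f.hasSum (BiSeq.hasSum_single v)).unique hcolumn, Finset.sum_insert (by simp; omega),
    Finset.sum_insert (by simp), Finset.sum_singleton, ← add_assoc]
  rfl

variable {w : ℤ → ℝ} {n : ℕ} (hw : ∀ i, ¬ (1 ≤ i ∧ i ≤ (n : ℤ)) → w i = 0) (k : ℤ)
include hw

theorem IsTridiagonal.norm_apply_windowMul_le (x : BiSeq X) (i : ℕ) :
    ‖B (windowMul X w n k x) (k + 1 + i)‖ ≤ |w (i + 1)| * ‖B x (k + 1 + i)‖ +
      (subdiagNorm B * |w (i + 1) - w i| * ‖x (k + 1 + i - 1)‖ +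
        superdiagNorm B * |w (i + 1 + 1) - w (i + 1)| * ‖x (k + 1 + i + 1)‖) := by
  rw [hB.apply_eq (windowMul X w n k x), hB.apply_eq x]
  set j : ℤ := k + 1 + i
  have hleft : ‖matrixEntry B j (j - 1) (x (j - 1))‖ ≤ subdiagNorm B * ‖x (j - 1)‖ := by
    refine (matrixEntry B j (j - 1)).le_of_opNorm_le ?_ _
    simpa only [sub_add_cancel] using norm_matrixEntry_le_subdiagNorm B (j - 1)
  have hright : ‖matrixEntry B j (j + 1) (x (j + 1))‖ ≤ superdiagNorm B * ‖x (j + 1)‖ := by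
    refine (matrixEntry B j (j + 1)).le_of_opNorm_le ?_ _
    simpa only [add_sub_cancel_right] using norm_matrixEntry_le_superdiagNorm B (j + 1)
  simp only [windowMul_apply hw, map_smul, show j - 1 - k = i by omega,
    show j - k = i + 1 by omega, show j + 1 - k = i + 1 + 1 by omega]
  refine (norm_smul_add_smul_add_smul_le _ _ _ _ _ _).trans ?_
  rw [mul_comm (subdiagNorm B), mul_comm (superdiagNorm B), mul_assoc, mul_assoc]
  gcongr

theorem IsTridiagonal.norm_dualCoord_comp_windowMul_le (f : BiSeq X →L[ℂ] ℂ) (i : ℕ) :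
    ‖dualCoord ((f.comp (windowMul X w n k)).comp B) (k + 1 + i)‖ ≤
      |w (i + 1)| * ‖dualCoord (f.comp B) (k + 1 + i)‖ +
        (superdiagNorm B * |w (i + 1) - w i| * ‖dualCoord f (k + 1 + i - 1)‖ +
          subdiagNorm B * |w (i + 1 + 1) - w (i + 1)| * ‖dualCoord f (k + 1 + i + 1)‖) := by
  rw [hB.dualCoord_comp (f.comp _), hB.dualCoord_comp f]
  set j : ℤ := k + 1 + i
  have hleft : ‖(dualCoord f (j - 1)).comp (matrixEntry B (j - 1) j)‖ ≤
      superdiagNorm B * ‖dualCoord f (j - 1)‖ := by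
    refine (ContinuousLinearMap.opNorm_comp_le _ _).trans ?_
    rw [mul_comm]
    gcongr
    exact norm_matrixEntry_le_superdiagNorm B j
  have hright : ‖(dualCoord f (j + 1)).comp (matrixEntry B (j + 1) j)‖ ≤
      subdiagNorm B * ‖dualCoord f (j + 1)‖ := by
    refine (ContinuousLinearMap.opNorm_comp_le _ _).trans ?_
    rw [mul_comm]
    gcongr
    exact norm_matrixEntry_le_subdiagNorm B j
  simp only [dualCoord_comp_windowMul hw, ContinuousLinearMap.smul_comp,
    show j - 1 - k = i by omega, show j - k = i + 1 by omega, show j + 1 - k = i + 1 + 1 by omega]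
  refine (norm_smul_add_smul_add_smul_le _ _ _ _ _ _).trans ?_
  rw [mul_comm (subdiagNorm B), mul_comm (superdiagNorm B), mul_assoc, mul_assoc]
  gcongr

theorem IsTridiagonal.inverseGap_finiteSection_lt_of_vector {x : BiSeq X} {s : ℝ} (hs : 0 ≤ s)
    (h : ∑ i ∈ Finset.range n, (|w (i + 1)| * ‖B x (k + 1 + i)‖ +
        (subdiagNorm B * |w (i + 1) - w i| * ‖x (k + 1 + i - 1)‖ +
          superdiagNorm B * |w (i + 1 + 1) - w (i + 1)| * ‖x (k + 1 + i + 1)‖)) ^ 2 <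
      s ^ 2 * ∑ i ∈ Finset.range n, w (i + 1) ^ 2 * ‖x (k + 1 + i)‖ ^ 2) :
    inverseGap (finiteSection B n k) < s := by
  set y := windowRestrict X n k (windowMul X w n k x)
  have hupper : ‖finiteSection B n k y‖ ^ 2 < (s * ‖y‖) ^ 2 := by
    rw [mul_pow, norm_windowRestrict_windowMul_sq hw]
    refine lt_of_le_of_lt ?_ h
    rw [finiteSection_eq_comp, ContinuousLinearMap.comp_apply, ContinuousLinearMap.comp_apply,
      windowEmbed_restrict_windowMul hw, norm_windowRestrict_apply_sq]
    exact Finset.sum_le_sum fun i _ =>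
      pow_le_pow_left₀ (norm_nonneg _) (hB.norm_apply_windowMul_le hw k x i) 2
  have hlower := inverseGap_mul_norm_le (finiteSection B n k) y
  exact lt_of_mul_lt_mul_right (hlower.trans_lt (lt_of_pow_lt_pow_left₀ 2 (by positivity) hupper))
    (norm_nonneg y)

theorem IsTridiagonal.inverseGap_finiteSection_lt_of_functional {f : BiSeq X →L[ℂ] ℂ} {s : ℝ}
    (hs : 0 ≤ s)
    (h : ∑ i ∈ Finset.range n, (|w (i + 1)| * ‖dualCoord (f.comp B) (k + 1 + i)‖ +
        (superdiagNorm B * |w (i + 1) - w i| * ‖dualCoord f (k + 1 + i - 1)‖ +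
          subdiagNorm B * |w (i + 1 + 1) - w (i + 1)| * ‖dualCoord f (k + 1 + i + 1)‖)) ^ 2 <
      s ^ 2 * ∑ i ∈ Finset.range n, w (i + 1) ^ 2 * ‖dualCoord f (k + 1 + i)‖ ^ 2) :
    inverseGap (finiteSection B n k) < s := by
  set g := (f.comp (windowMul X w n k)).comp (windowEmbed X n k)
  have hcomp : g.comp (windowRestrict X n k) = f.comp (windowMul X w n k) := by
    ext x
    exact congrArg f (windowMul_embed_restrict hw k x)
  have hnorm : ‖g‖ ^ 2 = ∑ i ∈ Finset.range n, w (i + 1) ^ 2 * ‖dualCoord f (k + 1 + i)‖ ^ 2 := by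
    rw [norm_sq_eq_sum_norm_dualCoord_sq n k, hcomp]
    refine Finset.sum_congr rfl fun i _ => ?_
    rw [dualCoord_comp_windowMul hw, norm_smul, mul_pow, Complex.norm_real, Real.norm_eq_abs,
      sq_abs, show k + 1 + (i : ℤ) - k = i + 1 by ring]
  have hcoord : ∀ i < n, dualCoord ((g.comp (finiteSection B n k)).comp (windowRestrict X n k))
      (k + 1 + i) = dualCoord ((f.comp (windowMul X w n k)).comp B) (k + 1 + i) := by
    intro i hi
    rw [← hcomp, finiteSection_eq_comp]
    ext x
    refine congrArg (fun v => g (windowRestrict X n k (B v))) ?_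
    exact windowEmbed_restrict_single n k (by omega) x
  have hupper : ‖g.comp (finiteSection B n k)‖ ^ 2 < (s * ‖g‖) ^ 2 := by
    rw [mul_pow, hnorm, norm_sq_eq_sum_norm_dualCoord_sq n k]
    refine lt_of_le_of_lt (Finset.sum_le_sum fun i hi => ?_) h
    rw [hcoord i (Finset.mem_range.1 hi)]
    exact pow_le_pow_left₀ (norm_nonneg _) (hB.norm_dualCoord_comp_windowMul_le hw k f i) 2
  have hlower := inverseGap_mul_norm_le_norm_comp (finiteSection B n k) g
  exact lt_of_mul_lt_mul_right (hlower.trans_lt (lt_of_pow_lt_pow_left₀ 2 (by positivity) hupper))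
    (norm_nonneg g)

end Tridiagonal

instance nontrivial_biSeq [Nontrivial X] : Nontrivial (BiSeq X) := by
  obtain ⟨x, hx⟩ := exists_ne (0 : X)
  refine ⟨lp.singleContinuousLinearMap ℂ (fun _ : ℤ => X) 2 0 x, 0, fun h => hx ?_⟩
  have hcoord := BiSeq.single_apply 0 0 x
  rw [h, if_pos rfl] at hcoord
  exact hcoord.symm

theorem IsTridiagonal.exists_inverseGap_finiteSection_lt [CompleteSpace X] [Nontrivial X]
    {B : BiSeq X →L[ℂ] BiSeq X} (hB : IsTridiagonal B) {n : ℕ} (hn : 1 ≤ n) {ε : ℝ}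
    (h : inverseGap B < ε) : ∃ k : ℤ, inverseGap (finiteSection B n k) < ε + tauPenalty B n := by
  obtain ⟨ε', hgap, hlt⟩ := exists_between h
  have hε' : 0 < ε' := (inverseGap_nonneg _).trans_lt hgap
  obtain ⟨κ, hκdef⟩ : ∃ κ, κ = tauPenalty B n + (ε - ε') := ⟨_, rfl⟩
  obtain ⟨φ, hφ0, hφ1, hφ⟩ := exists_penaltyTerm_lt B n (show tauPenalty B n < κ by linarith)
  have hψ0 : 0 < 1 - φ := sub_pos.2 hφ1
  have hψ1 : 1 - φ < 1 := sub_lt_self 1 hφ0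
  have hκ : 0 < κ := by linarith [tauPenalty_nonneg B hn]
  have hμ : (subdiagNorm B ^ 2 / φ + superdiagNorm B ^ 2 / (1 - φ))
      * (2 * Real.sin (tauTheta n φ / 2)) ^ 2 ≤ κ ^ 2 := by
    have hsq := pow_le_pow_left₀ (mul_nonneg zero_le_two
      (penaltyTerm_nonneg B hn ⟨φ, hφ0, hφ1⟩)) hφ.le 2
    rw [penaltyTerm, mul_pow, mul_pow, Real.sq_sqrt (by positivity)] at hsq
    linarith
  rw [show ε + tauPenalty B n = ε' + κ by rw [hκdef]; ring]
  rcases exists_small_of_inverseGap_lt hε' hgap with ⟨x, hx⟩ | ⟨f, hf⟩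
  · obtain ⟨k, hk⟩ := exists_window_sum_lt (BiSeq.hasSum_norm_sq x) (BiSeq.hasSum_norm_sq (B x))
      hφ0 hφ1 (sum_sq_sub_tauWeight hn hφ0 hφ1) (sum_sq_tauWeight_pos hn hφ0 hφ1) hε' hκ hμ
      (by rw [← mul_pow]; exact pow_lt_pow_left₀ hx (norm_nonneg _) two_ne_zero)
    exact ⟨k, hB.inverseGap_finiteSection_lt_of_vector (fun _ => tauWeight_of_notMem) k
      (by positivity) hk⟩
  · -- Passing to the adjoint exchanges the two off-diagonals, hence `φ` and `1 - φ`.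
    obtain ⟨k, hk⟩ := exists_window_sum_lt (a := superdiagNorm B) (b := subdiagNorm B)
      (hasSum_norm_dualCoord_sq f) (hasSum_norm_dualCoord_sq (f.comp B)) hψ0 hψ1
      (sum_sq_sub_tauWeight hn hψ0 hψ1) (sum_sq_tauWeight_pos hn hψ0 hψ1) hε' hκ
      (by rwa [tauTheta_one_sub, sub_sub_cancel, add_comm])
      (by rw [← mul_pow]; exact pow_lt_pow_left₀ hf (norm_nonneg _) two_ne_zero)
    exact ⟨k, hB.inverseGap_finiteSection_lt_of_functional (fun _ => tauWeight_of_notMem) k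
      (by positivity) hk⟩

theorem IsTridiagonal.openPseudospectrum_subset_tauOpenSet [CompleteSpace X] [Nontrivial X]
    {A : BiSeq X →L[ℂ] BiSeq X} (hA : IsTridiagonal A) {n : ℕ} (hn : 1 ≤ n) {ε : ℝ} (hε : 0 < ε) :
    openPseudospectrum A ε ⊆ tauOpenSet A n (ε + tauPenalty A n) := by
  intro z hz
  have : NeZero n := ⟨Nat.one_le_iff_ne_zero.1 hn⟩
  obtain ⟨k, hk⟩ := (hA.sub_smul z).exists_inverseGap_finiteSection_lt hn
    ((mem_openPseudospectrum_iff hε).1 hz)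
  rw [finiteSection_sub_smul, tauPenalty_sub_smul] at hk
  exact Set.mem_iUnion.2 ⟨k,
    (mem_openPseudospectrum_iff (add_pos_of_pos_of_nonneg hε (tauPenalty_nonneg A hn))).2 hk⟩

end Truncation

/-! ### Coefficients of bounded resolvents -/

section CircleAverage

variable {F : Type*} [NormedAddCommGroup F] [NormedSpace ℂ F]

theorem circleAverage_inv_pow_smul [CompleteSpace F] {ρ : ℝ} (hρ : ρ ≠ 0) {m : ℕ} (hm : m ≠ 0)
    (a : F) : Real.circleAverage (fun z : ℂ => z⁻¹ ^ m • a) 0 ρ = 0 := by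
  have hzpow : ∀ z : ℂ, (z - 0)⁻¹ • z⁻¹ ^ m • a = (z - 0) ^ (-(m + 1 : ℤ)) • a := fun z => by
    rw [smul_smul, sub_zero, zpow_neg, ← pow_succ', inv_pow]
    norm_cast
  simp_rw [Real.circleAverage_eq_circleIntegral hρ, hzpow]
  rw [circleIntegral.integral_smul_const, circleIntegral.integral_sub_zpow_of_ne (by omega),
    zero_smul, smul_zero]

theorem norm_circleAverage_le (f : ℂ → F) (c : ℂ) (ρ : ℝ) :
    ‖Real.circleAverage f c ρ‖ ≤ Real.circleAverage (fun z => ‖f z‖) c ρ := by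
  rw [Real.circleAverage_def, Real.circleAverage_def, norm_smul, smul_eq_mul,
    Real.norm_of_nonneg (by positivity)]
  exact mul_le_mul_of_nonneg_left
    (intervalIntegral.norm_integral_le_integral_norm (by positivity)) (by positivity)

theorem circleAverage_eq_of_differentiableOn {ρ : ℝ} (hρ : 0 < ρ) {f : ℂ → F}
    [CompleteSpace F] (hf : DifferentiableOn ℂ f (Metric.closedBall 0 ρ)) :
    Real.circleAverage f 0 ρ = f 0 := by
  refine DiffContOnCl.circleAverage (DifferentiableOn.diffContOnCl ?_)
  rwa [abs_of_pos hρ, closure_ball _ hρ.ne']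

/-- The kernel `1 + Re (ζ ρᵐ z⁻ᵐ)`, non-negative on the circle `|z| = ρ` if `|ζ| ≤ 1`; integrating
against it singles out the Taylor coefficients of orders `0` and `m`. -/
def coefficientKernel (ζ : ℂ) (ρ : ℝ) (m : ℕ) (z : ℂ) : ℝ := 1 + (ζ * ρ ^ m * z⁻¹ ^ m).re

variable {ζ : ℂ} {ρ : ℝ} {m : ℕ}

theorem coefficientKernel_nonneg (hζ : ‖ζ‖ ≤ 1) {z : ℂ} (hz : ‖z‖ = ρ) :
    0 ≤ coefficientKernel ζ ρ m z := by
  have hnorm : ‖ζ * ρ ^ m * z⁻¹ ^ m‖ ≤ 1 := by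
    rw [mul_assoc, ← mul_pow, norm_mul, norm_pow, norm_mul, norm_inv, Complex.norm_real, ← hz,
      norm_norm]
    exact mul_le_one₀ hζ (by positivity) (pow_le_one₀ (by positivity) mul_inv_le_one)
  have := (abs_le.1 ((Complex.abs_re_le_norm _).trans hnorm)).1
  rw [coefficientKernel]
  linarith

theorem ofReal_coefficientKernel (hρ : 0 < ρ) {z : ℂ} (hz : ‖z‖ = ρ) :
    (coefficientKernel ζ ρ m z : ℂ) =
      1 + (ζ * ρ ^ m / 2 * z⁻¹ ^ m + starRingEnd ℂ ζ / (ρ ^ m * 2) * z ^ m) := by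
  have hρ' : (ρ : ℂ) ≠ 0 := Complex.ofReal_ne_zero.2 hρ.ne'
  have hconj : starRingEnd ℂ z⁻¹ = z / ρ ^ 2 := by
    rw [Complex.inv_def, Complex.normSq_eq_norm_sq, hz]
    simp [div_eq_mul_inv]
  have := pow_ne_zero m hρ'
  rw [coefficientKernel, Complex.ofReal_add, Complex.re_eq_add_conj]
  simp only [map_mul, map_pow, hconj, Complex.conj_ofReal, Complex.ofReal_one, div_pow,
    ← pow_mul, mul_comm 2 m]
  rw [pow_mul]
  field_simp

theorem continuousOn_inv_sphere (hρ : 0 < ρ) :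
    ContinuousOn (fun z : ℂ => z⁻¹) (Metric.sphere 0 |ρ|) :=
  continuousOn_inv₀.mono fun _ hz =>
    ne_zero_of_mem_sphere (abs_pos.2 hρ.ne').ne' ⟨_, hz⟩

theorem continuousOn_coefficientKernel (hρ : 0 < ρ) :
    ContinuousOn (coefficientKernel ζ ρ m) (Metric.sphere 0 |ρ|) :=
  continuousOn_const.add (Complex.continuous_re.comp_continuousOn
    (continuousOn_const.mul ((continuousOn_inv_sphere hρ).pow m)))

theorem circleAverage_coefficientKernel_smul [CompleteSpace F] (hρ : 0 < ρ) (hm : m ≠ 0)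
    {f : ℂ → F} (hf : DifferentiableOn ℂ f (Metric.closedBall 0 ρ)) :
    Real.circleAverage (fun z => (coefficientKernel ζ ρ m z : ℂ) • f z) 0 ρ =
      f 0 + (ζ * ρ ^ m / 2) • Real.circleAverage (fun z => z⁻¹ ^ m • f z) 0 ρ := by
  have hcont : ContinuousOn f (Metric.sphere 0 |ρ|) := by
    rw [abs_of_pos hρ]
    exact hf.continuousOn.mono Metric.sphere_subset_closedBall
  have hpow_zero : Real.circleAverage (fun z => z ^ m • f z) 0 ρ = 0 := by
    refine (circleAverage_eq_of_differentiableOn hρ ((differentiableOn_id.pow m).smul hf)).trans ?_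
    simp [zero_pow hm]
  have hneg : CircleIntegrable (fun z => (ζ * ρ ^ m / 2) • (z⁻¹ ^ m • f z)) 0 ρ :=
    ((((continuousOn_inv_sphere hρ).pow m).smul hcont).const_smul _).circleIntegrable'
  have hpos : CircleIntegrable
      (fun z : ℂ => (starRingEnd ℂ ζ / (ρ ^ m * 2)) • (z ^ m • f z)) 0 ρ :=
    (((continuousOn_id.pow m).smul hcont).const_smul _).circleIntegrable'
  have hexpand : Set.EqOn (fun z => (coefficientKernel ζ ρ m z : ℂ) • f z) (fun z => f z +
      ((ζ * ρ ^ m / 2) • (z⁻¹ ^ m • f z) + (starRingEnd ℂ ζ / (ρ ^ m * 2)) • (z ^ m • f z)))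
      (Metric.sphere 0 |ρ|) := fun z hz => by
    rw [mem_sphere_zero_iff_norm, abs_of_pos hρ] at hz
    simp only [ofReal_coefficientKernel hρ hz, add_smul, one_smul, smul_smul]
  rw [Real.circleAverage_congr_sphere hexpand,
    Real.circleAverage_fun_add (f₂ := fun z => _ + _) hcont.circleIntegrable' (hneg.add hpos),
    Real.circleAverage_fun_add hneg hpos, Real.circleAverage_fun_smul,
    Real.circleAverage_fun_smul, hpow_zero, smul_zero, add_zero,
    circleAverage_eq_of_differentiableOn hρ hf]

theorem circleAverage_coefficientKernel (hρ : 0 < ρ) (hm : m ≠ 0) :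
    Real.circleAverage (coefficientKernel ζ ρ m) 0 ρ = 1 := by
  have hone : Real.circleAverage (fun z => (coefficientKernel ζ ρ m z : ℂ) • (1 : ℂ)) 0 ρ = 1 := by
    rw [circleAverage_coefficientKernel_smul hρ hm (differentiableOn_const 1),
      circleAverage_inv_pow_smul hρ.ne' hm, smul_zero, add_zero]
  have hreal := Complex.ofRealCLM.circleAverage_comp_comm
    (continuousOn_coefficientKernel (ζ := ζ) (m := m) hρ).circleIntegrable'
  simp only [smul_eq_mul, mul_one] at hone
  exact Complex.ofReal_injective (hreal.symm.trans hone)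

theorem norm_add_smul_circleAverage_le [CompleteSpace F] (hρ : 0 < ρ) (hm : m ≠ 0) (hζ : ‖ζ‖ ≤ 1)
    {f : ℂ → F} (hf : DifferentiableOn ℂ f (Metric.closedBall 0 ρ)) {M : ℝ}
    (hM : ∀ z, ‖z‖ = ρ → ‖f z‖ ≤ M) :
    ‖f 0 + (ζ * ρ ^ m / 2) • Real.circleAverage (fun z => z⁻¹ ^ m • f z) 0 ρ‖ ≤ M := by
  have hcont : ContinuousOn f (Metric.sphere 0 |ρ|) := by
    rw [abs_of_pos hρ]
    exact hf.continuousOn.mono Metric.sphere_subset_closedBall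
  have hkernel := continuousOn_coefficientKernel (ζ := ζ) (m := m) hρ
  calc ‖f 0 + (ζ * ρ ^ m / 2) • Real.circleAverage (fun z => z⁻¹ ^ m • f z) 0 ρ‖
      = ‖Real.circleAverage (fun z => (coefficientKernel ζ ρ m z : ℂ) • f z) 0 ρ‖ := by
        rw [circleAverage_coefficientKernel_smul hρ hm hf]
    _ ≤ Real.circleAverage (fun z => ‖(coefficientKernel ζ ρ m z : ℂ) • f z‖) 0 ρ :=
        norm_circleAverage_le _ _ _
    _ ≤ Real.circleAverage (fun z => M • coefficientKernel ζ ρ m z) 0 ρ := by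
        refine Real.circleAverage_mono
          ((Complex.continuous_ofReal.comp_continuousOn hkernel).smul hcont).norm.circleIntegrable'
          (hkernel.const_smul M).circleIntegrable' fun z hz => ?_
        rw [mem_sphere_zero_iff_norm, abs_of_pos hρ] at hz
        rw [norm_smul, Complex.norm_of_nonneg (coefficientKernel_nonneg hζ hz), mul_comm]
        exact mul_le_mul_of_nonneg_right (hM z hz) (coefficientKernel_nonneg hζ hz)
    _ = M := by
        rw [Real.circleAverage_fun_smul, circleAverage_coefficientKernel hρ hm, smul_eq_mul,
          mul_one]

end CircleAverage

section Resolvent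

variable {V : Type*} [NormedAddCommGroup V] [NormedSpace ℂ V] {B : V →L[ℂ] V} {ρ : ℝ}

theorem differentiableOn_inverse_sub_smul [CompleteSpace V]
    (hB : ∀ z : ℂ, ‖z‖ ≤ ρ → IsUnit (B - z • ContinuousLinearMap.id ℂ V)) :
    DifferentiableOn ℂ (fun z : ℂ => Ring.inverse (B - z • ContinuousLinearMap.id ℂ V))
      (Metric.closedBall 0 ρ) := fun z hz => by
  have hinverse := differentiableAt_inverse (𝕜 := ℂ) (hB z (mem_closedBall_zero_iff.1 hz))
  have hshift : DifferentiableAt ℂ (fun z : ℂ => B - z • ContinuousLinearMap.id ℂ V) z := by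
    fun_prop
  exact (hinverse.comp z hshift).differentiableWithinAt

theorem inverse_sub_smul_eq (hB : IsUnit B) {z : ℂ}
    (hz : IsUnit (B - z • ContinuousLinearMap.id ℂ V)) :
    Ring.inverse (B - z • ContinuousLinearMap.id ℂ V) = Ring.inverse B +
      z • (Ring.inverse B * Ring.inverse (B - z • ContinuousLinearMap.id ℂ V)) := by
  ext x
  set y := Ring.inverse (B - z • ContinuousLinearMap.id ℂ V) x
  have hy : B y - z • y = x := apply_inverse_apply hz x
  change y = Ring.inverse B x + z • Ring.inverse B y
  rw [← hy, map_sub, map_smul, inverse_apply_apply hB, sub_add_cancel]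

theorem circleAverage_inv_pow_smul_inverse_sub_smul [CompleteSpace V] (hρ : 0 < ρ)
    (hB : ∀ z : ℂ, ‖z‖ ≤ ρ → IsUnit (B - z • ContinuousLinearMap.id ℂ V)) (m : ℕ) :
    Real.circleAverage
      (fun z => z⁻¹ ^ m • Ring.inverse (B - z • ContinuousLinearMap.id ℂ V)) 0 ρ =
      Ring.inverse B ^ (m + 1) := by
  have hdiff := differentiableOn_inverse_sub_smul hB
  induction m with
  | zero => simpa using circleAverage_eq_of_differentiableOn hρ hdiff
  | succ m ih =>
    have hBunit : IsUnit B := by simpa using hB 0 (by simpa using hρ.le)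
    have hinv := continuousOn_inv_sphere hρ
    have hcont : ContinuousOn
        (fun z : ℂ => z⁻¹ ^ m • Ring.inverse (B - z • ContinuousLinearMap.id ℂ V))
        (Metric.sphere 0 |ρ|) := by
      refine ContinuousOn.smul (hinv.pow m) (hdiff.continuousOn.mono ?_)
      rw [abs_of_pos hρ]
      exact Metric.sphere_subset_closedBall
    set L : (V →L[ℂ] V) →L[ℝ] (V →L[ℂ] V) :=
      (ContinuousLinearMap.mul ℂ (V →L[ℂ] V) (Ring.inverse B)).restrictScalars ℝ
    have hrec : Set.EqOn
        (fun z : ℂ => z⁻¹ ^ (m + 1) • Ring.inverse (B - z • ContinuousLinearMap.id ℂ V))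
        (fun z : ℂ => z⁻¹ ^ (m + 1) • Ring.inverse B +
          L (z⁻¹ ^ m • Ring.inverse (B - z • ContinuousLinearMap.id ℂ V)))
        (Metric.sphere 0 |ρ|) := fun z hz => by
      have hz0 : z ≠ 0 := ne_zero_of_mem_sphere (abs_pos.2 hρ.ne').ne' ⟨z, hz⟩
      rw [mem_sphere_zero_iff_norm, abs_of_pos hρ] at hz
      change _ = _ + Ring.inverse B * (_ • _)
      dsimp only
      conv_lhs => rw [inverse_sub_smul_eq hBunit (hB z hz.le)]
      rw [smul_add, smul_smul, pow_succ, mul_assoc, inv_mul_cancel₀ hz0, mul_one, mul_smul_comm]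
    have hconst : CircleIntegrable (fun z : ℂ => z⁻¹ ^ (m + 1) • Ring.inverse B) 0 ρ :=
      ((hinv.pow _).smul continuousOn_const).circleIntegrable'
    have hL : CircleIntegrable
        (fun z : ℂ => L (z⁻¹ ^ m • Ring.inverse (B - z • ContinuousLinearMap.id ℂ V))) 0 ρ :=
      (L.continuous.comp_continuousOn hcont).circleIntegrable'
    rw [Real.circleAverage_congr_sphere hrec, Real.circleAverage_fun_add hconst hL,
      circleAverage_inv_pow_smul hρ.ne' m.succ_ne_zero, zero_add]
    refine (L.circleAverage_comp_comm hcont.circleIntegrable').trans ?_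
    rw [ih]
    exact (pow_succ' (Ring.inverse B) (m + 1)).symm

theorem norm_inverse_add_smul_pow_le [CompleteSpace V] [Nontrivial V] {s : ℝ} (hs : 0 < s)
    (hρ : 0 < ρ) (hB : ∀ z : ℂ, ‖z‖ ≤ ρ → s ≤ inverseGap (B - z • ContinuousLinearMap.id ℂ V))
    {m : ℕ} (hm : m ≠ 0) {ζ : ℂ} (hζ : ‖ζ‖ ≤ 1) :
    ‖Ring.inverse B + ζ • ((ρ ^ m / 2 : ℝ) : ℂ) • Ring.inverse B ^ (m + 1)‖ ≤ s⁻¹ := by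
  have hinverse := fun z hz => norm_inverse_le_of_le_inverseGap hs (hB z hz)
  have h := norm_add_smul_circleAverage_le hρ hm hζ
    (differentiableOn_inverse_sub_smul fun z hz => (hinverse z hz).1)
    fun z hz => (hinverse z hz.le).2
  rw [circleAverage_inv_pow_smul_inverse_sub_smul hρ fun z hz => (hinverse z hz).1] at h
  simpa [smul_smul, mul_div_assoc] using h

end Resolvent

/-! ### The uniform maximum principle -/

section MaximumPrinciple

variable {V : Type*} [NormedAddCommGroup V] [NormedSpace ℂ V]

/-- A family of operators satisfies the uniform maximum principle if a lower bound `s` of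
`1 / ‖(B - z)⁻¹‖` in a disc around `0` can be improved at the centre by an amount that depends
only on `s`, the radius, and a bound of `‖B‖`. -/
def UniformMaximumPrinciple (𝓑 : Set (V →L[ℂ] V)) : Prop :=
  ∀ C r s : ℝ, 0 < r → 0 < s → ∃ δ > 0, ∀ B ∈ 𝓑, ‖B‖ ≤ C →
    (∀ z : ℂ, ‖z‖ < r → s ≤ inverseGap (B - z • ContinuousLinearMap.id ℂ V)) →
      s + δ ≤ inverseGap B

theorem ComplexUniformlyConvex.exists_norm_le_mul_of_mul_norm_le {Y : Type*} [NormedAddCommGroup Y]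
    [NormedSpace ℂ Y] (hY : ComplexUniformlyConvex Y) {c : ℝ} (hc : 0 < c) :
    ∃ κ : ℝ, 0 < κ ∧ κ < 1 ∧ ∀ (x y : Y) (M : ℝ), 0 < M → c * ‖x‖ ≤ ‖y‖ →
      (∀ ζ : ℂ, ‖ζ‖ ≤ 1 → ‖x + ζ • y‖ ≤ M) → ‖x‖ ≤ κ * M := by
  obtain ⟨δ, hδ, hconv⟩ := hY.exists_norm_le_mul (half_pos hc)
  refine ⟨max (1 - δ) (1 / 2), by positivity, by simp [hδ]; norm_num, fun x y M hM hxy hdisc => ?_⟩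
  rcases le_or_gt (c / 2 * M) ‖y‖ with hy | hy
  · exact (hconv x y M hM hy hdisc).trans (by gcongr; exact le_max_left _ _)
  · refine le_trans ?_ (mul_le_mul_of_nonneg_right (le_max_right _ _) hM.le)
    nlinarith

variable [CompleteSpace V] [Nontrivial V]

/-- The functional `Φ` norms `B⁻¹`, and the disc `Φ B⁻¹ + ζ ρ Φ B⁻² / 2`, `|ζ| ≤ 1`, in `Y` has
norm at most `s⁻¹`; it is not too small because `B⁻¹ = B B⁻²`. -/
theorem ComplexUniformlyConvex.uniformMaximumPrinciple_of_norming {Y : Type*}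
    [NormedAddCommGroup Y] [NormedSpace ℂ Y] (hY : ComplexUniformlyConvex Y)
    (hnorming : ∀ (R : V →L[ℂ] V) (x : V), ‖x‖ = 1 → ∃ Φ : (V →L[ℂ] V) →L[ℂ] Y, ‖Φ‖ ≤ 1 ∧
      ‖R x‖ ≤ ‖Φ R‖ ∧ ∀ B S : V →L[ℂ] V, Commute B S → ‖Φ (B * S)‖ ≤ ‖B‖ * ‖Φ S‖)
    (𝓑 : Set (V →L[ℂ] V)) : UniformMaximumPrinciple 𝓑 := by
  intro C r s hr hs
  obtain ⟨κ, hκ, hκ1, hconv⟩ := hY.exists_norm_le_mul_of_mul_norm_le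
    (show 0 < r / 4 / max C 1 by positivity)
  refine ⟨s * (κ⁻¹ - 1), mul_pos hs (sub_pos.2 ((one_lt_inv₀ hκ).2 hκ1)), fun B _ hC hB => ?_⟩
  have hunit : IsUnit B :=
    isUnit_of_inverseGap_pos (hs.trans_le (by simpa using hB 0 (by simpa using hr)))
  suffices hR : ‖Ring.inverse B‖ ≤ κ * s⁻¹ by
    rw [mul_sub, mul_one, add_sub_cancel, inverseGap_of_isUnit hunit,
      le_inv_comm₀ (by positivity) (norm_inverse_pos hunit), mul_inv, inv_inv, mul_comm]
    exact hR
  refine ContinuousLinearMap.opNorm_le_of_unit_norm (by positivity) fun x hx => ?_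
  obtain ⟨Φ, hΦ, hΦx, hΦmul⟩ := hnorming (Ring.inverse B) x hx
  refine hΦx.trans (hconv _ (((r / 4 : ℝ) : ℂ) • Φ (Ring.inverse B ^ 2)) _ (by positivity) ?_
    fun ζ hζ => ?_)
  · have hsq : B * Ring.inverse B ^ 2 = Ring.inverse B := by
      rw [pow_two, Ring.mul_inverse_cancel_left _ _ hunit]
    have hcomm : Commute B (Ring.inverse B ^ 2) := by
      rw [Commute, SemiconjBy, hsq, pow_two, Ring.inverse_mul_cancel_right _ _ hunit]
    have hle := hΦmul B _ hcomm
    rw [hsq] at hle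
    rw [norm_smul, Complex.norm_of_nonneg (by positivity), div_mul_eq_mul_div,
      div_le_iff₀ (by positivity), mul_assoc, mul_comm ‖Φ _‖]
    gcongr
    exact hle.trans (by gcongr; exact hC.trans (le_max_left _ _))
  · have hdisc := norm_inverse_add_smul_pow_le hs (half_pos hr)
      (fun z hz => hB z (hz.trans_lt (half_lt_self hr))) one_ne_zero hζ
    rw [pow_one, div_div, show (2 * 2 : ℝ) = 4 by norm_num] at hdisc
    rw [← map_smul, ← map_smul, ← map_add]
    exact (Φ.le_of_opNorm_le_of_le hΦ hdisc).trans_eq (one_mul _)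

theorem ComplexUniformlyConvex.uniformMaximumPrinciple (hV : ComplexUniformlyConvex V)
    (𝓑 : Set (V →L[ℂ] V)) : UniformMaximumPrinciple 𝓑 := by
  refine hV.uniformMaximumPrinciple_of_norming (fun R x hx => ?_) 𝓑
  refine ⟨ContinuousLinearMap.apply ℂ V x, ?_, le_rfl, fun B S _ => B.le_opNorm (S x)⟩
  exact ContinuousLinearMap.opNorm_le_bound _ zero_le_one fun T => by
    simpa [hx] using T.le_opNorm x

theorem ComplexUniformlyConvex.uniformMaximumPrinciple_of_dual
    (hV : ComplexUniformlyConvex (V →L[ℂ] ℂ)) (𝓑 : Set (V →L[ℂ] V)) :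
    UniformMaximumPrinciple 𝓑 := by
  refine hV.uniformMaximumPrinciple_of_norming (fun R x hx => ?_) 𝓑
  obtain ⟨g, hg, hgR⟩ := exists_dual_vector'' ℂ (R x)
  refine ⟨ContinuousLinearMap.compL ℂ V V ℂ g, ?_, ?_, fun B S hBS => ?_⟩
  · exact ContinuousLinearMap.opNorm_le_bound _ zero_le_one fun T =>
      (g.opNorm_comp_le T).trans (by gcongr)
  · have hle := (g.comp R).le_opNorm x
    rw [ContinuousLinearMap.comp_apply, hgR, hx, mul_one] at hle
    simpa using hle
  · rw [hBS.eq, mul_comm]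
    exact (g.comp S).opNorm_comp_le B

end MaximumPrinciple

/-! ### Backward orbits of tridiagonal maps -/

section BackwardOrbit

variable {K X : Type*} [Field K] [AddCommGroup X] [Module K X]

/-- The tridiagonal linear map on all of `ℤ → X` with entries `a i j`, `|i - j| ≤ 1`. -/
def tridiagonalMap (a : ℤ → ℤ → X →ₗ[K] X) : (ℤ → X) →ₗ[K] (ℤ → X) :=
  LinearMap.pi fun i => a i (i - 1) ∘ₗ LinearMap.proj (i - 1) + a i i ∘ₗ LinearMap.proj i
    + a i (i + 1) ∘ₗ LinearMap.proj (i + 1)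

theorem tridiagonalMap_apply (a : ℤ → ℤ → X →ₗ[K] X) (w : ℤ → X) (i : ℤ) :
    tridiagonalMap a w i = a i (i - 1) (w (i - 1)) + a i i (w i) + a i (i + 1) (w (i + 1)) := rfl

theorem tridiagonalMap_apply_eq_zero (a : ℤ → ℤ → X →ₗ[K] X) {w : ℤ → X} {i : ℤ}
    (h : ∀ l, |l - i| ≤ 1 → w l = 0) : tridiagonalMap a w i = 0 := by
  rw [tridiagonalMap_apply, h (i - 1) (by simp), h i (by simp), h (i + 1) (by simp)]
  simp only [map_zero, add_zero]

theorem tridiagonalMap_pow_apply_eq_zero (a : ℤ → ℤ → X →ₗ[K] X) {j : ℤ} (M : ℕ) {w : ℤ → X}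
    (h : ∀ i, |i - j| ≤ M → w i = 0) : (tridiagonalMap a ^ M) w j = 0 := by
  induction M generalizing w with
  | zero => exact h j (by simp)
  | succ M ih =>
    rw [pow_succ, Module.End.mul_apply]
    refine ih fun i hi => tridiagonalMap_apply_eq_zero a fun l hl => h l ?_
    push_cast
    rw [abs_le] at *
    omega

/-- The span of the members of index at least `M` of a sequence. -/
def tailSpan (K : Type*) {W : Type*} [Field K] [AddCommGroup W] [Module K W] (e : ℕ → W) (M : ℕ) :
    Submodule K W :=
  Submodule.span K (e '' Set.Ici M)

section TailSpan

variable {W : Type*} [AddCommGroup W] [Module K W] {e : ℕ → W}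

theorem mem_tailSpan {M m : ℕ} (h : M ≤ m) : e m ∈ tailSpan K e M :=
  Submodule.subset_span ⟨m, h, rfl⟩

theorem tailSpan_le {M : ℕ} {S : Submodule K W} : tailSpan K e M ≤ S ↔ ∀ m, M ≤ m → e m ∈ S := by
  rw [tailSpan, Submodule.span_le, Set.image_subset_iff]
  rfl

theorem tailSpan_succ_le (e : ℕ → W) (M : ℕ) : tailSpan K e (M + 1) ≤ tailSpan K e M :=
  tailSpan_le.2 fun _ hm => mem_tailSpan (M.le_succ.trans hm)

variable {T : W →ₗ[K] W} (he : ∀ m, T (e (m + 1)) = e m)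
include he

theorem pow_apply_backwardOrbit (M l : ℕ) : (T ^ M) (e (M + l)) = e l := by
  induction M with
  | zero => simp
  | succ M ih => rw [pow_succ, Module.End.mul_apply, Nat.add_right_comm, he, ih]

theorem apply_mem_tailSpan {M : ℕ} {w : W} (hw : w ∈ tailSpan K e (M + 1)) :
    T w ∈ tailSpan K e M := by
  suffices h : tailSpan K e (M + 1) ≤ (tailSpan K e M).comap T from h hw
  refine tailSpan_le.2 fun m hm => ?_
  obtain ⟨l, rfl⟩ := Nat.exists_eq_add_of_le' (Nat.le_of_add_left_le hm)
  rw [Submodule.mem_comap, he]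
  exact mem_tailSpan (Nat.le_of_add_le_add_right hm)

end TailSpan

variable {a : ℤ → ℤ → X →ₗ[K] X} {e : ℕ → ℤ → X}

theorem tridiagonalMap_pow_apply_eq_zero_of_vanish
    (he : ∀ m, tridiagonalMap a (e (m + 1)) = e m) {b c j : ℤ} (hj : j ∈ Finset.Ioo b c)
    (heb : ∀ m, e m b = 0) (hec : ∀ m, e m c = 0) {M : ℕ} {w : ℤ → X} (hw : w ∈ tailSpan K e M)
    (h : ∀ i ∈ Finset.Ioo b c, w i = 0) : (tridiagonalMap a ^ M) w j = 0 := by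
  have hzero : ∀ {i : ℤ}, (∀ m, e m i = 0) → ∀ {M : ℕ} {w : ℤ → X}, w ∈ tailSpan K e M → w i = 0 :=
    fun {i} hei _ _ hw =>
      (tailSpan_le (S := LinearMap.ker (LinearMap.proj i : (ℤ → X) →ₗ[K] X))).2
        (fun m _ => hei m) hw
  induction M generalizing w with
  | zero => exact h j hj
  | succ M ih =>
    rw [pow_succ, Module.End.mul_apply]
    refine ih (apply_mem_tailSpan he hw) fun i hi => tridiagonalMap_apply_eq_zero a fun l hl => ?_
    rw [Finset.mem_Ioo] at hi
    rw [abs_le] at hl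
    rcases eq_or_lt_of_le (show b ≤ l by omega) with rfl | hbl
    · exact hzero heb hw
    rcases eq_or_lt_of_le (show l ≤ c by omega) with rfl | hlc
    · exact hzero hec hw
    exact h l (Finset.mem_Ioo.2 ⟨hbl, hlc⟩)

/-- The dimension of the space of restrictions to `I` of the sequences in `S`. -/
def windowRank (S : Submodule K (ℤ → X)) (I : Finset ℤ) : ℕ :=
  Module.finrank K (S.map (LinearMap.funLeft K X ((↑) : I → ℤ)))

variable [FiniteDimensional K X]

theorem windowRank_le (S : Submodule K (ℤ → X)) (I : Finset ℤ) :
    windowRank S I ≤ I.card * Module.finrank K X := by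
  refine (Submodule.finrank_le _).trans_eq ?_
  rw [Module.finrank_pi_fintype, Finset.sum_const, Finset.card_univ, Fintype.card_coe, smul_eq_mul]

theorem windowRank_union_le (S : Submodule K (ℤ → X)) (I J : Finset ℤ) :
    windowRank S (I ∪ J) ≤ windowRank S I + windowRank S J := by
  set restrictI := LinearMap.funLeft K X ((↑) : I → ℤ)
  set restrictJ := LinearMap.funLeft K X ((↑) : J → ℤ)
  set split : (↥(I ∪ J) → X) →ₗ[K] (I → X) × (J → X) :=
    (LinearMap.funLeft K X (Set.inclusion Finset.subset_union_left)).prod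
      (LinearMap.funLeft K X (Set.inclusion Finset.subset_union_right))
  have hsplit : Function.Injective split := fun v w hvw => by
    ext ⟨i, hi⟩
    rcases Finset.mem_union.1 hi with hI | hJ
    · exact congrFun (congrArg Prod.fst hvw) ⟨i, hI⟩
    · exact congrFun (congrArg Prod.snd hvw) ⟨i, hJ⟩
  have hmap : (S.map (LinearMap.funLeft K X ((↑) : ↥(I ∪ J) → ℤ))).map split ≤
      (S.map restrictI).prod (S.map restrictJ) := by
    rintro _ ⟨_, ⟨w, hw, rfl⟩, rfl⟩
    exact ⟨⟨w, hw, rfl⟩, w, hw, rfl⟩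
  calc windowRank S (I ∪ J)
      = Module.finrank K ((S.map (LinearMap.funLeft K X ((↑) : ↥(I ∪ J) → ℤ))).map split) :=
        (LinearEquiv.finrank_eq (Submodule.equivMapOfInjective split hsplit _))
    _ ≤ Module.finrank K ((S.map restrictI).prod (S.map restrictJ)) := Submodule.finrank_mono hmap
    _ ≤ Module.finrank K ((S.map restrictI).map (LinearMap.inl K (I → X) (J → X))) +
        Module.finrank K ((S.map restrictJ).map (LinearMap.inr K (I → X) (J → X))) := by
      rw [LinearMap.prod_eq_sup_map]
      exact Submodule.finrank_add_le_finrank_add_finrank _ _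
    _ ≤ windowRank S I + windowRank S J :=
      add_le_add (Submodule.finrank_map_le _ _) (Submodule.finrank_map_le _ _)

/-- If the window determines the `j`-th entry `M` steps later, then `e M` is not, over the window,
a combination of later members, since `φ` annihilates the latter but not the former. -/
theorem windowRank_tailSpan_succ_lt (he : ∀ m, tridiagonalMap a (e (m + 1)) = e m)
    {I : Finset ℤ} {M : ℕ} {j : ℤ} {φ : X →ₗ[K] K} (h0 : φ (e 0 j) ≠ 0)
    (hφ : ∀ m, 1 ≤ m → φ (e m j) = 0)
    (hlocal : ∀ w ∈ tailSpan K e M, (∀ i ∈ I, w i = 0) → (tridiagonalMap a ^ M) w j = 0) :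
    windowRank (tailSpan K e (M + 1)) I < windowRank (tailSpan K e M) I := by
  refine Submodule.finrank_lt_finrank_of_lt
    (lt_of_le_of_ne (Submodule.map_mono (tailSpan_succ_le e M)) fun heq => ?_)
  obtain ⟨v, hv, hvM⟩ :=
    heq.ge (Submodule.mem_map_of_mem (mem_tailSpan (K := K) (e := e) (le_refl M)))
  have hannihilate : φ ((tridiagonalMap a ^ M) v j) = 0 := by
    suffices h : tailSpan K e (M + 1) ≤
        LinearMap.ker (φ ∘ₗ LinearMap.proj j ∘ₗ (tridiagonalMap a ^ M)) from h hv
    refine tailSpan_le.2 fun m hm => ?_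
    obtain ⟨l, rfl⟩ := Nat.exists_eq_add_of_le hm
    change φ ((tridiagonalMap a ^ M) (e (M + 1 + l)) j) = 0
    rw [add_assoc, pow_apply_backwardOrbit he]
    exact hφ _ (Nat.le_add_right 1 l)
  have hdiff := hlocal (e M - v)
    (Submodule.sub_mem _ (mem_tailSpan le_rfl) (tailSpan_succ_le e M hv))
    fun i hi => sub_eq_zero.2 (congrFun hvM ⟨i, hi⟩).symm
  rw [map_sub, Pi.sub_apply, sub_eq_zero, show (tridiagonalMap a ^ M) (e M) = e 0 from
    pow_apply_backwardOrbit he M 0] at hdiff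
  exact h0 (hdiff ▸ hannihilate)

theorem add_le_of_forall_succ_lt {f : ℕ → ℕ} {m l : ℕ} (h : ∀ i < l, f (m + i + 1) < f (m + i)) :
    f (m + l) + l ≤ f m := by
  induction l with
  | zero => exact le_rfl
  | succ l ih =>
    have := ih fun i hi => h i (hi.trans l.lt_succ_self)
    have := h l l.lt_succ_self
    rw [← add_assoc m]
    omega

theorem false_of_backwardOrbit_of_vanish (he : ∀ m, tridiagonalMap a (e (m + 1)) = e m)
    {b c j : ℤ} (hj : j ∈ Finset.Ioo b c) (heb : ∀ m, e m b = 0) (hec : ∀ m, e m c = 0)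
    {φ : X →ₗ[K] K} (h0 : φ (e 0 j) ≠ 0) (hφ : ∀ m, 1 ≤ m → φ (e m j) = 0) : False := by
  set rank : ℕ → ℕ := fun M => windowRank (tailSpan K e M) (Finset.Ioo b c)
  have hdrop : ∀ M, rank (M + 1) < rank M := fun M =>
    windowRank_tailSpan_succ_lt he h0 hφ fun w hw =>
      tridiagonalMap_pow_apply_eq_zero_of_vanish he hj heb hec hw
  have := add_le_of_forall_succ_lt (f := rank) (m := 0) (l := rank 0 + 1) fun i _ => hdrop _
  omega

/-- A window of length `2 ^ (k + 2)` consists of two of half the length, and its rank drops at each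
step from `2 ^ k` to `2 ^ (k + 1)` because the midpoint has not yet felt the ends. -/
theorem windowRank_backwardOrbit_dyadic (he : ∀ m, tridiagonalMap a (e (m + 1)) = e m)
    {φ : ℤ → X →ₗ[K] K} (h0 : ∀ j, 0 ≤ j → φ j (e 0 j) ≠ 0)
    (hφ : ∀ m, 1 ≤ m → ∀ j, 0 ≤ j → φ j (e m j) = 0) (k : ℕ) {b : ℤ} (hb : 0 ≤ b) :
    4 * windowRank (tailSpan K e (2 ^ k)) (Finset.Ico b (b + 2 ^ (k + 1))) + k * 2 ^ (k + 1) ≤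
      4 * (2 ^ (k + 1) * Module.finrank K X) := by
  induction k generalizing b with
  | zero =>
    have := windowRank_le (tailSpan K e (2 ^ 0)) (Finset.Ico b (b + 2 ^ (0 + 1)))
    rw [Int.card_Ico] at this
    simp only [zero_add, pow_one, add_sub_cancel_left] at this
    simpa using this
  | succ k ih =>
    set c : ℤ := b + 2 ^ (k + 1) with hc
    have hpos : (0 : ℤ) < 2 ^ (k + 1) := by positivity
    set I := Finset.Ico b (b + 2 ^ (k + 1 + 1)) with hI
    set rank : ℕ → ℕ := fun M => windowRank (tailSpan K e M) I
    have hdouble : (2 : ℤ) ^ (k + 1 + 1) = 2 ^ (k + 1) + 2 ^ (k + 1) := by ring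
    have hunion : Finset.Ico b (b + 2 ^ (k + 1)) ∪ Finset.Ico c (c + 2 ^ (k + 1)) = I := by
      rw [Finset.Ico_union_Ico_eq_Ico (by omega) (by omega), hI, hdouble, hc, add_assoc]
    have hhalves : rank (2 ^ k) ≤ _ := hunion ▸ windowRank_union_le (tailSpan K e (2 ^ k)) _ _
    have hstep : ∀ i < 2 ^ k, rank (2 ^ k + i + 1) < rank (2 ^ k + i) := fun i hi => by
      refine windowRank_tailSpan_succ_lt he (h0 c (by omega)) (fun m hm => hφ m hm c (by omega))
        fun w _ hw => tridiagonalMap_pow_apply_eq_zero a _ fun l hl => hw l ?_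
      have : ((2 ^ k + i : ℕ) : ℤ) < 2 ^ (k + 1) := by exact_mod_cast (by omega)
      rw [abs_le] at hl
      rw [hI, Finset.mem_Ico]
      omega
    have hdrop : rank (2 ^ k + 2 ^ k) + 2 ^ k ≤ rank (2 ^ k) := add_le_of_forall_succ_lt hstep
    have hleft := ih hb
    have hright := ih (b := c) (by omega)
    change 4 * rank (2 ^ (k + 1)) + _ ≤ _
    rw [← two_mul, ← pow_succ'] at hdrop
    rw [show (k + 1) * 2 ^ (k + 1 + 1) = k * 2 ^ (k + 1) + k * 2 ^ (k + 1) + 4 * 2 ^ k by ring,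
      pow_succ 2 (k + 1), mul_right_comm]
    omega

theorem false_of_backwardOrbit_of_nonneg (he : ∀ m, tridiagonalMap a (e (m + 1)) = e m)
    {φ : ℤ → X →ₗ[K] K} (h0 : ∀ j, 0 ≤ j → φ j (e 0 j) ≠ 0)
    (hφ : ∀ m, 1 ≤ m → ∀ j, 0 ≤ j → φ j (e m j) = 0) : False := by
  have hrank := windowRank_backwardOrbit_dyadic he h0 hφ (4 * Module.finrank K X + 1) le_rfl
  have hpos : 0 < 2 ^ (4 * Module.finrank K X + 1 + 1) := by positivity
  nlinarith

/-- Either `e 0` is nonzero on a half-line, or it vanishes at points on both sides of `0`. -/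
theorem false_of_backwardOrbit (he : ∀ m, tridiagonalMap a (e (m + 1)) = e m)
    {φ : ℤ → X →ₗ[K] K} (h0 : e 0 0 ≠ 0) (hφ0 : ∀ j, e 0 j ≠ 0 → φ j (e 0 j) ≠ 0)
    (hφ : ∀ m, 1 ≤ m → ∀ j, φ j (e m j) = 0) (hvanish : ∀ j, e 0 j = 0 → ∀ m, e m j = 0) :
    False := by
  by_cases hright : ∀ j, 0 ≤ j → e 0 j ≠ 0
  · exact false_of_backwardOrbit_of_nonneg he (fun j hj => hφ0 j (hright j hj))
      fun m hm j _ => hφ m hm j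
  by_cases hleft : ∀ j, j ≤ 0 → e 0 j ≠ 0
  · refine false_of_backwardOrbit_of_nonneg (a := fun i j => a (-i) (-j))
      (e := fun m i => e m (-i)) (φ := fun j => φ (-j)) (fun m => ?_)
      (fun j hj => hφ0 (-j) (hleft (-j) (by omega))) fun m hm j _ => hφ m hm (-j)
    ext i
    rw [tridiagonalMap_apply, ← he m, tridiagonalMap_apply, show -(i - 1) = -i + 1 by ring,
      show -(i + 1) = -i - 1 by ring]
    abel
  push Not at hright hleft
  obtain ⟨c, hc, hc0⟩ := hright
  obtain ⟨b, hb, hb0⟩ := hleft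
  have hb' : b ≠ 0 := by rintro rfl; exact h0 hb0
  have hc' : c ≠ 0 := by rintro rfl; exact h0 hc0
  exact false_of_backwardOrbit_of_vanish he
    (Finset.mem_Ioo.2 ⟨lt_of_le_of_ne hb hb', lt_of_le_of_ne hc hc'.symm⟩)
    (hvanish b hb0) (hvanish c hc0) (hφ0 0 h0) fun m hm => hφ m hm 0

end BackwardOrbit

/-! ### The uniform maximum principle on finite-dimensional coefficients -/

section Localization

open scoped NNReal

theorem exists_le_mul_of_tsum_lt {ι : Type*} [AddGroup ι] {p f g : ι → ℝ≥0∞} {K : ℝ≥0∞}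
    (h : (∑' i, p i) * ∑' i, g i < K * ∑' i, f i) :
    ∃ j, f j ≠ 0 ∧ ∀ i, p i * g (j + i) ≤ K * f j := by
  by_contra! hcon
  refine h.not_ge ?_
  have hle : ∀ j, K * f j ≤ ∑' i, p i * g (j + i) := fun j => by
    by_cases hj : f j = 0
    · rw [hj, mul_zero]
      exact zero_le
    · obtain ⟨i, hi⟩ := hcon j hj
      exact hi.le.trans (ENNReal.le_tsum i)
  calc K * ∑' j, f j = ∑' j, K * f j := ENNReal.tsum_mul_left.symm
    _ ≤ ∑' j, ∑' i, p i * g (j + i) := ENNReal.tsum_le_tsum hle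
    _ = ∑' i, ∑' j, p i * g (j + i) := ENNReal.tsum_comm
    _ = ∑' i, p i * ∑' j, g j := tsum_congr fun i =>
      ENNReal.tsum_mul_left.trans (congrArg _ ((Equiv.addRight i).tsum_eq g))
    _ = _ := ENNReal.tsum_mul_right

theorem exists_le_mul_of_hasSum_lt {ι : Type*} [AddGroup ι] {p : ι → ℝ≥0}
    (hp : ∑' i, (p i : ℝ≥0∞) ≤ 1) {f g : ι → ℝ} (hf : ∀ j, 0 ≤ f j) (hg : ∀ j, 0 ≤ g j)
    {U W K : ℝ} (hfU : HasSum f U) (hgW : HasSum g W) (hK : 0 ≤ K) (h : W < K * U) :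
    ∃ j, 0 < f j ∧ ∀ i, p i * g (j + i) ≤ K * f j := by
  have hlt : (∑' i, (p i : ℝ≥0∞)) * ∑' j, ENNReal.ofReal (g j) <
      ENNReal.ofReal K * ∑' j, ENNReal.ofReal (f j) := by
    rw [← ENNReal.ofReal_tsum_of_nonneg hf hfU.summable,
      ← ENNReal.ofReal_tsum_of_nonneg hg hgW.summable, hfU.tsum_eq, hgW.tsum_eq,
      ← ENNReal.ofReal_mul hK]
    exact (mul_le_of_le_one_left zero_le hp).trans_lt
      ((ENNReal.ofReal_lt_ofReal_iff ((hgW.nonneg hg).trans_lt h)).2 h)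
  obtain ⟨j, hj, hji⟩ := exists_le_mul_of_tsum_lt hlt
  refine ⟨j, by simpa using hj, fun i => ?_⟩
  have hle := hji i
  rwa [← ENNReal.ofReal_coe_nnreal, ← ENNReal.ofReal_mul (p i).coe_nonneg,
    ← ENNReal.ofReal_mul hK, ENNReal.ofReal_le_ofReal_iff (mul_nonneg hK (hf j))] at hle

variable {X : Type*} [NormedAddCommGroup X] [NormedSpace ℂ X]

section ConvexDefect

/-- The defect in the convexity of the squared norm, along `y`, at the midpoint `x`. -/
def convexDefect {Y : Type*} [NormedAddCommGroup Y] (x y : Y) : ℝ :=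
  ‖x + y‖ ^ 2 + ‖x - y‖ ^ 2 - 2 * ‖x‖ ^ 2

theorem convexDefect_nonneg (x y : X) : 0 ≤ convexDefect x y :=
  sub_nonneg.2 (two_mul_norm_sq_le x y)

theorem convexDefect_smul (c : ℂ) (x y : X) :
    convexDefect (c • x) (c • y) = ‖c‖ ^ 2 * convexDefect x y := by
  simp only [convexDefect, ← smul_add, ← smul_sub, norm_smul, mul_pow]
  ring

theorem BiSeq.hasSum_convexDefect {Y : Type*} [NormedAddCommGroup Y] (x y : BiSeq Y) :
    HasSum (fun j => convexDefect (x j) (y j)) (convexDefect x y) :=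
  (((x + y).hasSum_norm_sq).add ((x - y).hasSum_norm_sq)).sub (x.hasSum_norm_sq.mul_left 2)

theorem two_mul_norm_sq_le_convexDefect (x y : X) :
    2 * ‖y‖ ^ 2 ≤ convexDefect x y + 2 * ‖x‖ ^ 2 := by
  have h := two_mul_norm_sq_le y x
  rw [add_comm y x, norm_sub_rev] at h
  unfold convexDefect
  linarith

theorem continuous_convexDefect {Y : Type*} [NormedAddCommGroup Y] :
    Continuous fun v : Y × Y => convexDefect v.1 v.2 := by
  unfold convexDefect
  fun_prop

theorem apply_eq_zero_of_convexDefect_le {x y : X} (h : convexDefect x y ≤ 0) {φ : X →L[ℂ] ℂ}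
    (hφ : ‖φ‖ ≤ 1) (hx : φ x = ‖x‖) : φ y = 0 := by
  have hle : ∀ v, ‖φ v‖ ^ 2 ≤ ‖v‖ ^ 2 := fun v =>
    pow_le_pow_left₀ (norm_nonneg _) ((φ.le_of_opNorm_le hφ v).trans_eq (one_mul _)) 2
  have hadd := hle (x + y)
  have hsub := hle (x - y)
  have hparallelogram := parallelogram_law_with_norm ℝ (φ x) (φ y)
  rw [map_add] at hadd
  rw [map_sub] at hsub
  rw [hx, Complex.norm_real, norm_norm, ← hx] at hparallelogram
  unfold convexDefect at h
  exact norm_eq_zero.1 (sq_nonpos_iff _ |>.1 (by nlinarith))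

end ConvexDefect

section AlmostExtremal

variable {V : Type*} [NormedAddCommGroup V] [NormedSpace ℂ V]

theorem apply_inverse_pow_succ {B : V →L[ℂ] V} (hB : IsUnit B) (m : ℕ) (x : V) :
    B ((Ring.inverse B ^ (m + 1)) x) = (Ring.inverse B ^ m) x := by
  rw [pow_succ']
  exact apply_inverse_apply hB _

theorem exists_inv_lt_norm_inverse [Nontrivial V] {B : V →L[ℂ] V} {M : ℝ} (hB : IsUnit B)
    (hM : inverseGap B < M) : ∃ x : V, ‖x‖ < 1 ∧ M⁻¹ < ‖Ring.inverse B x‖ := by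
  refine ContinuousLinearMap.exists_lt_apply_of_lt_opNorm _ ?_
  have hpos := norm_inverse_pos hB
  rw [inverseGap_of_isUnit hB] at hM
  exact (inv_lt_comm₀ ((inv_pos.2 hpos).trans hM) hpos).2 hM

theorem convexDefect_inverse_pow_le [CompleteSpace V] [Nontrivial V] {s ρ : ℝ} (hs : 0 < s)
    (hρ : 0 < ρ) {B : V →L[ℂ] V}
    (hB : ∀ z : ℂ, ‖z‖ ≤ ρ → s ≤ inverseGap (B - z • ContinuousLinearMap.id ℂ V))
    {m : ℕ} (hm : m ≠ 0) {x : V} (hx : ‖x‖ ≤ 1) :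
    convexDefect (Ring.inverse B x) (((ρ ^ m / 2 : ℝ) : ℂ) • (Ring.inverse B ^ (m + 1)) x) ≤
      2 * s⁻¹ ^ 2 - 2 * ‖Ring.inverse B x‖ ^ 2 := by
  have hdisc : ∀ ζ : ℂ, ‖ζ‖ ≤ 1 → ‖Ring.inverse B x +
      ζ • ((ρ ^ m / 2 : ℝ) : ℂ) • (Ring.inverse B ^ (m + 1)) x‖ ^ 2 ≤ s⁻¹ ^ 2 := fun ζ hζ => by
    have h := ContinuousLinearMap.le_of_opNorm_le_of_le _
      (norm_inverse_add_smul_pow_le hs hρ hB hm hζ) hx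
    rw [mul_one] at h
    exact pow_le_pow_left₀ (norm_nonneg _) h 2
  have hadd := hdisc 1 (by simp)
  have hsub := hdisc (-1) (by simp)
  rw [one_smul] at hadd
  rw [neg_one_smul, ← sub_eq_add_neg] at hsub
  unfold convexDefect
  linarith

theorem exists_sq_mul_add_sq_lt (c : ℝ) {s : ℝ} (hs : 0 < s) :
    ∃ δ > 0, c * (s + δ) ^ 2 < (c + 1) * s ^ 2 := by
  have hlim : Tendsto (fun δ : ℝ => c * (s + δ) ^ 2) (𝓝[>] 0) (𝓝 (c * (s + 0) ^ 2)) :=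
    (Continuous.tendsto (by fun_prop) 0).mono_left nhdsWithin_le_nhds
  have hlt : c * (s + 0) ^ 2 < (c + 1) * s ^ 2 := by nlinarith [pow_pos hs 2]
  obtain ⟨δ, hδ, hpos⟩ := ((hlim.eventually_lt_const hlt).and self_mem_nhdsWithin).exists
  exact ⟨δ, hpos, hδ⟩

theorem exists_norm_sq_add_sum_convexDefect_lt [CompleteSpace V] [Nontrivial V] {s ρ : ℝ}
    (hs : 0 < s) (hρ : 0 < ρ) (n : ℕ) :
    ∃ δ > 0, ∀ B : V →L[ℂ] V,
      (∀ z : ℂ, ‖z‖ ≤ ρ → s ≤ inverseGap (B - z • ContinuousLinearMap.id ℂ V)) →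
      inverseGap B < s + δ → IsUnit B ∧ ∃ x : V, ‖Ring.inverse B x‖ ^ 2 +
          n * ∑ m ∈ Finset.Icc 1 n, convexDefect (Ring.inverse B x)
            (((ρ ^ m / 2 : ℝ) : ℂ) • (Ring.inverse B ^ (m + 1)) x) <
        3 * ‖Ring.inverse B x‖ ^ 2 := by
  obtain ⟨δ, hδ, hlt⟩ := exists_sq_mul_add_sq_lt ((n : ℝ) ^ 2) hs
  refine ⟨δ, hδ, fun B hB hgap => ?_⟩
  have hunit : IsUnit B := by
    refine isUnit_of_inverseGap_pos (hs.trans_le ?_)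
    simpa using hB 0 (by simpa using hρ.le)
  obtain ⟨x, hx, hlarge⟩ := exists_inv_lt_norm_inverse hunit hgap
  refine ⟨hunit, x, ?_⟩
  set E := ‖Ring.inverse B x‖
  have hsum : ∑ m ∈ Finset.Icc 1 n, convexDefect (Ring.inverse B x)
      (((ρ ^ m / 2 : ℝ) : ℂ) • (Ring.inverse B ^ (m + 1)) x) ≤ n * (2 * s⁻¹ ^ 2 - 2 * E ^ 2) := by
    refine (Finset.sum_le_card_nsmul _ _ _ fun m hm => convexDefect_inverse_pow_le hs hρ hB
      (Nat.one_le_iff_ne_zero.1 (Finset.mem_Icc.1 hm).1) hx.le).trans_eq ?_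
    rw [Nat.card_Icc, Nat.add_sub_cancel, nsmul_eq_mul]
  have hE : (s + δ)⁻¹ ^ 2 < E ^ 2 := pow_lt_pow_left₀ hlarge (by positivity) two_ne_zero
  have hinv : (n : ℝ) ^ 2 * s⁻¹ ^ 2 < ((n : ℝ) ^ 2 + 1) * (s + δ)⁻¹ ^ 2 := by
    rw [inv_pow, inv_pow, ← div_eq_mul_inv, ← div_eq_mul_inv,
      div_lt_div_iff₀ (by positivity) (by positivity)]
    exact hlt
  have hsum' := mul_le_mul_of_nonneg_left hsum (Nat.cast_nonneg (α := ℝ) n)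
  have hE' := mul_lt_mul_of_pos_left hE (show 0 < (n : ℝ) ^ 2 + 1 by positivity)
  nlinarith

end AlmostExtremal

theorem BiSeq.exists_localized {p : ℤ → ℝ≥0} (hp : ∑' i, (p i : ℝ≥0∞) ≤ 1) {n : ℕ}
    {x : BiSeq X} {y : ℕ → BiSeq X}
    (h : ‖x‖ ^ 2 + n * ∑ m ∈ Finset.Icc 1 n, convexDefect x (y m) < 3 * ‖x‖ ^ 2) :
    ∃ j, x j ≠ 0 ∧ ∀ i, p i * ‖x (j + i)‖ ^ 2 ≤ 3 * ‖x j‖ ^ 2 ∧ ∀ m ∈ Finset.Icc 1 n,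
      p i * (n * convexDefect (x (j + i)) (y m (j + i))) ≤ 3 * ‖x j‖ ^ 2 := by
  have hdefect : ∀ m j, 0 ≤ convexDefect (x j) (y m j) := fun _ _ => convexDefect_nonneg _ _
  have hnonneg : ∀ j, 0 ≤ n * ∑ m ∈ Finset.Icc 1 n, convexDefect (x j) (y m j) := fun j =>
    mul_nonneg n.cast_nonneg (Finset.sum_nonneg fun m _ => hdefect m j)
  obtain ⟨j, hj, hle⟩ := exists_le_mul_of_hasSum_lt hp (fun j => sq_nonneg ‖x j‖)
    (fun j => add_nonneg (sq_nonneg ‖x j‖) (hnonneg j)) x.hasSum_norm_sq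
    (x.hasSum_norm_sq.add ((hasSum_sum fun m _ => hasSum_convexDefect x (y m)).mul_left (n : ℝ)))
    zero_le_three h
  refine ⟨j, norm_ne_zero_iff.1 (sq_pos_iff.1 hj), fun i => ⟨?_, fun m hm => ?_⟩⟩
  · exact (mul_le_mul_of_nonneg_left (le_add_of_nonneg_right (hnonneg _))
      (p i).coe_nonneg).trans (hle i)
  · refine (mul_le_mul_of_nonneg_left ?_ (p i).coe_nonneg).trans (hle i)
    refine le_add_of_nonneg_of_le (sq_nonneg _) (mul_le_mul_of_nonneg_left ?_ n.cast_nonneg)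
    exact Finset.single_le_sum (f := fun m => convexDefect (x (j + i)) (y m (j + i)))
      (fun m _ => hdefect m _) hm

/-- A backward orbit `e` of the tridiagonal map with entries `a` that is normalised at the origin,
and whose first `n` members, rescaled by `c`, change the norm of `e 0` little near the origin; the
weight `p` says how near. -/
structure IsLocalizedBackwardOrbit (p : ℤ → ℝ≥0) (c : ℕ → ℂ) (n : ℕ) (a : ℤ → ℤ → X →L[ℂ] X)
    (e : ℕ → ℤ → X) : Prop where
  tridiagonalMap_succ : ∀ m, tridiagonalMap (fun i j => (a i j : X →ₗ[ℂ] X)) (e (m + 1)) = e m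
  norm_zero_zero : ‖e 0 0‖ = 1
  mul_norm_sq_le : ∀ i, p i * ‖e 0 i‖ ^ 2 ≤ 3
  mul_convexDefect_le : ∀ m ∈ Finset.Icc 1 n, ∀ i,
    p i * (n * convexDefect (e 0 i) (c m • e m i)) ≤ 3

/-- Restriction to the neighbourhood of a site where `E 0` is comparatively large, normalised. -/
theorem IsTridiagonal.exists_isLocalizedBackwardOrbit {B : BiSeq X →L[ℂ] BiSeq X}
    (hB : IsTridiagonal B) {p : ℤ → ℝ≥0} (hp : ∑' i, (p i : ℝ≥0∞) ≤ 1) {c : ℕ → ℂ} {n : ℕ}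
    {E : ℕ → BiSeq X} (hE : ∀ m, B (E (m + 1)) = E m)
    (h : ‖E 0‖ ^ 2 + n * ∑ m ∈ Finset.Icc 1 n, convexDefect (E 0) (c m • E m) < 3 * ‖E 0‖ ^ 2) :
    ∃ (a : ℤ → ℤ → X →L[ℂ] X) (e : ℕ → ℤ → X), (∀ i j, ‖a i j‖ ≤ ‖B‖) ∧
      IsLocalizedBackwardOrbit p c n a e := by
  obtain ⟨j, hj, hle⟩ := BiSeq.exists_localized hp h
  set t : ℂ := ((‖E 0 j‖⁻¹ : ℝ) : ℂ)
  have ht : ‖t‖ = ‖E 0 j‖⁻¹ := by rw [Complex.norm_real, norm_inv, norm_norm]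
  have hnormalise : ∀ {b y : ℝ}, b * y ≤ 3 * ‖E 0 j‖ ^ 2 → b * (‖t‖ ^ 2 * y) ≤ 3 :=
    fun {b y} hy => by
      rw [ht, mul_left_comm, inv_pow, inv_mul_le_iff₀ (by positivity), mul_comm _ (3 : ℝ)]
      exact hy
  refine ⟨fun i l => matrixEntry B (j + i) (j + l), fun m i => t • E m (j + i),
    fun i l => norm_matrixEntry_le B _ _, fun m => ?_, ?_, fun i => ?_, fun m hm i => ?_⟩
  · ext i
    rw [tridiagonalMap_apply, ← hE m, hB.apply_eq, smul_add, smul_add, ← map_smul, ← map_smul,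
      ← map_smul, add_sub_assoc, add_assoc j i 1]
    rfl
  · rw [add_zero, norm_smul, ht, inv_mul_cancel₀ (norm_ne_zero_iff.2 hj)]
  · rw [norm_smul, mul_pow]
    exact hnormalise (hle i).1
  · rw [smul_comm, convexDefect_smul, mul_left_comm (n : ℝ)]
    exact hnormalise ((hle i).2 m hm)

namespace IsLocalizedBackwardOrbit

variable {p : ℤ → ℝ≥0} {c : ℕ → ℂ}

theorem convexDefect_le {n : ℕ} {a : ℤ → ℤ → X →L[ℂ] X} {e : ℕ → ℤ → X}
    (h : IsLocalizedBackwardOrbit p c n a e) {i : ℤ} (hp : 0 < p i) {m : ℕ}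
    (hm : m ∈ Finset.Icc 1 n) : convexDefect (e 0 i) (c m • e m i) ≤ 3 / p i / n := by
  have hn : 0 < n := (Finset.mem_Icc.1 hm).1.trans (Finset.mem_Icc.1 hm).2
  rw [le_div_iff₀' (Nat.cast_pos.2 hn), le_div_iff₀' (NNReal.coe_pos.2 hp)]
  exact h.mul_convexDefect_le m hm i

theorem exists_norm_le {i : ℤ} (hp : 0 < p i) {m : ℕ} (hc : c m ≠ 0) :
    ∃ K, ∀ (n : ℕ) (a : ℤ → ℤ → X →L[ℂ] X) (e : ℕ → ℤ → X),
      IsLocalizedBackwardOrbit p c n a e → m ≤ n → ‖e m i‖ ≤ K := by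
  have hzero : ∀ {n : ℕ} {a : ℤ → ℤ → X →L[ℂ] X} {e : ℕ → ℤ → X},
      IsLocalizedBackwardOrbit p c n a e → ‖e 0 i‖ ^ 2 ≤ 3 / p i := fun h =>
    (le_div_iff₀' (NNReal.coe_pos.2 hp)).2 (h.mul_norm_sq_le i)
  rcases Nat.eq_zero_or_pos m with rfl | hm
  · exact ⟨√(3 / p i), fun n a e h _ => Real.le_sqrt_of_sq_le (hzero h)⟩
  refine ⟨√(3 * (3 / p i)) / ‖c m‖, fun n a e h hmn => ?_⟩
  rw [le_div_iff₀' (norm_pos_iff.2 hc), ← norm_smul]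
  refine Real.le_sqrt_of_sq_le ?_
  have hdefect : convexDefect (e 0 i) (c m • e m i) ≤ 3 / p i :=
    (h.convexDefect_le hp (Finset.mem_Icc.2 ⟨hm, hmn⟩)).trans
      (div_le_self (by positivity) (Nat.one_le_cast.2 (hm.trans_le hmn)))
  linarith [two_mul_norm_sq_le_convexDefect (e 0 i) (c m • e m i), hzero h, norm_nonneg (e 0 i),
    show (0 : ℝ) ≤ 3 / p i by positivity]

end IsLocalizedBackwardOrbit

theorem exists_tendsto_hyperfilter {Y : Type*} [SeminormedAddCommGroup Y] [ProperSpace Y]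
    {x : ℕ → Y} {K : ℝ} (h : ∀ᶠ n in atTop, ‖x n‖ ≤ K) :
    ∃ z, Tendsto x (hyperfilter ℕ : Filter ℕ) (𝓝 z) := by
  have hmem : ∀ᶠ n in (hyperfilter ℕ : Filter ℕ), x n ∈ Metric.closedBall 0 K :=
    (h.mono fun n hn => mem_closedBall_zero_iff.2 hn).filter_mono Nat.hyperfilter_le_atTop
  obtain ⟨z, -, hz⟩ := (isCompact_closedBall 0 K).ultrafilter_le_nhds ((hyperfilter ℕ).map x)
    (le_principal_iff.2 hmem)
  exact ⟨z, hz⟩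

theorem exists_limit_isLocalizedBackwardOrbit [FiniteDimensional ℂ X] {p : ℤ → ℝ≥0}
    (hp : ∀ i, 0 < p i) {c : ℕ → ℂ} (hc : ∀ m, c m ≠ 0) {a : ℕ → ℤ → ℤ → X →L[ℂ] X} {C : ℝ}
    (ha : ∀ n i j, ‖a n i j‖ ≤ C) {e : ℕ → ℕ → ℤ → X}
    (he : ∀ n, IsLocalizedBackwardOrbit p c n (a n) (e n)) :
    ∃ (a' : ℤ → ℤ → X →ₗ[ℂ] X) (e' : ℕ → ℤ → X), (∀ m, tridiagonalMap a' (e' (m + 1)) = e' m) ∧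
      ‖e' 0 0‖ = 1 ∧ ∀ m, m ≠ 0 → ∀ i, convexDefect (e' 0 i) (c m • e' m i) ≤ 0 := by
  have := FiniteDimensional.proper ℂ X
  have := FiniteDimensional.proper ℂ (X →L[ℂ] X)
  have hbound : ∀ m i, ∃ K, ∀ᶠ n in atTop, ‖e n m i‖ ≤ K := fun m i => by
    obtain ⟨K, hK⟩ := IsLocalizedBackwardOrbit.exists_norm_le (X := X) (hp i) (hc m)
    exact ⟨K, (eventually_ge_atTop m).mono fun n hn => hK n _ _ (he n) hn⟩
  choose K hK using hbound
  choose e' he' using fun m i => exists_tendsto_hyperfilter (hK m i)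
  choose a' ha' using fun i j =>
    exists_tendsto_hyperfilter (Eventually.of_forall fun n => ha n i j)
  refine ⟨fun i j => a' i j, e', fun m => ?_, ?_, fun m hm i => ?_⟩
  · ext i
    have hterm : ∀ k, Tendsto (fun n => a n i k (e n (m + 1) k)) (hyperfilter ℕ : Filter ℕ)
        (𝓝 (a' i k (e' (m + 1) k))) := fun k =>
      ((isBoundedBilinearMap_apply (𝕜 := ℂ) (E := X) (F := X)).continuous.tendsto _).comp
        ((ha' i k).prodMk_nhds (he' (m + 1) k))
    refine tendsto_nhds_unique (((hterm _).add (hterm _)).add (hterm _)) ?_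
    exact (he' m i).congr fun n => congrFun ((he n).tridiagonalMap_succ m).symm i
  · exact tendsto_nhds_unique (he' 0 0).norm
      (tendsto_const_nhds.congr fun n => (he n).norm_zero_zero.symm)
  · refine le_of_tendsto_of_tendsto
      ((continuous_convexDefect.tendsto _).comp
        ((he' 0 i).prodMk_nhds ((he' m i).const_smul (c m))))
      ((tendsto_const_div_atTop_nhds_zero_nat (3 / (p i : ℝ))).mono_left
        Nat.hyperfilter_le_atTop) (Eventually.filter_mono Nat.hyperfilter_le_atTop ?_)
    exact (eventually_ge_atTop m).mono fun n hn =>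
      (he n).convexDefect_le (hp i) (Finset.mem_Icc.2 ⟨Nat.one_le_iff_ne_zero.2 hm, hn⟩)

theorem false_of_backwardOrbit_of_convexDefect_le [FiniteDimensional ℂ X]
    {a : ℤ → ℤ → X →ₗ[ℂ] X} {e : ℕ → ℤ → X} (he : ∀ m, tridiagonalMap a (e (m + 1)) = e m)
    (h0 : e 0 0 ≠ 0) {c : ℕ → ℂ} (hc : ∀ m, c m ≠ 0)
    (hdefect : ∀ m, m ≠ 0 → ∀ i, convexDefect (e 0 i) (c m • e m i) ≤ 0) : False := by
  choose φ hφ hφe using fun i => exists_dual_vector'' ℂ (e 0 i)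
  refine false_of_backwardOrbit (φ := fun j => (φ j : X →ₗ[ℂ] ℂ)) he h0 (fun j hj hφj => ?_)
    (fun m hm j => ?_) fun j hj m => ?_
  · exact hj (norm_eq_zero.1 (Complex.ofReal_eq_zero.1 ((hφe j).symm.trans hφj)))
  · have h := apply_eq_zero_of_convexDefect_le (hdefect m (Nat.one_le_iff_ne_zero.1 hm) j) (hφ j)
      (hφe j)
    rw [map_smul, smul_eq_mul] at h
    exact (mul_eq_zero.1 h).resolve_left (hc m)
  · rcases eq_or_ne m 0 with rfl | hm
    · exact hj
    have h := (two_mul_norm_sq_le_convexDefect (e 0 j) (c m • e m j)).trans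
      (add_le_add_left (hdefect m hm j) _)
    rw [hj, norm_zero] at h
    have hsmul : c m • e m j = 0 := norm_eq_zero.1 (sq_nonpos_iff _ |>.1 (by linarith))
    exact (smul_eq_zero.1 hsmul).resolve_left (hc m)

variable [CompleteSpace X] [Nontrivial X]

theorem uniformMaximumPrinciple_of_finiteDimensional [FiniteDimensional ℂ X] :
    UniformMaximumPrinciple {B : BiSeq X →L[ℂ] BiSeq X | IsTridiagonal B} := by
  intro C r s hr hs
  obtain ⟨p, hp, hpsum⟩ := ENNReal.exists_pos_sum_of_countable (one_ne_zero (α := ℝ≥0∞)) ℤ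
  by_contra! hcon
  set c : ℕ → ℂ := fun m => (((r / 2) ^ m / 2 : ℝ) : ℂ)
  have hc : ∀ m, c m ≠ 0 := fun m => Complex.ofReal_ne_zero.2 (by positivity)
  have horbit : ∀ n : ℕ, ∃ (a : ℤ → ℤ → X →L[ℂ] X) (e : ℕ → ℤ → X), (∀ i j, ‖a i j‖ ≤ C) ∧
      IsLocalizedBackwardOrbit p c n a e := fun n => by
    obtain ⟨δ, hδ, hextremal⟩ :=
      exists_norm_sq_add_sum_convexDefect_lt (V := BiSeq X) hs (half_pos hr) n
    obtain ⟨B, hB, hBC, hBz, hBδ⟩ := hcon δ hδ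
    obtain ⟨hunit, x, hx⟩ := hextremal B (fun z hz => hBz z (hz.trans_lt (half_lt_self hr))) hBδ
    obtain ⟨a, e, ha, he⟩ := IsTridiagonal.exists_isLocalizedBackwardOrbit hB hpsum.le (c := c)
      (E := fun m => (Ring.inverse B ^ (m + 1)) x)
      (fun m => apply_inverse_pow_succ hunit (m + 1) x) (by simpa only [zero_add, pow_one] using hx)
    exact ⟨a, e, fun i j => (ha i j).trans hBC, he⟩
  choose a e ha he using horbit
  obtain ⟨a', e', horbit, hnorm, hdefect⟩ := exists_limit_isLocalizedBackwardOrbit hp hc ha he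
  have h0 : e' 0 0 ≠ 0 := norm_ne_zero_iff.1 (hnorm ▸ one_ne_zero)
  exact false_of_backwardOrbit_of_convexDefect_le horbit h0 hc hdefect

theorem GlobevnikProperty.uniformMaximumPrinciple (hX : GlobevnikProperty X) :
    UniformMaximumPrinciple {B : BiSeq X →L[ℂ] BiSeq X | IsTridiagonal B} := by
  rcases hX with h | h | h
  · exact uniformMaximumPrinciple_of_finiteDimensional
  · exact h.biSeq.uniformMaximumPrinciple _
  · exact h.dual_biSeq.uniformMaximumPrinciple_of_dual _

end Localization

/-! ### Extending operators from a window -/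

section WindowExtension

variable {X : Type*} [NormedAddCommGroup X] [NormedSpace ℂ X]

theorem norm_windowEmbed_add_sq (n : ℕ) (k : ℤ) (y : PiLp 2 (fun _ : Fin n => X)) {x : BiSeq X}
    (hx : windowRestrict X n k x = 0) :
    ‖windowEmbed X n k y + x‖ ^ 2 = ‖y‖ ^ 2 + ‖x‖ ^ 2 := by
  have hcoord : ∀ j, ‖(windowEmbed X n k y + x) j‖ ^ 2 =
      ‖windowEmbed X n k y j‖ ^ 2 + ‖x j‖ ^ 2 := by
    intro j
    rw [lp.coeFn_add, Pi.add_apply]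
    by_cases h : k + 1 ≤ j ∧ j ≤ k + n
    · have hj := windowEmbed_restrict_apply n k x j
      rw [hx, map_zero, if_pos h, lp.coeFn_zero, Pi.zero_apply] at hj
      simp [← hj]
    · simp [windowEmbed_apply_notMem n k y h]
  have hsum := BiSeq.hasSum_norm_sq (windowEmbed X n k y + x)
  simp only [hcoord] at hsum
  rw [← norm_windowEmbed_apply n k y]
  exact hsum.unique ((BiSeq.hasSum_norm_sq _).add (BiSeq.hasSum_norm_sq x))

/-- The operator on `ℓ²(ℤ, X)` that acts as `G` on the window `{k+1, …, k+n}` and as the scalar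
`t` outside of it. It turns all finite sections, whatever their size and position, into operators
on one and the same space. -/
def windowExtend {n : ℕ} (k : ℤ)
    (G : PiLp 2 (fun _ : Fin n => X) →L[ℂ] PiLp 2 (fun _ : Fin n => X)) (t : ℂ) :
    BiSeq X →L[ℂ] BiSeq X :=
  (windowEmbed X n k).comp (G.comp (windowRestrict X n k)) +
    t • (ContinuousLinearMap.id ℂ (BiSeq X) - (windowEmbed X n k).comp (windowRestrict X n k))

variable {n : ℕ} {k : ℤ} {G H : PiLp 2 (fun _ : Fin n => X) →L[ℂ] PiLp 2 (fun _ : Fin n => X)}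
  {t u : ℂ}

theorem windowExtend_apply (x : BiSeq X) : windowExtend k G t x =
    windowEmbed X n k (G (windowRestrict X n k x)) +
      t • (x - windowEmbed X n k (windowRestrict X n k x)) := rfl

theorem windowRestrict_sub_embed (x : BiSeq X) :
    windowRestrict X n k (x - windowEmbed X n k (windowRestrict X n k x)) = 0 := by
  rw [map_sub, windowRestrict_embed, sub_self]

theorem windowRestrict_windowExtend (x : BiSeq X) :
    windowRestrict X n k (windowExtend k G t x) = G (windowRestrict X n k x) := by
  rw [windowExtend_apply, map_add, map_smul, windowRestrict_sub_embed, smul_zero, add_zero,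
    windowRestrict_embed]

theorem windowExtend_windowEmbed (y : PiLp 2 (fun _ : Fin n => X)) :
    windowExtend k G t (windowEmbed X n k y) = windowEmbed X n k (G y) := by
  rw [windowExtend_apply, windowRestrict_embed, sub_self, smul_zero, add_zero]

theorem windowExtend_mul :
    windowExtend k G t * windowExtend k H u = windowExtend k (G * H) (t * u) := by
  ext1 x
  change windowExtend k G t (windowExtend k H u x) = _
  rw [windowExtend_apply, windowRestrict_windowExtend, windowExtend_apply, windowExtend_apply,
    add_sub_cancel_left, smul_smul]
  rfl

theorem windowExtend_one : windowExtend k (1 : PiLp 2 (fun _ : Fin n => X) →L[ℂ] _) 1 = 1 := by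
  ext1 x
  rw [windowExtend_apply, one_smul]
  exact add_sub_cancel _ _

theorem windowExtend_sub_smul (z : ℂ) :
    windowExtend k G t - z • ContinuousLinearMap.id ℂ (BiSeq X) =
      windowExtend k (G - z • ContinuousLinearMap.id ℂ _) (t - z) := by
  ext1 x
  change windowExtend k G t x - z • x =
    windowEmbed X n k (G (windowRestrict X n k x) - z • windowRestrict X n k x) +
      (t - z) • (x - windowEmbed X n k (windowRestrict X n k x))
  rw [windowExtend_apply, map_sub, map_smul]
  module

theorem isUnit_windowExtend (hG : IsUnit G) (ht : t ≠ 0) : IsUnit (windowExtend k G t) := by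
  refine ⟨⟨windowExtend k G t, windowExtend k (Ring.inverse G) t⁻¹, ?_, ?_⟩, rfl⟩
  · rw [windowExtend_mul, Ring.mul_inverse_cancel _ hG, mul_inv_cancel₀ ht, windowExtend_one]
  · rw [windowExtend_mul, Ring.inverse_mul_cancel _ hG, inv_mul_cancel₀ ht, windowExtend_one]

theorem norm_windowExtend_apply_sq (x : BiSeq X) : ‖windowExtend k G t x‖ ^ 2 =
    ‖G (windowRestrict X n k x)‖ ^ 2 +
      (‖t‖ * ‖x - windowEmbed X n k (windowRestrict X n k x)‖) ^ 2 := by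
  have hzero : windowRestrict X n k (t • (x - windowEmbed X n k (windowRestrict X n k x))) = 0 := by
    rw [map_smul, windowRestrict_sub_embed, smul_zero]
  rw [windowExtend_apply, norm_windowEmbed_add_sq _ _ _ hzero, norm_smul]

theorem norm_sq_eq_windowRestrict_add (n : ℕ) (k : ℤ) (x : BiSeq X) : ‖x‖ ^ 2 =
    ‖windowRestrict X n k x‖ ^ 2 + ‖x - windowEmbed X n k (windowRestrict X n k x)‖ ^ 2 := by
  rw [← norm_windowEmbed_add_sq n k _ (windowRestrict_sub_embed x), add_sub_cancel]

theorem norm_windowExtend_le : ‖windowExtend k G t‖ ≤ max ‖G‖ ‖t‖ := by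
  refine ContinuousLinearMap.opNorm_le_bound _ (le_max_of_le_left (norm_nonneg _)) fun x => ?_
  refine le_of_sq_le_sq ?_ (by positivity)
  rw [norm_windowExtend_apply_sq, mul_pow (max _ _), norm_sq_eq_windowRestrict_add n k x, mul_add,
    ← mul_pow, ← mul_pow]
  gcongr
  · exact (G.le_opNorm _).trans (mul_le_mul_of_nonneg_right (le_max_left _ _) (norm_nonneg _))
  · exact le_max_right _ _

theorem le_inverseGap_windowExtend [Nontrivial X] {s : ℝ} (hs : 0 < s) (hG : s ≤ inverseGap G)
    (ht : s ≤ ‖t‖) : s ≤ inverseGap (windowExtend k G t) := by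
  refine le_inverseGap_of_forall (isUnit_windowExtend (isUnit_of_inverseGap_pos (hs.trans_le hG))
    (norm_pos_iff.1 (hs.trans_le ht))) fun x => ?_
  refine le_of_sq_le_sq ?_ (norm_nonneg _)
  rw [norm_windowExtend_apply_sq, mul_pow, norm_sq_eq_windowRestrict_add n k x, mul_add, ← mul_pow,
    ← mul_pow]
  gcongr
  exact (mul_le_mul_of_nonneg_right hG (norm_nonneg _)).trans (inverseGap_mul_norm_le G _)

theorem le_inverseGap_of_windowExtend [NeZero n] [Nontrivial X] {s : ℝ}
    (hG : IsUnit G) (h : s ≤ inverseGap (windowExtend k G t)) : s ≤ inverseGap G := by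
  refine le_inverseGap_of_forall hG fun y => ?_
  rw [← norm_windowEmbed_apply n k y, ← norm_windowEmbed_apply n k (G y),
    ← windowExtend_windowEmbed (t := t)]
  exact (mul_le_mul_of_nonneg_right h (norm_nonneg _)).trans (inverseGap_mul_norm_le _ _)

theorem matrixEntry_windowExtend_finiteSection {A : BiSeq X →L[ℂ] BiSeq X} {i j : ℤ} (hij : i ≠ j)
    (h : matrixEntry A i j = 0) :
    matrixEntry (windowExtend k (finiteSection A n k) t) i j = 0 := by
  ext x
  rw [matrixEntry_apply, windowExtend_apply, finiteSection_eq_comp, lp.coeFn_add, Pi.add_apply,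
    lp.coeFn_smul, Pi.smul_apply, lp.coeFn_sub, Pi.sub_apply, ContinuousLinearMap.comp_apply,
    ContinuousLinearMap.comp_apply, windowEmbed_restrict_apply, zero_apply]
  by_cases hj : k + 1 ≤ j ∧ j ≤ k + n
  · rw [windowEmbed_restrict_single n k hj, sub_self, smul_zero, add_zero, ← matrixEntry_apply, h,
      zero_apply, ite_self]
  · simp only [windowRestrict_single_of_notMem n k hj, map_zero, BiSeq.single_apply, if_neg hij,
      lp.coeFn_zero, Pi.zero_apply, ite_self, sub_self, smul_zero, add_zero]

theorem IsTridiagonal.windowExtend_finiteSection {A : BiSeq X →L[ℂ] BiSeq X}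
    (hA : IsTridiagonal A) (n : ℕ) (k : ℤ) (t : ℂ) :
    IsTridiagonal (windowExtend k (finiteSection A n k) t) := fun i j hij =>
  matrixEntry_windowExtend_finiteSection (by rintro rfl; simp at hij) (hA i j hij)

end WindowExtension

/-! ### Limits of the pseudospectra of finite sections -/

section FiniteDimensional

variable {Y : Type*} [NormedAddCommGroup Y] [NormedSpace ℂ Y] [FiniteDimensional ℂ Y]

theorem pow_finrank_le_norm_det {B : Y →ₗ[ℂ] Y} {r : ℝ} (hr : 0 ≤ r)
    (h : ∀ μ, Module.End.HasEigenvalue B μ → r ≤ ‖μ‖) :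
    r ^ Module.finrank ℂ Y ≤ ‖LinearMap.det B‖ := by
  have hsplits : B.charpoly.Splits := IsAlgClosed.splits _
  have hdet : LinearMap.det B = B.charpoly.roots.prod := by
    rw [LinearMap.det_eq_sign_charpoly_coeff,
      hsplits.coeff_zero_eq_prod_roots_of_monic (LinearMap.charpoly_monic B),
      LinearMap.charpoly_natDegree, ← mul_assoc, ← mul_pow, neg_one_mul, neg_neg, one_pow, one_mul]
  have hcard : Module.finrank ℂ Y = B.charpoly.roots.card := by
    rw [← hsplits.natDegree_eq_card_roots, LinearMap.charpoly_natDegree]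
  calc r ^ Module.finrank ℂ Y = (B.charpoly.roots.map fun _ => r).prod := by
        rw [hcard, Multiset.map_const', Multiset.prod_replicate]
    _ ≤ (B.charpoly.roots.map fun μ => ‖μ‖).prod :=
        Multiset.prod_map_le_prod_map₀ _ _ (fun _ _ => hr) fun μ hμ =>
          h μ <| (Module.End.hasEigenvalue_iff_isRoot_charpoly B μ).2 <|
            Polynomial.isRoot_of_mem_roots hμ
    _ = ‖LinearMap.det B‖ := by
        rw [hdet]
        exact (map_multiset_prod (normHom : ℂ →*₀ ℝ) _).symm

theorem exists_le_inverseGap_of_finiteDimensional [Nontrivial Y] (C : ℝ) {r : ℝ} (hr : 0 < r) :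
    ∃ δ > 0, ∀ B : Y →L[ℂ] Y, ‖B‖ ≤ C →
      (∀ z : ℂ, ‖z‖ < r → IsUnit (B - z • ContinuousLinearMap.id ℂ Y)) → δ ≤ inverseGap B := by
  have := FiniteDimensional.complete ℂ Y
  have := FiniteDimensional.proper ℂ (Y →L[ℂ] Y)
  have hcompact : IsCompact
      (Metric.closedBall 0 C ∩ {B : Y →L[ℂ] Y | r ^ Module.finrank ℂ Y ≤ ‖B.det‖}) :=
    (isCompact_closedBall _ _).inter_right
      (isClosed_le continuous_const ContinuousLinearMap.continuous_det.norm)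
  obtain ⟨δ, hδ, hle⟩ := hcompact.exists_forall_le' lipschitzWith_inverseGap.continuous.continuousOn
    (a := 0) fun B hB => by
      have hdet : B.det ≠ 0 := norm_pos_iff.1 ((pow_pos hr _).trans_le hB.2)
      have hunit : IsUnit B := by
        rwa [ContinuousLinearMap.isUnit_iff_isUnit_toLinearMap, LinearMap.isUnit_iff_isUnit_det,
          isUnit_iff_ne_zero]
      rw [inverseGap_of_isUnit hunit]
      exact inv_pos.2 (norm_inverse_pos hunit)
  refine ⟨δ, hδ, fun B hBC hB => hle B ⟨mem_closedBall_zero_iff.2 hBC, ?_⟩⟩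
  refine pow_finrank_le_norm_det hr.le fun μ hμ => ?_
  by_contra! hlt
  obtain ⟨v, hv⟩ := hμ.exists_hasEigenvector
  have hzero : (B - μ • ContinuousLinearMap.id ℂ Y) v = 0 := sub_eq_zero.2 hv.apply_eq_smul
  apply hv.2
  rw [← inverse_apply_apply (hB μ hlt) v, hzero, map_zero]

end FiniteDimensional

section SpectralInclusion

variable {X : Type*} [NormedAddCommGroup X] [NormedSpace ℂ X] [CompleteSpace X] [Nontrivial X]
  {A : BiSeq X →L[ℂ] BiSeq X}

theorem GlobevnikProperty.exists_le_inverseGap_finiteSection (hX : GlobevnikProperty X)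
    (hA : IsTridiagonal A) {n : ℕ} [NeZero n] {r s : ℝ} (hr : 0 < r) (hs : 0 < s)
    (h : ∀ (k : ℤ) (z : ℂ), ‖z‖ < r →
      s ≤ inverseGap (finiteSection A n k - z • ContinuousLinearMap.id ℂ _)) :
    ∃ δ > 0, ∀ k, s + δ ≤ inverseGap (finiteSection A n k) := by
  set t : ℂ := ((r + s : ℝ) : ℂ)
  have ht : ‖t‖ = r + s := Complex.norm_of_nonneg (by positivity)
  obtain ⟨δ, hδ, hmax⟩ := hX.uniformMaximumPrinciple (max ‖A‖ ‖t‖) r s hr hs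
  refine ⟨δ, hδ, fun k => ?_⟩
  have hcenter := h k 0 (by rwa [norm_zero])
  rw [← finiteSection_sub_smul, zero_smul, sub_zero] at hcenter
  have hunit := isUnit_of_inverseGap_pos (hs.trans_le hcenter)
  refine le_inverseGap_of_windowExtend hunit (hmax (windowExtend k (finiteSection A n k) t)
    (hA.windowExtend_finiteSection n k t)
    (norm_windowExtend_le.trans (max_le_max_right _ (norm_finiteSection_le n k A))) fun z hz => ?_)
  rw [windowExtend_sub_smul]
  exact le_inverseGap_windowExtend hs (h k z hz) (by linarith [norm_sub_norm_le t z])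

omit [CompleteSpace X] in
theorem exists_le_inverseGap_finiteSection_of_finiteDimensional [FiniteDimensional ℂ X]
    (A : BiSeq X →L[ℂ] BiSeq X) {n : ℕ} [NeZero n] {r : ℝ} (hr : 0 < r)
    (h : ∀ (k : ℤ) (z : ℂ), ‖z‖ < r →
      0 < inverseGap (finiteSection A n k - z • ContinuousLinearMap.id ℂ _)) :
    ∃ δ > 0, ∀ k, δ ≤ inverseGap (finiteSection A n k) := by
  obtain ⟨δ, hδ, hle⟩ := exists_le_inverseGap_of_finiteDimensional
    (Y := PiLp 2 (fun _ : Fin n => X)) ‖A‖ hr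
  exact ⟨δ, hδ, fun k => hle _ (norm_finiteSection_le n k A) fun z hz =>
    isUnit_of_inverseGap_pos (h k z hz)⟩

theorem GlobevnikProperty.exists_inverseGap_finiteSection_le (hX : GlobevnikProperty X)
    (hA : IsTridiagonal A) {ε : ℝ} (hε : 0 ≤ ε)
    (h : 0 < ε ∨ ¬ IsDiagonalOperator A ∨ FiniteDimensional ℂ X) {n : ℕ} (hn : 1 ≤ n)
    (hgap : inverseGap A ≤ ε) {r : ℝ} (hr : 0 < r) :
    ∃ (k : ℤ) (z : ℂ), ‖z‖ < r ∧ inverseGap (finiteSection A n k - z • ContinuousLinearMap.id ℂ _) ≤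
      ε + tauPenalty A n := by
  have : NeZero n := ⟨Nat.one_le_iff_ne_zero.1 hn⟩
  have hpenalty := tauPenalty_nonneg A hn
  by_contra! hlarge
  have hgain : ∃ δ > 0, ∀ k, ε + tauPenalty A n + δ ≤ inverseGap (finiteSection A n k) := by
    rcases (add_nonneg hε hpenalty).eq_or_lt with hzero | hpos
    · have hfin : FiniteDimensional ℂ X := by
        rcases h with h | h | h
        · linarith
        · linarith [tauPenalty_pos hA h hn]
        · exact h
      simp only [← hzero, zero_add] at hlarge ⊢
      exact exists_le_inverseGap_finiteSection_of_finiteDimensional A hr hlarge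
    · exact hX.exists_le_inverseGap_finiteSection hA hr hpos fun k z hz => (hlarge k z hz).le
  obtain ⟨δ, hδ, hle⟩ := hgain
  obtain ⟨k, hlt⟩ := hA.exists_inverseGap_finiteSection_lt hn (lt_add_of_le_of_pos hgap hδ)
  linarith [hle k]

omit [CompleteSpace X] [Nontrivial X] in
theorem isDiagonalOperator_sub_smul_iff (z : ℂ) :
    IsDiagonalOperator (A - z • ContinuousLinearMap.id ℂ _) ↔ IsDiagonalOperator A :=
  forall₂_congr fun i j => forall_congr' fun h => by rw [matrixEntry_sub_smul z h]

theorem sub_smul_sub_smul {V : Type*} [NormedAddCommGroup V] [NormedSpace ℂ V] (B : V →L[ℂ] V)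
    (w z : ℂ) : B - w • ContinuousLinearMap.id ℂ V - z • ContinuousLinearMap.id ℂ V =
      B - (w + z) • ContinuousLinearMap.id ℂ V := by
  rw [add_smul, sub_sub]

theorem GlobevnikProperty.closedPseudospectrum_subset_tauClosedSet (hX : GlobevnikProperty X)
    (hA : IsTridiagonal A) {ε : ℝ} (hε : 0 ≤ ε)
    (h : 0 < ε ∨ ¬ IsDiagonalOperator A ∨ FiniteDimensional ℂ X) {n : ℕ} (hn : 1 ≤ n) :
    closedPseudospectrum A ε ⊆ tauClosedSet A n (ε + tauPenalty A n) := by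
  have : NeZero n := ⟨Nat.one_le_iff_ne_zero.1 hn⟩
  intro w hw
  refine Metric.mem_closure_iff.2 fun r hr => ?_
  obtain ⟨k, z, hz, hle⟩ := hX.exists_inverseGap_finiteSection_le (hA.sub_smul w) hε
    (by rwa [isDiagonalOperator_sub_smul_iff]) hn ((mem_closedPseudospectrum_iff hε).1 hw) hr
  rw [finiteSection_sub_smul, sub_smul_sub_smul, tauPenalty_sub_smul] at hle
  exact ⟨w + z, Set.mem_iUnion.2 ⟨k, (mem_closedPseudospectrum_iff
    (add_nonneg hε (tauPenalty_nonneg A hn))).2 hle⟩, by rwa [dist_self_add_right]⟩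

theorem GlobevnikProperty.closedPseudospectrum_subset_closure (hX : GlobevnikProperty X)
    (hA : IsTridiagonal A) {ε : ℝ} (hε : 0 < ε) :
    closedPseudospectrum A ε ⊆ closure (openPseudospectrum A ε) := by
  intro w hw
  refine Metric.mem_closure_iff.2 fun r hr => ?_
  by_contra! hfar
  obtain ⟨δ, hδ, hmax⟩ := hX.uniformMaximumPrinciple
    ‖A - w • ContinuousLinearMap.id ℂ (BiSeq X)‖ r ε hr hε
  have hgain := hmax _ (hA.sub_smul w) le_rfl fun z hz => by
    rw [sub_smul_sub_smul]
    by_contra! hlt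
    have hdist := hfar _ ((mem_openPseudospectrum_iff hε).2 hlt)
    rw [dist_self_add_right] at hdist
    exact hz.not_ge hdist
  linarith [(mem_closedPseudospectrum_iff hε.le).1 hw]

end SpectralInclusion

section Convergence

theorem hausdorffTendsto_of_eventually_subset_cthickening {S : ℕ → Set ℂ} {T : Set ℂ}
    (hT : T.Nonempty) (hTb : Bornology.IsBounded T)
    (hS : ∀ n, 1 ≤ n → Bornology.IsBounded (S n)) (hTS : ∀ n, 1 ≤ n → T ⊆ closure (S n))
    (hST : ∀ ρ > 0, ∀ᶠ n in atTop, S n ⊆ Metric.cthickening ρ T) : HausdorffTendsto S T := by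
  have hne : ∀ n, 1 ≤ n → (S n).Nonempty := fun n hn =>
    closure_nonempty_iff.1 (hT.mono (hTS n hn))
  refine ⟨fun n hn => ⟨hne n hn, hS n hn⟩, hT, hTb, Metric.tendsto_nhds.2 fun ρ hρ => ?_⟩
  filter_upwards [hST (ρ / 2) (half_pos hρ), eventually_ge_atTop 1] with n hSn hn
  rw [Real.dist_0_eq_abs, abs_of_nonneg Metric.hausdorffDist_nonneg]
  refine (Metric.hausdorffDist_le_of_infDist (half_pos hρ).le (fun x hx => ?_)
    fun x hx => ?_).trans_lt (half_lt_self hρ)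
  · exact ENNReal.toReal_le_of_le_ofReal (half_pos hρ).le (Metric.mem_cthickening_iff.1 (hSn hx))
  · rw [(Metric.mem_closure_iff_infDist_zero (hne n hn)).1 (hTS n hn hx)]
    exact (half_pos hρ).le

theorem isBounded_closedPseudospectrum {Y : Type*} [NormedAddCommGroup Y] [NormedSpace ℂ Y]
    [CompleteSpace Y] [Nontrivial Y] (B : Y →L[ℂ] Y) {ε : ℝ} (hε : 0 ≤ ε) :
    Bornology.IsBounded (closedPseudospectrum B ε) :=
  isBounded_iff_forall_norm_le.2 ⟨‖B‖ + ε, fun _ hz => norm_le_of_mem_closedPseudospectrum hε hz⟩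

theorem closedPseudospectrum_nonempty {Y : Type*} [NormedAddCommGroup Y] [NormedSpace ℂ Y]
    [CompleteSpace Y] [Nontrivial Y] (B : Y →L[ℂ] Y) {ε : ℝ} (hε : 0 ≤ ε) :
    (closedPseudospectrum B ε).Nonempty := by
  refine Set.Nonempty.mono (closedPseudospectrum_mono hε) ?_
  rw [closedPseudospectrum_zero]
  exact spectrum.nonempty B

variable {X : Type*} [NormedAddCommGroup X] [NormedSpace ℂ X] {A : BiSeq X →L[ℂ] BiSeq X}

theorem tauOpenSet_subset_tauClosedSet {n : ℕ} {ε : ℝ} :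
    tauOpenSet A n ε ⊆ tauClosedSet A n ε :=
  (Set.iUnion_mono fun _ => openPseudospectrum_subset_closedPseudospectrum).trans subset_closure

variable [CompleteSpace X] [Nontrivial X]

theorem isBounded_tauClosedSet (A : BiSeq X →L[ℂ] BiSeq X) {n : ℕ} (hn : 1 ≤ n) {ε : ℝ}
    (hε : 0 ≤ ε) : Bornology.IsBounded (tauClosedSet A n ε) := by
  have : NeZero n := ⟨Nat.one_le_iff_ne_zero.1 hn⟩
  refine (isBounded_iff_forall_norm_le.2 ⟨‖A‖ + ε, fun z hz => ?_⟩).closure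
  obtain ⟨k, hk⟩ := Set.mem_iUnion.1 hz
  linarith [norm_le_of_mem_closedPseudospectrum hε hk, norm_finiteSection_le n k A]

theorem TauNoSpectralPollution.eventually_tauClosedSet_subset (hpol : TauNoSpectralPollution A)
    {ε ρ : ℝ} (hε : 0 ≤ ε) (hρ : 0 < ρ) :
    ∀ᶠ n in atTop, tauClosedSet A n (ε + tauPenalty A n) ⊆
      Metric.cthickening ρ (closedPseudospectrum A ε) := by
  obtain ⟨η, hηpos, hη, hsub⟩ := hpol
  obtain ⟨τ, hτ, hτsub⟩ := exists_openPseudospectrum_subset_thickening A hε hρ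
  have hlim : Tendsto (fun n => tauPenalty A n + η n + η n) atTop (𝓝 0) := by
    simpa only [add_zero] using ((tendsto_tauPenalty A).add hη).add hη
  filter_upwards [hlim.eventually_lt_const hτ, eventually_ge_atTop 1] with n hlt hn
  have hradius : 0 ≤ ε + tauPenalty A n := add_nonneg hε (tauPenalty_nonneg A hn)
  have hsection : ∀ k, closedPseudospectrum (finiteSection A n k) (ε + tauPenalty A n) ⊆
      openPseudospectrum A (ε + τ) := fun k => calc
    _ ⊆ openPseudospectrum (finiteSection A n k) (ε + tauPenalty A n + η n) :=
      closedPseudospectrum_subset_openPseudospectrum hradius (lt_add_of_pos_right _ (hηpos n))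
    _ ⊆ openPseudospectrum A (ε + tauPenalty A n + η n + η n) :=
      hsub _ (add_pos_of_nonneg_of_pos hradius (hηpos n)) n hn k
    _ ⊆ openPseudospectrum A (ε + τ) := openPseudospectrum_mono (by linarith)
  exact (closure_mono ((Set.iUnion_subset hsection).trans hτsub)).trans
    (Metric.closure_thickening_subset_cthickening ρ _)

theorem hausdorffTendsto_tauClosedSet (hX : GlobevnikProperty X) (hA : IsTridiagonal A)
    (hpol : TauNoSpectralPollution A) {ε : ℝ} (hε : 0 ≤ ε)
    (h : 0 < ε ∨ ¬ IsDiagonalOperator A ∨ FiniteDimensional ℂ X) :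
    HausdorffTendsto (fun n => tauClosedSet A n (ε + tauPenalty A n))
      (closedPseudospectrum A ε) :=
  hausdorffTendsto_of_eventually_subset_cthickening (closedPseudospectrum_nonempty A hε)
    (isBounded_closedPseudospectrum A hε)
    (fun _ hn => isBounded_tauClosedSet A hn (add_nonneg hε (tauPenalty_nonneg A hn)))
    (fun _ hn => (hX.closedPseudospectrum_subset_tauClosedSet hA hε h hn).trans subset_closure)
    fun _ hρ => hpol.eventually_tauClosedSet_subset hε hρ

theorem hausdorffTendsto_tauOpenSet (hX : GlobevnikProperty X) (hA : IsTridiagonal A)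
    (hpol : TauNoSpectralPollution A) {ε : ℝ} (hε : 0 < ε) :
    HausdorffTendsto (fun n => tauOpenSet A n (ε + tauPenalty A n)) (openPseudospectrum A ε) := by
  refine hausdorffTendsto_of_eventually_subset_cthickening
    ((closedPseudospectrum_nonempty A le_rfl).mono
      (closedPseudospectrum_subset_openPseudospectrum le_rfl hε))
    ((isBounded_closedPseudospectrum A hε.le).subset openPseudospectrum_subset_closedPseudospectrum)
    (fun n hn => (isBounded_tauClosedSet A hn (add_nonneg hε.le (tauPenalty_nonneg A hn))).subset
      tauOpenSet_subset_tauClosedSet)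
    (fun n hn => (hA.openPseudospectrum_subset_tauOpenSet hn hε).trans subset_closure)
    fun ρ hρ => ?_
  filter_upwards [hpol.eventually_tauClosedSet_subset hε.le hρ] with n hn
  rw [← Metric.cthickening_closure]
  exact (tauOpenSet_subset_tauClosedSet.trans hn).trans
    (Metric.cthickening_subset_of_subset ρ (hX.closedPseudospectrum_subset_closure hA hε))

end Convergence

end

theorem theorem1p3 {X : Type*} [NormedAddCommGroup X] [NormedSpace ℂ X] [CompleteSpace X]
    [Nontrivial X] (hX : GlobevnikProperty X)
    (A : BiSeq X →L[ℂ] BiSeq X) (hA : IsTridiagonal A) (hpol : TauNoSpectralPollution A) :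
    (∀ ε : ℝ, 0 ≤ ε → (0 < ε ∨ ¬ IsDiagonalOperator A ∨ FiniteDimensional ℂ X) →
      HausdorffTendsto (fun n => tauClosedSet A n (ε + tauPenalty A n))
        (closedPseudospectrum A ε)) ∧
    ((¬ IsDiagonalOperator A ∨ FiniteDimensional ℂ X) →
      HausdorffTendsto (fun n => tauClosedSet A n (tauPenalty A n)) (spectrum ℂ A)) ∧
    (∀ ε : ℝ, 0 < ε →
      HausdorffTendsto (fun n => tauOpenSet A n (ε + tauPenalty A n))
        (openPseudospectrum A ε)) := by
  refine ⟨fun ε hε h => hausdorffTendsto_tauClosedSet hX hA hpol hε h, fun h => ?_,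
    fun ε hε => hausdorffTendsto_tauOpenSet hX hA hpol hε⟩
  have hzero := hausdorffTendsto_tauClosedSet hX hA hpol le_rfl (Or.inr h)
  simpa only [zero_add, closedPseudospectrum_zero] using hzero
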